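/- Let $F$ be a non-archimedean local field with ring of integers $\mathcal{O}$, uniformizer $\varpi$ and residue field $k=\mathbb{F}_q$ of characteristic $p$. Let $n,i$ be integers with $2\le i\le[(n-1)/2]$. For a perfect $k$-algebra $R$ let $W_{\mathcal{O}}(R)=\varprojlim_m W(R)\otimes_{W(k)}\mathcal{O}/\varpi^m$, so that $W_{\mathcal O}(R)/\varpi=R$. A lattice over $R$ is a finite projective $W_{\mathcal{O}}(R)$-submodule of $W_{\mathcal{O}}(R)[\frac1\varpi]^n$ which spans it; put $\mathcal{E}^0=W_{\mathcal{O}}(R)^n$. For a lattice $\mathcal{E}$ let $\mathcal{E}^\vee$ be its dual with respect to $\langle x,y\rangle=\sum_{j=1}^n x_jy_{n+1-j}$ and let $F(\mathcal{E})$ be its pullback along the $q$-th power Frobenius of $R$. A pair of lattices $\mathcal{M},\mathcal{N}$ is "bounded by $\mu\in\mathbb{Z}^n$", written $\mathcal{M}\dashrightarrow\mathcal{N}\preceq\mu$, if at every geometric point of $\mathrm{Spec}\,R$ one has $\mathcal{N}=g\mathcal{E}^0$ and $\mathcal{M}=g\varpi^\lambda\mathcal{E}^0$ for an invertible matrix $g$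 and a dominant $\lambda\preceq\mu$ (dominance order). For $\mu=(\mu_1,\dots,\mu_n)$ put $\mu^*=(-\mu_n,\dots,-\mu_1)$, and let $\varepsilon_1,\dots,\varepsilon_n$ be the standard basis of $\mathbb{Z}^n$. Put $\nu_{i,+}=\varepsilon_1+\cdots+\varepsilon_{i-1}$, $\nu_{i,-}=-\varepsilon_{n+1-i}-\cdots-\varepsilon_n$, $\nu_i=\nu_{i,+}+\nu_{i,-}$ and $\xi_i=\varepsilon_1+\cdots+\varepsilon_{2i-1}$. All spaces below are described by their points with values in perfect $k$-algebras $R$. Let $Y_i$ be the space of pairs of lattices $(\mathcal{E}_+,\mathcal{E}_-)$ with $\mathcal{E}_+\dashrightarrow\mathcal{E}^0\preceq\nu_{i,+}^*$, $\mathcal{E}_-\dashrightarrow\mathcal{E}^0\preceq\nu_{i,-}^*$, $\mathcal{E}_-\dashrightarrow\mathcal{E}_+\preceq\xi_i$ and $$\mathcal{E}_+\subset F(\mathcal{E}_-^\vee),\qquad \mathcal{E}_-\subset F(\mathcal{E}_+^\vee),\qquad \varpi F(\mathcal{E}_-^\vee)\subset\mathcal{E}_- .$$ Let $\pi_1^{-1}(Y_i)$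 be the space of triples $(\mathcal{E},\mathcal{E}_+,\mathcal{E}_-)$ with $(\mathcal{E}_+,\mathcal{E}_-)\in Y_i$, $\mathcal{E}\dashrightarrow\mathcal{E}_+\preceq\nu_{i,-}^*$ and $\mathcal{E}\dashrightarrow\mathcal{E}_-\preceq\nu_{i,+}^*$. Let $X_i\subset\pi_1^{-1}(Y_i)$ be the locus where $\mathcal{E}$ belongs to $X_{\mu^*,\nu_i^*}(\tau_i^*)$, that is, $\mathcal{E}\dashrightarrow\mathcal{E}^0\preceq\nu_i^*$ and $F(\mathcal{E}^\vee)\dashrightarrow\mathcal{E}\preceq(\varepsilon_1+\varepsilon_2)^*$. Then the following hold. 1. The map $(\mathcal{E}_+,\mathcal{E}_-)\mapsto(\varpi\mathcal{E}_+/\varpi\mathcal{E}^0\subset\mathcal{E}_- /\varpi\mathcal{E}^0\subset R^n)$ identifies $Y_i$, functorially in $R$, with the perfection of the Deligne–Lusztig variety $X_I([1])$ of the unitary similitude group $\mathrm{GU}_n$ over $\mathbb{F}_q$, where $I$ is the set of all simple reflections except $s_{i-1}$ and $s_{n-i}$; that is, with the space of flags $V_1\subset V_2\subset R^n$ of subbundles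 of ranks $i-1$ and $n-i$ which at every geometric point have a common refinement to a complete flag with the flag $F(V_2^\perp)\subset F(V_1^\perp)$. 2. On $Y_i$, $\mathscr{V}_i=\mathcal{E}_+/\mathcal{E}_-$ is a vector bundle of rank $2i-1$ over $R$, and $(\mathcal{E},\mathcal{E}_+,\mathcal{E}_-)\mapsto\mathscr{W}=\mathcal{E}/\mathcal{E}_-$ identifies $\pi_1^{-1}(Y_i)$, functorially in $R$, with the Grassmannian bundle $\mathrm{Par}_{t_i}(\mathscr{G}_{Y_i})$ over $Y_i$ of subbundles $\mathscr{W}\subset\mathscr{V}_i$ of rank $i-1$, where $\mathscr{G}_{Y_i}=\mathrm{Aut}(\mathscr{V}_i)$. 3. Let $\mathscr{W}^\perp\subset\mathcal{E}_-^\vee/\mathcal{E}_+^\vee$ be the annihilator of $\mathscr{W}$, and let $\phi_1\colon\mathcal{E}_+/\mathcal{E}_-\to F(\mathcal{E}_-^\vee)/F(\mathcal{E}_+^\vee)$ and $\phi_2\colon\mathcal{E}^0/\varpi\mathcal{E}^0\to\mathcal{E}_+/\mathcal{E}_-$ be the natural maps. The subspace $X_i$ of $\pi_1^{-1}(Y_i)\simeq\mathrm{Par}_{t_i}(\mathscr{G}_{Y_i})$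 is closed, and it is defined by the single condition $\phi_1(\mathscr{W})\subset F(\mathscr{W}^\perp)$. 4. The condition $\phi_2(F(\varpi\mathscr{W}^\perp))\subset\mathscr{W}$, where $F(\varpi\mathscr{W}^\perp)$ is viewed in $\mathcal{E}^0/\varpi\mathcal{E}^0$, holds at every point of $\pi_1^{-1}(Y_i)$. -/

import Mathlib

open IsLocalRing TensorProduct

universe u v

namespace Unitary

/-! ### The structure map `W(k) → O`

`O` is a complete local ring whose residue field `k` is perfect of characteristic `p`. -/

section StructureMap

variable (p : ℕ) [Fact p.Prime] (O : Type v) [CommRing O] [IsLocalRing O]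
  [CharP (ResidueField O) p]

/-- The `m`-th ghost component `W(O) → O`, followed by `O → O / 𝔪 ^ (m + 1)`, only depends on the
image in `W(k)`. -/
theorem ker_map_residue_le (m : ℕ) :
    RingHom.ker (WittVector.map (p := p) (residue O)) ≤
      RingHom.ker ((Ideal.Quotient.mk (maximalIdeal O ^ (m + 1))).comp
        (WittVector.ghostComponent (p := p) m)) := by
  intro x hx
  have hp : (p : O) ∈ maximalIdeal O := by
    rw [← residue_eq_zero_iff, map_natCast]
    exact CharP.cast_eq_zero _ p
  have hx' : ∀ j, x.coeff j ∈ maximalIdeal O := by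
    intro j
    rw [← residue_eq_zero_iff, ← WittVector.map_coeff, RingHom.mem_ker.mp hx]
    exact WittVector.zero_coeff p _ j
  rw [RingHom.mem_ker, RingHom.comp_apply, Ideal.Quotient.eq_zero_iff_mem,
    WittVector.ghostComponent_apply, wittPolynomial_eq_sum_C_mul_X_pow, map_sum]
  refine Ideal.sum_mem _ fun j hj => ?_
  have hj' : j ≤ m := Nat.lt_succ_iff.mp (Finset.mem_range.mp hj)
  simp only [map_mul, map_pow, MvPolynomial.aeval_X, map_natCast]
  have h1 : (p : O) ^ j * x.coeff j ^ p ^ (m - j) ∈ maximalIdeal O ^ (j + p ^ (m - j)) := by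
    rw [pow_add]
    exact Ideal.mul_mem_mul (Ideal.pow_mem_pow hp _) (Ideal.pow_mem_pow (hx' j) _)
  refine Ideal.pow_le_pow_right ?_ h1
  have h2 : m - j < p ^ (m - j) := Nat.lt_pow_self (Fact.out : p.Prime).one_lt
  omega

/-- The map `W(k) → O / 𝔪 ^ (m + 1)` induced by the `m`-th ghost component. -/
noncomputable def ghostMod (m : ℕ) :
    WittVector p (ResidueField O) →+* O ⧸ maximalIdeal O ^ (m + 1) :=
  RingHom.liftOfSurjective (WittVector.map (residue O))
    (WittVector.map_surjective _ residue_surjective)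
    ⟨(Ideal.Quotient.mk (maximalIdeal O ^ (m + 1))).comp (WittVector.ghostComponent m),
      ker_map_residue_le p O m⟩

variable [PerfectRing (ResidueField O) p]

/-- The canonical map `W(k) → O / 𝔪 ^ (m + 1)`: the map `ghostMod` after the inverse of the
`m`-th power of Frobenius. -/
noncomputable def structMod (m : ℕ) :
    WittVector p (ResidueField O) →+* O ⧸ maximalIdeal O ^ (m + 1) :=
  (ghostMod p O m).comp (WittVector.map
    ((((frobeniusEquiv (ResidueField O) p).symm ^ m : _ ≃+* _) : _ →+* _)))

theorem structMod_teichmuller (m : ℕ) (x : ResidueField O) (y : O)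
    (h : residue O y = ((frobeniusEquiv (ResidueField O) p).symm ^ m) x) :
    structMod p O m (WittVector.teichmuller p x) = Ideal.Quotient.mk _ (y ^ p ^ m) := by
  rw [structMod, RingHom.comp_apply, WittVector.map_teichmuller]
  have : (((frobeniusEquiv (ResidueField O) p).symm ^ m : _ ≃+* _) : _ →+* _) x = residue O y :=
    h.symm
  rw [this, ← WittVector.map_teichmuller, ghostMod, RingHom.liftOfSurjective_comp_apply,
    RingHom.comp_apply, WittVector.ghostComponent_teichmuller]

theorem factor_structMod (m : ℕ) :
    (Ideal.Quotient.factorPowSucc (maximalIdeal O) (m + 1)).comp (structMod p O (m + 1)) =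
      structMod p O m := by
  have hp : (p : O) ∈ maximalIdeal O := by
    rw [← residue_eq_zero_iff, map_natCast]
    exact CharP.cast_eq_zero _ p
  refine WittVector.eq_of_apply_teichmuller_eq (p := p) _ _ ⟨m + 1, ?_⟩ fun x => ?_
  · rw [← map_natCast (Ideal.Quotient.mk (maximalIdeal O ^ (m + 1))), ← map_pow,
      Ideal.Quotient.eq_zero_iff_mem]
    exact Ideal.pow_mem_pow hp _
  · obtain ⟨z, hz⟩ := residue_surjective (R := O)
      (((frobeniusEquiv (ResidueField O) p).symm ^ (m + 1)) x)
    rw [RingHom.comp_apply, structMod_teichmuller p O (m + 1) x z hz,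
      structMod_teichmuller p O m x (z ^ p) (by
        rw [map_pow, hz, pow_succ', RingAut.mul_apply, frobeniusEquiv_symm_pow_p])]
    rw [← pow_mul, ← pow_succ']
    rfl

/-- The canonical map `W(k) → O`, that is, the one which induces the identity on residue
fields. -/
noncomputable def structMap [IsAdicComplete (maximalIdeal O) O] :
    WittVector p (ResidueField O) →+* O :=
  IsAdicComplete.StrictMono.liftRingHom (maximalIdeal O) Order.succ_strictMono
    (fun m => structMod p O m) (fun {m} => factor_structMod p O m)

end StructureMap

/-! ### Ramified Witt vectors

`O` is a complete discrete valuation ring with finite residue field `k` of characteristic `p`, that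
is, the ring of integers of a non-archimedean local field. -/

section RamifiedWitt

variable (p : ℕ) [Fact p.Prime] (O : Type v) [CommRing O] [IsDomain O]
  [IsDiscreteValuationRing O] [IsAdicComplete (maximalIdeal O) O] [Finite (ResidueField O)]
  [CharP (ResidueField O) p]

theorem residue_structMap (w : WittVector p (ResidueField O)) :
    residue O (structMap p O w) = w.coeff 0 := by
  have h : Ideal.Quotient.mk (maximalIdeal O ^ (0 + 1)) (structMap p O w) = structMod p O 0 w :=
    IsAdicComplete.StrictMono.mk_liftRingHom (maximalIdeal O) Order.succ_strictMono
      (fun m => structMod p O m) (fun {m} => factor_structMod p O m) w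
  obtain ⟨x, rfl⟩ := WittVector.map_surjective (p := p) (residue O) residue_surjective w
  have h2 : structMod p O 0 (WittVector.map (residue O) x) =
      Ideal.Quotient.mk (maximalIdeal O ^ (0 + 1)) (x.coeff 0) := by
    have : ((((frobeniusEquiv (ResidueField O) p).symm ^ 0 : _ ≃+* _) : _ →+* _)) =
        RingHom.id (ResidueField O) := by
      ext; rfl
    rw [structMod, RingHom.comp_apply, this, WittVector.map_id, RingHom.id_apply, ghostMod,
      RingHom.liftOfSurjective_comp_apply, RingHom.comp_apply, WittVector.ghostComponent_apply]
    simp [wittPolynomial_zero]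
  rw [h2, Ideal.Quotient.eq, zero_add, pow_one] at h
  rw [WittVector.map_coeff]
  exact Ideal.Quotient.eq.mpr h

/-- `O` as an algebra over `W(k)`. -/
noncomputable instance algebraWittBase : Algebra (WittVector p (ResidueField O)) O :=
  (structMap p O).toAlgebra

variable (R : Type u) [CommRing R] [Algebra (ResidueField O) R]

/-- `W(R)` as an algebra over `W(k)`, for a `k`-algebra `R`. -/
noncomputable abbrev algebraWitt :
    Algebra (WittVector p (ResidueField O)) (WittVector p R) :=
  (WittVector.map (algebraMap (ResidueField O) R)).toAlgebra

attribute [local instance] algebraWitt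

/-- `W(R) ⊗ O / 𝔪 ^ m` over `W(k)`. -/
abbrev WOLevel (m : ℕ) : Type (max u v) :=
  WittVector p R ⊗[WittVector p (ResidueField O)] (O ⧸ maximalIdeal O ^ m)

/-- The transition map `W(R) ⊗ O / 𝔪 ^ (m + 1) → W(R) ⊗ O / 𝔪 ^ m`. -/
noncomputable def WOLevel.transition (m : ℕ) : WOLevel p O R (m + 1) →+* WOLevel p O R m :=
  (Algebra.TensorProduct.map (AlgHom.id (WittVector p (ResidueField O)) (WittVector p R))
    (Ideal.Quotient.factorₐ (WittVector p (ResidueField O))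
      (Ideal.pow_le_pow_right (I := maximalIdeal O) m.le_succ))).toRingHom

/-- `W_O(R)`, the inverse limit of the rings `W(R) ⊗ O / 𝔪 ^ m`, as a subring of their product. -/
noncomputable def WOSubring : Subring (∀ m, WOLevel p O R m) where
  carrier := {x | ∀ m, WOLevel.transition p O R m (x (m + 1)) = x m}
  mul_mem' hx hy m := by simp [hx m, hy m]
  one_mem' m := by simp
  add_mem' hx hy m := by simp [hx m, hy m]
  zero_mem' m := by simp
  neg_mem' hx m := by simp [hx m]

/-- The ring `W_O(R)` of ramified Witt vectors. -/
def WO : Type (max u v) := WOSubring p O R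

noncomputable instance : CommRing (WO p O R) := inferInstanceAs (CommRing (WOSubring p O R))

/-- The map `O → W_O(R)`. -/
noncomputable def WO.ofBase : O →+* WO p O R :=
  (RingHom.pi fun m =>
    (Algebra.TensorProduct.includeRight (R := WittVector p (ResidueField O))
      (A := WittVector p R) (B := O ⧸ maximalIdeal O ^ m)).toRingHom.comp
      (Ideal.Quotient.mk (maximalIdeal O ^ m))).codRestrict (WOSubring p O R) fun x m => by
    change Algebra.TensorProduct.map _ _ (1 ⊗ₜ _) = 1 ⊗ₜ _
    rw [Algebra.TensorProduct.map_tmul, map_one]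
    rfl

noncomputable instance : Algebra O (WO p O R) := (WO.ofBase p O R).toAlgebra

/-- The map `W_O(R) → R`, which sends `w ⊗ x` to `w₀ x̄` in `W(R) ⊗ O / 𝔪 → R`. -/
noncomputable def WO.res : WO p O R →+* R :=
  letI : Algebra (WittVector p (ResidueField O)) R :=
    ((algebraMap (ResidueField O) R).comp WittVector.constantCoeff).toAlgebra
  ((Algebra.TensorProduct.lift
    (⟨WittVector.constantCoeff, fun w => by
      change (WittVector.map (algebraMap (ResidueField O) R) w).coeff 0 = _
      rw [WittVector.map_coeff]; rfl⟩ : WittVector p R →ₐ[WittVector p (ResidueField O)] R)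
    (⟨(algebraMap (ResidueField O) R).comp
        (Ideal.Quotient.factor (pow_one (maximalIdeal O)).le), fun w => by
      change algebraMap (ResidueField O) R (residue O (structMap p O w)) = _
      rw [residue_structMap]; rfl⟩ :
        (O ⧸ maximalIdeal O ^ 1) →ₐ[WittVector p (ResidueField O)] R)
    (fun _ _ => Commute.all _ _)).toRingHom.comp
      (Pi.evalRingHom (fun m => WOLevel p O R m) 1)).comp (WOSubring p O R).subtype

noncomputable instance : Algebra (WO p O R) R := (WO.res p O R).toAlgebra

variable {R} {R' : Type u} [CommRing R'] [Algebra (ResidueField O) R']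

/-- `W(f)` as a map of `W(k)`-algebras. -/
noncomputable def wittMap (f : R →ₐ[ResidueField O] R') :
    WittVector p R →ₐ[WittVector p (ResidueField O)] WittVector p R' where
  __ := WittVector.map f.toRingHom
  commutes' w := by
    change WittVector.map f.toRingHom (WittVector.map (algebraMap (ResidueField O) R) w) =
      WittVector.map (algebraMap (ResidueField O) R') w
    ext m
    simp [WittVector.map_coeff]

/-- `W(f) ⊗ id`. -/
noncomputable def WOLevel.map (f : R →ₐ[ResidueField O] R') (m : ℕ) :
    WOLevel p O R m →+* WOLevel p O R' m :=
  (Algebra.TensorProduct.map (wittMap p O f)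
    (AlgHom.id (WittVector p (ResidueField O)) (O ⧸ maximalIdeal O ^ m))).toRingHom

theorem WOLevel.transition_map (f : R →ₐ[ResidueField O] R') (m : ℕ) (x : WOLevel p O R (m + 1)) :
    WOLevel.transition p O R' m (WOLevel.map p O f (m + 1) x) =
      WOLevel.map p O f m (WOLevel.transition p O R m x) := by
  induction x using TensorProduct.induction_on with
  | zero => simp
  | tmul x y => rfl
  | add x y hx hy => rw [map_add, map_add, hx, hy, map_add, map_add]

/-- The map `W_O(f) : W_O(R) → W_O(R')`. -/
noncomputable def WO.map (f : R →ₐ[ResidueField O] R') : WO p O R →+* WO p O R' :=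
  ((RingHom.pi fun m => (WOLevel.map p O f m).comp
    (Pi.evalRingHom (fun m => WOLevel p O R m) m)).comp (WOSubring p O R).subtype).codRestrict
    (WOSubring p O R') fun x m => by
      change WOLevel.transition p O R' m (WOLevel.map p O f (m + 1) (x.1 (m + 1))) =
        WOLevel.map p O f m (x.1 m)
      rw [WOLevel.transition_map, x.2 m]

theorem WO.map_algebraMap (f : R →ₐ[ResidueField O] R') (x : O) :
    WO.map p O f (algebraMap O (WO p O R) x) = algebraMap O (WO p O R') x := by
  refine Subtype.ext (funext fun m => ?_)
  change Algebra.TensorProduct.map _ _ (1 ⊗ₜ _) = 1 ⊗ₜ _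
  rw [Algebra.TensorProduct.map_tmul, map_one]
  rfl

end RamifiedWitt

/-! ### Lattices

A vector bundle of rank `n` on `Spec W_O(R)` with a trivialization over `Spec W_O(R)[1/ϖ]` is the
same as a finite projective `W_O(R)`-submodule of `W_O(R)[1/ϖ]ⁿ` which spans. -/

section Lattices

variable (p : ℕ) [Fact p.Prime] {O : Type v} [CommRing O] [IsDomain O]
  [IsDiscreteValuationRing O] [IsAdicComplete (maximalIdeal O) O] [Finite (ResidueField O)]
  [CharP (ResidueField O) p] (ϖ : O) (n : ℕ)

/-- `W_O(R)[1/ϖ]`. -/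
abbrev LO (R : Type u) [CommRing R] [Algebra (ResidueField O) R] : Type (max u v) :=
  Localization.Away (algebraMap O (WO p O R) ϖ)

/-- `W_O(R)[1/ϖ]ⁿ`. -/
abbrev Amb (R : Type u) [CommRing R] [Algebra (ResidueField O) R] : Type (max u v) :=
  Fin n → LO p ϖ R

variable {R : Type u} [CommRing R] [Algebra (ResidueField O) R]
  {R' : Type u} [CommRing R'] [Algebra (ResidueField O) R']

/-- The map `W_O(R)[1/ϖ] → W_O(R')[1/ϖ]` induced by `R → R'`. -/
noncomputable def LO.map (f : R →ₐ[ResidueField O] R') : LO p ϖ R →+* LO p ϖ R' :=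
  IsLocalization.Away.lift (algebraMap O (WO p O R) ϖ)
    (g := (algebraMap (WO p O R') (LO p ϖ R')).comp (WO.map p O f)) (by
      rw [RingHom.comp_apply, WO.map_algebraMap]
      exact IsLocalization.Away.algebraMap_isUnit _)

/-- `ϖ` as a unit of `W_O(R)[1/ϖ]`. -/
noncomputable def unitϖ (R : Type u) [CommRing R] [Algebra (ResidueField O) R] : (LO p ϖ R)ˣ :=
  (IsLocalization.Away.algebraMap_isUnit (S := LO p ϖ R) (algebraMap O (WO p O R) ϖ)).unit

variable {p ϖ n}

/-- The underlying submodule of a modification of the trivial vector bundle. -/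
structure IsLattice (M : Submodule (WO p O R) (Amb p ϖ n R)) : Prop where
  finite : Module.Finite (WO p O R) M
  projective : Module.Projective (WO p O R) M
  span_eq_top : Submodule.span (LO p ϖ R) (M : Set (Amb p ϖ n R)) = ⊤

variable (p ϖ n R) in
/-- The trivial lattice `𝓔⁰ = W_O(R)ⁿ`. -/
noncomputable def trivialLattice : Submodule (WO p O R) (Amb p ϖ n R) :=
  Submodule.pi Set.univ fun _ => 1

/-- The pullback of a lattice along `Spec R' → Spec R`. -/
noncomputable def pullback (f : R →ₐ[ResidueField O] R')
    (M : Submodule (WO p O R) (Amb p ϖ n R)) : Submodule (WO p O R') (Amb p ϖ n R') :=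
  Submodule.span (WO p O R') ((fun x j => LO.map p ϖ f (x j)) '' (M : Set (Amb p ϖ n R)))

variable (O R) in
/-- The `q`-th power Frobenius endomorphism of `R`, where `q` is the cardinality of `k`. -/
noncomputable def frob : R →ₐ[ResidueField O] R :=
  letI := Fintype.ofFinite (ResidueField O)
  FiniteField.frobeniusAlgHom (ResidueField O) R

/-- The Frobenius twist `F(M)`, the pullback along Frobenius. -/
noncomputable def twist (M : Submodule (WO p O R) (Amb p ϖ n R)) :
    Submodule (WO p O R) (Amb p ϖ n R) :=
  pullback (frob O R) M

/-- The dual lattice for the pairing `⟨x, y⟩ = ∑ j, x_j y_{n + 1 - j}`; this is the dual vector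
bundle, with the trivial one identified with its dual through the pairing. -/
noncomputable def dual (M : Submodule (WO p O R) (Amb p ϖ n R)) :
    Submodule (WO p O R) (Amb p ϖ n R) where
  carrier := {y | ∀ x ∈ M, ∑ j, x j * y (Fin.rev j) ∈ (1 : Submodule (WO p O R) (LO p ϖ R))}
  add_mem' hy hy' x hx := by
    simp only [Pi.add_apply, mul_add, Finset.sum_add_distrib]
    exact add_mem (hy x hx) (hy' x hx)
  zero_mem' x _ := by simp
  smul_mem' a y hy x hx := by
    simp only [Pi.smul_apply, mul_smul_comm, ← Finset.smul_sum]
    exact Submodule.smul_mem _ a (hy x hx)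

/-- `ϖ M`. -/
noncomputable def scale (M : Submodule (WO p O R) (Amb p ϖ n R)) :
    Submodule (WO p O R) (Amb p ϖ n R) :=
  M.map (LinearMap.lsmul (WO p O R) (Amb p ϖ n R) (algebraMap O (WO p O R) ϖ))

/-! ### Relative position -/

/-- The relative position of a modification `M ⇢ N` is `μ`: there is `g` in `GL_n` with
`N = g W_O(R)ⁿ` and `M = g ϖ^μ W_O(R)ⁿ`. The columns of `g` are given as a basis. -/
def HasRelPos (M N : Submodule (WO p O R) (Amb p ϖ n R)) (μ : Fin n → ℤ) : Prop :=
  ∃ g : Module.Basis (Fin n) (LO p ϖ R) (Amb p ϖ n R),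
    N = Submodule.span (WO p O R) (Set.range g) ∧
    M = Submodule.span (WO p O R)
      (Set.range fun j => ((unitϖ p ϖ R ^ μ j : (LO p ϖ R)ˣ) : LO p ϖ R) • g j)

/-- The dominance order `l ≼ μ` on cocharacters of the diagonal torus: `μ - l` is a sum of positive
coroots. -/
def Dominated (l μ : Fin n → ℤ) : Prop :=
  (∀ m : ℕ, ∑ j with j.val < m, l j ≤ ∑ j with j.val < m, μ j) ∧ ∑ j, l j = ∑ j, μ j

/-- The modification `M ⇢ N` is bounded by `μ`: at every geometric point of `Spec R` its relative
position is a dominant cocharacter `l ≼ μ`. -/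
def IsBounded (M N : Submodule (WO p O R) (Amb p ϖ n R)) (μ : Fin n → ℤ) : Prop :=
  ∀ (K : Type u) [Field K] [IsAlgClosed K] [Algebra (ResidueField O) K]
    (f : R →ₐ[ResidueField O] K),
    ∃ l : Fin n → ℤ, Antitone l ∧ Dominated l μ ∧ HasRelPos (pullback f M) (pullback f N) l

/-- `ω_d = ε_1 + ⋯ + ε_d`. -/
def omega (n d : ℕ) : Fin n → ℤ := fun j => if j.val < d then 1 else 0

/-- The dual cocharacter `μ* = - w₀ μ`. -/
def dualCochar (μ : Fin n → ℤ) : Fin n → ℤ := fun j => - μ (Fin.rev j)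

/-- `ν_{i,+} = ε_1 + ⋯ + ε_{i-1}`. -/
def nuPlus (n i : ℕ) : Fin n → ℤ := omega n (i - 1)

/-- `ν_{i,-} = - ε_{n+1-i} - ⋯ - ε_n`. -/
def nuMinus (n i : ℕ) : Fin n → ℤ := fun j => if n ≤ j.val + i then -1 else 0

/-- `ν_i = ν_{i,+} + ν_{i,-}`. -/
def nu (n i : ℕ) : Fin n → ℤ := nuPlus n i + nuMinus n i

/-! ### The spaces of modifications

All of them are given by their points with values in perfect `k`-algebras. -/

/-- A point of `(Gr_{ν_{i,+}^*} × Gr_{ν_{i,-}^*})_{ξ_i}`. -/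
structure IsPairPoint (i : ℕ) (Ep Em : Submodule (WO p O R) (Amb p ϖ n R)) : Prop where
  lattice_plus : IsLattice Ep
  lattice_minus : IsLattice Em
  bounded_plus : IsBounded Ep (trivialLattice p ϖ n R) (dualCochar (nuPlus n i))
  bounded_minus : IsBounded Em (trivialLattice p ϖ n R) (dualCochar (nuMinus n i))
  bounded_xi : IsBounded Em Ep (omega n (2 * i - 1))

/-- A point of `(Gr_{(ν_{i,+}^*,ν_{i,-}^*)} ×_{Gr_{ν_i^*}} Gr_{(ν_{i,-}^*,ν_{i,+}^*)})_{ξ_i}`.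
Its image under `π₁` is `(Ep, Em)` and its image under `π₀` is `E`. -/
structure IsTriplePoint (i : ℕ) (E Ep Em : Submodule (WO p O R) (Amb p ϖ n R)) : Prop where
  pair : IsPairPoint i Ep Em
  lattice : IsLattice E
  bounded_plus : IsBounded E Ep (dualCochar (nuMinus n i))
  bounded_minus : IsBounded E Em (dualCochar (nuPlus n i))

/-- A point of `X_{μ^*,ν_i^*}(τ_i^*)`: a modification `E ⇢ 𝓔⁰` bounded by `ν_i^*` such that
`F(E^∨) ⇢ E` is bounded by `(ε_1 + ε_2)^*`. Here `F(E^∨)` is the image of `E` under the Frobenius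
endomorphism of the affine Grassmannian of the unitary group. Its relative position to `𝓔⁰` is then
bounded by `σ(ν_i^*) = ν_i`, as `F(M^∨)` has relative position `l^*` if `M` has relative
position `l`. -/
structure IsADLVPoint (i : ℕ) (E : Submodule (WO p O R) (Amb p ϖ n R)) : Prop where
  lattice : IsLattice E
  bounded : IsBounded E (trivialLattice p ϖ n R) (dualCochar (nu n i))
  bounded_frob : IsBounded (twist (dual E)) E (dualCochar (omega n 2))

/-- A point of `Y_i`. -/
structure IsYPoint (i : ℕ) (Ep Em : Submodule (WO p O R) (Amb p ϖ n R)) : Prop where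
  pair : IsPairPoint i Ep Em
  plus_le : Ep ≤ twist (dual Em)
  minus_le : Em ≤ twist (dual Ep)
  scale_le : scale (twist (dual Em)) ≤ Em

/-- A point of `π₁⁻¹(Y_i)`. -/
structure IsPreYPoint (i : ℕ) (E Ep Em : Submodule (WO p O R) (Amb p ϖ n R)) : Prop where
  triple : IsTriplePoint i E Ep Em
  base : IsYPoint i Ep Em

/-- A point of `X_i = π₀⁻¹(X_{μ^*,ν_i^*}(τ_i^*)) ∩ π₁⁻¹(Y_i)`. -/
structure IsXPoint (i : ℕ) (E Ep Em : Submodule (WO p O R) (Amb p ϖ n R)) : Prop where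
  preY : IsPreYPoint i E Ep Em
  adlv : IsADLVPoint i E

/-! ### Subquotients of lattices and vector bundles on `Spec R` -/

/-- `N / M` (for `M ≤ N`). -/
abbrev SubQuot (N M : Submodule (WO p O R) (Amb p ϖ n R)) : Type (max u v) :=
  N ⧸ M.submoduleOf N

/-- The image in `N / M` of `E ∩ N`; this is `E / M` for `M ≤ E ≤ N`. -/
noncomputable def toSub (N M E : Submodule (WO p O R) (Amb p ϖ n R)) :
    Submodule (WO p O R) (SubQuot N M) :=
  (E.submoduleOf N).map (M.submoduleOf N).mkQ

/-- The lattice between `M` and `N` given by a submodule of `N / M`. -/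
noncomputable def ofSub {N M : Submodule (WO p O R) (Amb p ϖ n R)}
    (W : Submodule (WO p O R) (SubQuot N M)) : Submodule (WO p O R) (Amb p ϖ n R) :=
  (W.comap (M.submoduleOf N).mkQ).map N.subtype

/-- The natural map `N / M → N' / M'` for `N ≤ N'` and `M ≤ M'`. -/
noncomputable def natMap {N M N' M' : Submodule (WO p O R) (Amb p ϖ n R)} (hN : N ≤ N')
    (hM : M ≤ M') : SubQuot N M →ₗ[WO p O R] SubQuot N' M' :=
  Submodule.mapQ _ _ (Submodule.inclusion hN) fun _ hx => hM hx

/-- The annihilator `W^⊥` in `M^∨ / N^∨` of a submodule `W` of `N / M`, for the pairing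
of `N / M` and `M^∨ / N^∨` with values in `W_O(R)[1/ϖ] / W_O(R)` induced by `⟨x, y⟩`. -/
noncomputable def annihilator {N M : Submodule (WO p O R) (Amb p ϖ n R)}
    (W : Submodule (WO p O R) (SubQuot N M)) :
    Submodule (WO p O R) (SubQuot (dual M) (dual N)) :=
  toSub (dual M) (dual N) (dual (ofSub W))

/-- The pullback along `Spec R' → Spec R` of a submodule of `N / M`. -/
noncomputable def pullbackQuot (f : R →ₐ[ResidueField O] R')
    {N M : Submodule (WO p O R) (Amb p ϖ n R)} (W : Submodule (WO p O R) (SubQuot N M)) :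
    Submodule (WO p O R') (SubQuot (pullback f N) (pullback f M)) :=
  toSub (pullback f N) (pullback f M) (pullback f (ofSub W))

/-- The Frobenius twist `F(W)` in `F(N) / F(M) = F(N / M)` of a submodule `W` of `N / M`. -/
noncomputable def twistSub {N M : Submodule (WO p O R) (Amb p ϖ n R)}
    (W : Submodule (WO p O R) (SubQuot N M)) :
    Submodule (WO p O R) (SubQuot (twist N) (twist M)) :=
  pullbackQuot (frob O R) W

/-- `F(ϖ W)`, where `ϖ W` is the image of `W ⊆ N / M` under `ϖ : N / M → 𝓔⁰ / ϖ 𝓔⁰`, for `N`, `M`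
with `ϖ N ≤ 𝓔⁰` and `ϖ M ≤ ϖ 𝓔⁰`. -/
noncomputable def twistScaleSub {N M : Submodule (WO p O R) (Amb p ϖ n R)}
    (W : Submodule (WO p O R) (SubQuot N M)) :
    Submodule (WO p O R) (SubQuot (trivialLattice p ϖ n R) (scale (trivialLattice p ϖ n R))) :=
  toSub _ _ (twist (scale (ofSub W)))

/-- `M` is a vector bundle of rank `r` on `Spec S`. -/
structure IsVectorBundle (S M : Type*) [CommRing S] [AddCommGroup M] [Module S M] (r : ℕ) :
    Prop where
  finite : Module.Finite S M
  projective : Module.Projective S M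
  rank_eq : ∀ x, Module.rankAtStalk (R := S) M x = r

variable (p ϖ R) in
/-- The `W_O(R)`-module `M` is a vector bundle of rank `r` on the closed subscheme `Spec R` of
`Spec W_O(R)` defined by `ϖ`: it is annihilated by `ϖ`, and it is a vector bundle as an `R`-module,
that is, after extension of scalars along the surjection `W_O(R) → R`. -/
structure IsResidueBundle (M : Type*) [AddCommGroup M] [Module (WO p O R) M] (r : ℕ) : Prop where
  smul_eq_zero : ∀ m : M, algebraMap O (WO p O R) ϖ • m = 0
  bundle : IsVectorBundle R (R ⊗[WO p O R] M) r

variable (p ϖ R) in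
/-- `W` is a subvector bundle of rank `r` and corank `s` of the vector bundle `M` on `Spec R`. -/
structure IsResidueSubbundle {M : Type*} [AddCommGroup M] [Module (WO p O R) M]
    (W : Submodule (WO p O R) M) (r s : ℕ) : Prop where
  sub : IsResidueBundle p ϖ R W r
  quot : IsResidueBundle p ϖ R (M ⧸ W) s

/-- The image in `Rⁿ` of `M ∩ 𝓔⁰` under `𝓔⁰ → 𝓔⁰ / ϖ 𝓔⁰ = Rⁿ`; this is `M / ϖ 𝓔⁰` for
`ϖ 𝓔⁰ ≤ M ≤ 𝓔⁰`. -/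
noncomputable def reduction (M : Submodule (WO p O R) (Amb p ϖ n R)) :
    Submodule R (Fin n → R) :=
  Submodule.span R ((fun (x : Fin n → WO p O R) j => WO.res p O R (x j)) ''
    {x | (fun j => algebraMap (WO p O R) (LO p ϖ R) (x j)) ∈ M})

end Lattices

/-! ### The Deligne-Lusztig variety

`k` is a finite field with `q` elements. Over the quadratic extension of `k` the group `GU_n` becomes
`GL_n × 𝔾_m`. In terms of `GL_n` a parabolic subgroup of type `I_n^{i-1,n-i}` over `R` is the
stabilizer of a flag `V₁ ≤ V₂` in `Rⁿ` of ranks `i - 1` and `n - i`, and the Frobenius of `GU_n` sends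
it to the stabilizer of `F(V₂^⊥) ≤ F(V₁^⊥)`. -/

section DeligneLusztig

variable (k : Type v) [Field k] [Finite k] {R : Type u} [CommRing R] [Algebra k R] {n : ℕ}

variable {k} in
/-- The pullback of a subbundle of `Rⁿ`. -/
def pullbackSub {R' : Type u} [CommRing R'] [Algebra k R'] (f : R →ₐ[k] R')
    (V : Submodule R (Fin n → R)) : Submodule R' (Fin n → R') :=
  Submodule.span R' ((fun x j => f (x j)) '' (V : Set (Fin n → R)))

/-- The Frobenius twist of a subbundle of `Rⁿ`. -/
noncomputable def frobSub (V : Submodule R (Fin n → R)) : Submodule R (Fin n → R) :=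
  letI := Fintype.ofFinite k
  pullbackSub (FiniteField.frobeniusAlgHom k R) V

/-- The orthogonal complement for the pairing `∑ j, x_j y_{n + 1 - j}`. -/
def perp (V : Submodule R (Fin n → R)) : Submodule R (Fin n → R) where
  carrier := {y | ∀ x ∈ V, ∑ j, x j * y (Fin.rev j) = 0}
  add_mem' hy hy' x hx := by
    simp only [Pi.add_apply, mul_add, Finset.sum_add_distrib, hy x hx, hy' x hx, add_zero]
  zero_mem' x _ := by simp
  smul_mem' a y hy x hx := by
    simp only [Pi.smul_apply, mul_smul_comm, ← Finset.smul_sum, hy x hx, smul_zero]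

/-- A point of the Deligne-Lusztig variety `X_I([1])` for `I = I_n^{i-1,n-i}` with values in a
perfect (hence reduced) ring: a flag such that, at every geometric point, the corresponding
parabolic subgroup `P` and `F(P)` are in relative position `[1]`, that is, contain a common Borel
subgroup. A Borel subgroup is the stabilizer of a complete flag. -/
structure IsDLPoint (i : ℕ) (V₁ V₂ : Submodule R (Fin n → R)) : Prop where
  le : V₁ ≤ V₂
  bundle₁ : IsVectorBundle R V₁ (i - 1)
  quot₁ : IsVectorBundle R ((Fin n → R) ⧸ V₁) (n - (i - 1))
  bundle₂ : IsVectorBundle R V₂ (n - i)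
  quot₂ : IsVectorBundle R ((Fin n → R) ⧸ V₂) i
  relPos : ∀ (K : Type u) [Field K] [IsAlgClosed K] [Algebra k K] (f : R →ₐ[k] K),
    ∃ c : Flag (Submodule K (Fin n → K)),
      pullbackSub f V₁ ∈ c ∧ pullbackSub f V₂ ∈ c ∧
      frobSub k (perp (pullbackSub f V₂)) ∈ c ∧ frobSub k (perp (pullbackSub f V₁)) ∈ c

end DeligneLusztig

end Unitary

set_option linter.unusedSectionVars false

/-! Every assertion is turned into inclusions and indices of lattices, and these are tested at
geometric points.

For perfect `R` the ring `W_O(R)` is `ϖ`-torsion free, `ϖ`-adically separated, and has quotient `R`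
modulo `ϖ`. Since `R` is reduced, an element of `W_O(R)[1/ϖ]` is integral as soon as it is so at all
geometric points (`LO.mem_range_of_forall_geometric`). A lattice is a direct summand of a free
module, so it is described by rectangular matrices `B` (generators) and `C` (coordinates) with `B *
C = 1`, a frame. An inclusion of lattices says that `C' * B` is integral (`IsFrame.le_iff`), and
pullback, dual, Frobenius twist and scaling act on frames by explicit formulas, so they commute
without any local trivialization. With the Cartan decomposition over algebraically closed fields, a
modification `M ⇢ N` is bounded by `ω_d` exactly when `ϖ N ≤ M ≤ N` and `N / M` is a bundle of rank
`d` on `Spec R` (`isBounded_omega_iff_bundle`).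

Assertion 1: put `V₁ = ϖ Ep / ϖ 𝓔⁰` and `V₂ = Em / ϖ 𝓔⁰`. Then `F(V₂^⊥)` and `F(V₁^⊥)` are the
reductions of `ϖ F(Em^∨)` and `F(Ep^∨)`. At a geometric point the dimensions of `V₁`, `F(V₂^⊥)`,
`V₂`, `F(V₁^⊥)` are `i - 1 < i < n - i < n - i + 1`. A common flag therefore exists if and only if
these four spaces are nested in this order, and the three inclusions are the ones that define `Y_i`
(`IsPairPoint.isYPoint`, `IsYPoint.exists_flag`).

Assertion 2: both bounds on `E` are minuscule, so they only prescribe the ranks of `E / Em` and `Ep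
/ E`. Conversely the preimage of a subbundle is again a lattice (`isLattice_of_projective`).

Assertions 3 and 4: on `π₁⁻¹(Y_i)` the chain `ϖ F(E^∨) ≤ ϖ F(Em^∨) ≤ Em ≤ E` always holds, which is
assertion 4. The lattice `E` has index `1` in `𝓔⁰`, hence index `2` in `F(E^∨)`, and its bound by
`ν_i^*` is automatic (`IsTriplePoint.isBounded_trivial`). What remains of the definition of `X_i` is
`E ≤ F(E^∨)`, that is, `φ₁(W) ⊆ F(W^⊥)` (`IsPreYPoint.isXPoint_iff_le`). Since `ϖ E ≤ F(E^∨)` holds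
anyway, this is the vanishing of finitely many elements of `R`, so it is a closed condition. -/

namespace Unitary

/-! ### Ramified Witt vectors over perfect rings -/

section WittLevels

variable {p : ℕ} [Fact p.Prime] {O : Type v} [CommRing O] [IsDomain O]
  [IsDiscreteValuationRing O] [IsAdicComplete (maximalIdeal O) O] [Finite (ResidueField O)]
  [CharP (ResidueField O) p] {R : Type u} [CommRing R] [Algebra (ResidueField O) R]

attribute [local instance] algebraWitt

variable (p O R) in
/-- Multiplication by `x ∈ 𝔪` as a map `O / 𝔪 ^ m → O / 𝔪 ^ (m + 1)`. -/
noncomputable def mulLevel (x : O) (hx : x ∈ maximalIdeal O) (m : ℕ) :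
    (O ⧸ maximalIdeal O ^ m) →ₗ[WittVector p (ResidueField O)] (O ⧸ maximalIdeal O ^ (m + 1)) :=
  (Submodule.mapQ (maximalIdeal O ^ m) (maximalIdeal O ^ (m + 1)) (LinearMap.mulLeft O x)
    fun y hy => by
      rw [Submodule.mem_comap, LinearMap.mulLeft_apply, pow_succ']
      exact Ideal.mul_mem_mul hx hy).restrictScalars _

theorem mulLevel_mk (x : O) (hx : x ∈ maximalIdeal O) (m : ℕ) (y : O) :
    mulLevel p O x hx m (Ideal.Quotient.mk _ y) = Ideal.Quotient.mk _ (x * y) := rfl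

theorem uniformizer_mem {ϖ : O} (hϖ : Irreducible ϖ) : ϖ ∈ maximalIdeal O := by
  rw [hϖ.maximalIdeal_eq]; exact Ideal.mem_span_singleton_self ϖ

theorem mulLevel_injective {ϖ : O} (hϖ : Irreducible ϖ) (m : ℕ) :
    Function.Injective (mulLevel p O ϖ (uniformizer_mem hϖ) m) := by
  rw [injective_iff_map_eq_zero]
  intro a ha
  obtain ⟨y, rfl⟩ := Ideal.Quotient.mk_surjective a
  rw [mulLevel_mk, Ideal.Quotient.eq_zero_iff_mem, hϖ.maximalIdeal_eq, Ideal.span_singleton_pow,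
    Ideal.mem_span_singleton, pow_succ'] at ha
  rw [Ideal.Quotient.eq_zero_iff_mem, hϖ.maximalIdeal_eq, Ideal.span_singleton_pow,
    Ideal.mem_span_singleton]
  exact (mul_dvd_mul_iff_left hϖ.ne_zero).mp ha

variable (p O R) in
/-- Multiplication by `x ∈ 𝔪` as a map `W(R) ⊗ O / 𝔪 ^ m → W(R) ⊗ O / 𝔪 ^ (m + 1)`. -/
noncomputable def WOLevel.shift (x : O) (hx : x ∈ maximalIdeal O) (m : ℕ) :
    WOLevel p O R m →ₗ[WittVector p (ResidueField O)] WOLevel p O R (m + 1) :=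
  LinearMap.lTensor (WittVector p R) (mulLevel p O x hx m)

variable (p O R) in
/-- The map `O → W(R) ⊗ O / 𝔪 ^ m`. -/
noncomputable def WOLevel.ofBase (m : ℕ) : O →+* WOLevel p O R m :=
  (Algebra.TensorProduct.includeRight (R := WittVector p (ResidueField O))
      (A := WittVector p R) (B := O ⧸ maximalIdeal O ^ m)).toRingHom.comp
      (Ideal.Quotient.mk (maximalIdeal O ^ m))

/-- Multiplication by `x` on one level factors through the level below. For a uniformizer the second
factor is injective when `R` is perfect, although multiplication on the level itself is not. -/
theorem WOLevel.shift_transition (x : O) (hx : x ∈ maximalIdeal O) (m : ℕ)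
    (a : WOLevel p O R (m + 1)) :
    WOLevel.shift p O R x hx m (WOLevel.transition p O R m a) = WOLevel.ofBase p O R (m + 1) x * a := by
  induction a using TensorProduct.induction_on with
  | zero => simp
  | tmul w y =>
    obtain ⟨y, rfl⟩ := Ideal.Quotient.mk_surjective y
    change w ⊗ₜ _ = ((1 : WittVector p R) ⊗ₜ _) * (w ⊗ₜ _)
    rw [Algebra.TensorProduct.tmul_mul_tmul, one_mul, ← map_mul]
    rfl
  | add x y hx hy => rw [map_add, map_add, hx, hy, mul_add]

theorem WOLevel.transition_shift (x : O) (hx : x ∈ maximalIdeal O) (m : ℕ)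
    (a : WOLevel p O R (m + 1)) :
    WOLevel.transition p O R (m + 1) (WOLevel.shift p O R x hx (m + 1) a) =
      WOLevel.shift p O R x hx m (WOLevel.transition p O R m a) := by
  induction a using TensorProduct.induction_on with
  | zero => simp
  | tmul w y =>
    obtain ⟨y, rfl⟩ := Ideal.Quotient.mk_surjective y
    rfl
  | add x y hx hy => simp only [map_add, hx, hy]

variable (p O R) in
/-- The reduction map `W(R) ⊗ O / 𝔪 → R`. -/
noncomputable def WOLevel.res : WOLevel p O R 1 →+* R :=
  letI : Algebra (WittVector p (ResidueField O)) R :=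
    ((algebraMap (ResidueField O) R).comp WittVector.constantCoeff).toAlgebra
  (Algebra.TensorProduct.lift
    (⟨WittVector.constantCoeff, fun w => by
      change (WittVector.map (algebraMap (ResidueField O) R) w).coeff 0 = _
      rw [WittVector.map_coeff]; rfl⟩ : WittVector p R →ₐ[WittVector p (ResidueField O)] R)
    (⟨(algebraMap (ResidueField O) R).comp
        (Ideal.Quotient.factor (pow_one (maximalIdeal O)).le), fun w => by
      change algebraMap (ResidueField O) R (residue O (structMap p O w)) = _
      rw [residue_structMap]; rfl⟩ :
        (O ⧸ maximalIdeal O ^ 1) →ₐ[WittVector p (ResidueField O)] R)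
    (fun _ _ => Commute.all _ _)).toRingHom

theorem WO.res_eq (x : WO p O R) : WO.res p O R x = WOLevel.res p O R (x.1 1) := rfl

theorem WOLevel.res_tmul (w : WittVector p R) (y : O) :
    WOLevel.res p O R (w ⊗ₜ Ideal.Quotient.mk _ y) =
      w.coeff 0 * algebraMap (ResidueField O) R (residue O y) := rfl

variable (p O) in
theorem natCast_mem : (p : O) ∈ maximalIdeal O := by
  rw [← residue_eq_zero_iff, map_natCast]
  exact CharP.cast_eq_zero _ p

/-- The structure map induces the identity on residue fields, so a class in `O / 𝔪` is the image of
a Teichmüller element and can be moved across the tensor sign. -/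
theorem WOLevel.exists_tmul_one (x : WOLevel p O R 1) :
    ∃ w : WittVector p R, x = w ⊗ₜ 1 := by
  induction x using TensorProduct.induction_on with
  | zero => exact ⟨0, by simp⟩
  | tmul w y =>
    obtain ⟨y, rfl⟩ := Ideal.Quotient.mk_surjective y
    refine ⟨WittVector.teichmuller p (residue O y) • w, ?_⟩
    rw [TensorProduct.smul_tmul]
    congr 1
    rw [Algebra.smul_def, mul_one]
    change _ = Ideal.Quotient.mk _ (structMap p O _)
    rw [Ideal.Quotient.eq, pow_one, ← residue_eq_zero_iff, map_sub, residue_structMap,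
      WittVector.teichmuller_coeff_zero, sub_self]
  | add x y hx hy =>
    obtain ⟨a, rfl⟩ := hx
    obtain ⟨b, rfl⟩ := hy
    exact ⟨a + b, (TensorProduct.add_tmul _ _ _).symm⟩

variable (O) in
-- Perfectness enters here: the kernel of `w ↦ w₀` is generated by `p`, and `p` vanishes in `O / 𝔪`.
theorem WOLevel.res_injective [CharP R p] [PerfectRing R p] :
    Function.Injective (WOLevel.res p O R) := by
  rw [injective_iff_map_eq_zero]
  intro x hx
  obtain ⟨w, rfl⟩ := WOLevel.exists_tmul_one x
  have h1 : w.coeff 0 = 0 := by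
    have := WOLevel.res_tmul (O := O) w 1
    rw [map_one, map_one, map_one, mul_one] at this
    rw [← this]; exact hx
  obtain ⟨w', rfl⟩ := Ideal.mem_span_singleton.mp
    ((WittVector.mem_span_p_iff_coeff_zero_eq_zero w).mpr h1)
  have : (p : WittVector p R) * w' = (p : WittVector p (ResidueField O)) • w' := by
    rw [Algebra.smul_def, map_natCast]
  rw [this, TensorProduct.smul_tmul, Algebra.smul_def, map_natCast, mul_one,
    ← map_natCast (Ideal.Quotient.mk (maximalIdeal O ^ 1)),
    Ideal.Quotient.eq_zero_iff_mem.mpr (by simpa using natCast_mem p O), TensorProduct.tmul_zero]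

variable (p O R) in
-- `W(k)` is a discrete valuation ring with uniformizer `p`, so flatness means that `p` is not a
-- zero divisor in `W(R)`.
theorem flat_wittVector [CharP R p] [PerfectRing R p] :
    Module.Flat (WittVector p (ResidueField O)) (WittVector p R) := by
  rw [IsDedekindDomain.flat_iff_torsion_eq_bot, ← Submodule.isTorsionFree_iff_torsion_eq_bot]
  have hp : ∀ (m : ℕ) (x : WittVector p R),
      (p : WittVector p (ResidueField O)) ^ m • x = 0 → x = 0 := by
    intro m
    induction m with
    | zero => intro x hx; simpa using hx
    | succ m ih =>
      intro x hx
      rw [pow_succ, mul_smul] at hx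
      refine WittVector.eq_zero_of_p_mul_eq_zero x ?_
      have := ih _ hx
      rw [Algebra.smul_def, map_natCast] at this
      rw [mul_comm]; exact this
  refine Module.IsTorsionFree.mk fun a ha => ?_
  have ha0 : a ≠ 0 := ha.ne_zero
  obtain ⟨m, u, rfl⟩ := WittVector.exists_eq_pow_p_mul' a ha0
  intro x y hxy
  rw [← sub_eq_zero]
  have h : ((p : WittVector p (ResidueField O)) ^ m * (u : WittVector p (ResidueField O))) • (x - y) = 0 := by
    rw [smul_sub, sub_eq_zero]; exact hxy
  rw [mul_smul] at h
  have := hp m _ h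
  exact (smul_eq_zero_iff_eq u).mp this

theorem WOLevel.shift_injective [CharP R p] [PerfectRing R p] {ϖ : O} (hϖ : Irreducible ϖ)
    (m : ℕ) : Function.Injective (WOLevel.shift p O R ϖ (uniformizer_mem hϖ) m) := by
  have := flat_wittVector p O R
  exact Module.Flat.lTensor_preserves_injective_linearMap _ (mulLevel_injective hϖ m)

variable (p O R) in
/-- The map `W(R) ⊗ O / 𝔪 ^ (m + 1) → W(R) ⊗ O / 𝔪`. -/
noncomputable def WOLevel.toOne (m : ℕ) :
    WOLevel p O R (m + 1) →ₗ[WittVector p (ResidueField O)] WOLevel p O R 1 :=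
  LinearMap.lTensor (WittVector p R) (Ideal.Quotient.factorₐ (WittVector p (ResidueField O))
      (Ideal.pow_le_pow_right (I := maximalIdeal O) (Nat.le_add_left 1 m))).toLinearMap

theorem WOLevel.toOne_tmul (m : ℕ) (w : WittVector p R) (y : O) :
    WOLevel.toOne p O R m (w ⊗ₜ Ideal.Quotient.mk _ y) = w ⊗ₜ Ideal.Quotient.mk _ y := rfl

theorem WOLevel.transition_tmul (m : ℕ) (w : WittVector p R) (y : O) :
    WOLevel.transition p O R m (w ⊗ₜ Ideal.Quotient.mk _ y) = w ⊗ₜ Ideal.Quotient.mk _ y := rfl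

theorem WOLevel.toOne_transition (m : ℕ) (x : WOLevel p O R (m + 2)) :
    WOLevel.toOne p O R m (WOLevel.transition p O R (m + 1) x) =
      WOLevel.toOne p O R (m + 1) x := by
  induction x using TensorProduct.induction_on with
  | zero => simp
  | tmul w y =>
    obtain ⟨y, rfl⟩ := Ideal.Quotient.mk_surjective y
    rw [WOLevel.transition_tmul, WOLevel.toOne_tmul]
    exact WOLevel.toOne_tmul m w y
  | add x y hx hy => simp only [map_add, hx, hy]

theorem WOLevel.toOne_zero (x : WOLevel p O R 1) : WOLevel.toOne p O R 0 x = x := by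
  induction x using TensorProduct.induction_on with
  | zero => simp
  | tmul w y =>
    obtain ⟨y, rfl⟩ := Ideal.Quotient.mk_surjective y
    rfl
  | add x y hx hy => rw [map_add, hx, hy]

theorem WO.toOne (x : WO p O R) (m : ℕ) : WOLevel.toOne p O R m (x.1 (m + 1)) = x.1 1 := by
  induction m with
  | zero => exact WOLevel.toOne_zero _
  | succ m ih => rw [← WOLevel.toOne_transition, x.2 (m + 1), ih]

/-- Right exactness of the tensor product, applied to `O / 𝔪 ^ m → O / 𝔪 ^ (m + 1) → O / 𝔪 → 0`. -/
theorem WOLevel.exact_shift_toOne {ϖ : O} (hϖ : Irreducible ϖ) (m : ℕ) :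
    Function.Exact (WOLevel.shift p O R ϖ (uniformizer_mem hϖ) m) (WOLevel.toOne p O R m) := by
  refine lTensor_exact _ ?_ ?_
  · intro y
    obtain ⟨y, rfl⟩ := Ideal.Quotient.mk_surjective y
    constructor
    · intro h
      have h1 : Ideal.Quotient.mk (maximalIdeal O ^ 1) y = 0 := h
      rw [Ideal.Quotient.eq_zero_iff_mem, pow_one, hϖ.maximalIdeal_eq,
        Ideal.mem_span_singleton] at h1
      obtain ⟨z, rfl⟩ := h1
      exact ⟨Ideal.Quotient.mk _ z, rfl⟩
    · rintro ⟨z, hz⟩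
      obtain ⟨z, rfl⟩ := Ideal.Quotient.mk_surjective z
      rw [← hz]
      change Ideal.Quotient.mk (maximalIdeal O ^ 1) (ϖ * z) = 0
      rw [Ideal.Quotient.eq_zero_iff_mem, pow_one]
      exact Ideal.mul_mem_right _ _ (uniformizer_mem hϖ)
  · intro y
    obtain ⟨y, rfl⟩ := Ideal.Quotient.mk_surjective y
    exact ⟨Ideal.Quotient.mk _ y, rfl⟩

instance WOLevel.subsingleton_zero : Subsingleton (WOLevel p O R 0) := by
  have : Subsingleton (O ⧸ maximalIdeal O ^ 0) := by
    rw [Ideal.Quotient.subsingleton_iff, pow_zero, Ideal.one_eq_top]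
  refine ⟨fun a b => ?_⟩
  have h : ∀ a : WOLevel p O R 0, a = 0 := fun a => by
    induction a using TensorProduct.induction_on with
    | zero => rfl
    | tmul w y => rw [Subsingleton.elim y 0, TensorProduct.tmul_zero]
    | add x y hx hy => rw [hx, hy, add_zero]
  rw [h a, h b]

theorem WO.ext_level {x y : WO p O R} (h : ∀ m, x.1 (m + 1) = y.1 (m + 1)) : x = y := by
  refine Subtype.ext (funext fun m => ?_)
  cases m with
  | zero => exact Subsingleton.elim (α := WOLevel p O R 0) _ _
  | succ m => exact h m

theorem WO.algebraMap_mul_level (x : O) (a : WO p O R) (m : ℕ) :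
    (algebraMap O (WO p O R) x * a).1 m = WOLevel.ofBase p O R m x * a.1 m := rfl

theorem WO.uniformizer_mul_level {ϖ : O} (hϖ : Irreducible ϖ) (a : WO p O R) (m : ℕ) :
    (algebraMap O (WO p O R) ϖ * a).1 (m + 1) =
      WOLevel.shift p O R ϖ (uniformizer_mem hϖ) m (a.1 m) := by
  rw [WO.algebraMap_mul_level, ← WOLevel.shift_transition (hx := uniformizer_mem hϖ), a.2 m]

variable [CharP R p] [PerfectRing R p]

theorem WO.eq_zero_of_uniformizer_mul {ϖ : O} (hϖ : Irreducible ϖ) (a : WO p O R)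
    (h : algebraMap O (WO p O R) ϖ * a = 0) : a = 0 := by
  refine WO.ext_level fun m => WOLevel.shift_injective hϖ (m + 1) ?_
  rw [← WO.uniformizer_mul_level hϖ a, h]
  exact (map_zero _).symm

theorem WO.res_algebraMap (x : O) :
    WO.res p O R (algebraMap O (WO p O R) x) = algebraMap (ResidueField O) R (residue O x) := by
  rw [WO.res_eq]
  refine (WOLevel.res_tmul 1 x).trans ?_
  rw [WittVector.one_coeff_zero, one_mul]

theorem WO.res_uniformizer {ϖ : O} (hϖ : Irreducible ϖ) :
    WO.res p O R (algebraMap O (WO p O R) ϖ) = 0 := by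
  rw [WO.res_algebraMap, (residue_eq_zero_iff ϖ).mpr (uniformizer_mem hϖ), map_zero]

/-- Exactness gives divisibility by `ϖ` on each level, with a quotient that lives one level lower.
This is the identification `W_O(R) / ϖ = R`. -/
theorem WO.res_eq_zero_iff {ϖ : O} (hϖ : Irreducible ϖ) (a : WO p O R) :
    WO.res p O R a = 0 ↔ ∃ b, a = algebraMap O (WO p O R) ϖ * b := by
  constructor
  · intro h
    have h1 : a.1 1 = 0 := WOLevel.res_injective O (by rw [← WO.res_eq, h, map_zero])
    have h2 : ∀ m, ∃ b, WOLevel.shift p O R ϖ (uniformizer_mem hϖ) m b = a.1 (m + 1) := fun m =>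
      (WOLevel.exact_shift_toOne hϖ m _).mp (by rw [WO.toOne, h1])
    choose b hb using h2
    -- The quotients are unique because the shift is injective, so they are compatible and define an
    -- element of the limit.
    have hb' : b ∈ WOSubring p O R := fun m => WOLevel.shift_injective hϖ m (by
      rw [hb, ← WOLevel.transition_shift, hb, a.2])
    refine ⟨⟨b, hb'⟩, WO.ext_level fun m => ?_⟩
    exact (hb m).symm.trans (WO.uniformizer_mul_level hϖ (⟨b, hb'⟩ : WO p O R) m).symm
  · rintro ⟨b, rfl⟩
    rw [map_mul, WO.res_uniformizer hϖ, zero_mul]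

variable (p O R) in
/-- The map `W(R) → W_O(R)`. -/
noncomputable def WO.ofWitt : WittVector p R →+* WO p O R :=
  (RingHom.pi fun m =>
    (Algebra.TensorProduct.includeLeftRingHom (R := WittVector p (ResidueField O))
      (A := WittVector p R) (B := O ⧸ maximalIdeal O ^ m))).codRestrict (WOSubring p O R)
      fun x m => by
    change Algebra.TensorProduct.map _ _ (_ ⊗ₜ 1) = _ ⊗ₜ 1
    rw [Algebra.TensorProduct.map_tmul, map_one]
    rfl

theorem WO.res_surjective : Function.Surjective (WO.res p O R) := by
  intro x
  refine ⟨WO.ofWitt p O R (WittVector.teichmuller p x), ?_⟩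
  rw [WO.res_eq]
  refine (WOLevel.res_tmul _ 1).trans ?_
  rw [WittVector.teichmuller_coeff_zero, map_one, map_one, mul_one]

theorem WOLevel.ofBase_pow_uniformizer {ϖ : O} (hϖ : Irreducible ϖ) (m : ℕ) :
    WOLevel.ofBase p O R m ϖ ^ m = 0 := by
  rw [← map_pow]
  change (1 : WittVector p R) ⊗ₜ Ideal.Quotient.mk _ (ϖ ^ m) = 0
  rw [Ideal.Quotient.eq_zero_iff_mem.mpr (Ideal.pow_mem_pow (uniformizer_mem hϖ) m),
    TensorProduct.tmul_zero]

/-- `ϖ` is nilpotent on each level, so inverses exist there. Inverses are unique, hence compatible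
with the transition maps. -/
theorem WO.isUnit_one_add {ϖ : O} (hϖ : Irreducible ϖ) (a : WO p O R) :
    IsUnit (1 + algebraMap O (WO p O R) ϖ * a) := by
  have h : ∀ m, IsUnit ((1 + algebraMap O (WO p O R) ϖ * a).1 m) := fun m => by
    change IsUnit (1 + WOLevel.ofBase p O R m ϖ * a.1 m)
    refine IsNilpotent.isUnit_one_add ⟨m, ?_⟩
    rw [mul_pow, WOLevel.ofBase_pow_uniformizer hϖ, zero_mul]
  choose b hb using fun m => (h m).exists_right_inv
  have hb' : ∀ m, WOLevel.transition p O R m (b (m + 1)) = b m := fun m => by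
    have h1 := congrArg (WOLevel.transition p O R m) (hb (m + 1))
    rw [map_mul, map_one, (1 + algebraMap O (WO p O R) ϖ * a).2 m] at h1
    exact (h m).mul_left_cancel (h1.trans (hb m).symm)
  exact IsUnit.of_mul_eq_one ⟨b, hb'⟩ (Subtype.ext (funext hb))

theorem WO.isUnit_of_isUnit_res {ϖ : O} (hϖ : Irreducible ϖ) {a : WO p O R}
    (h : IsUnit (WO.res p O R a)) : IsUnit a := by
  obtain ⟨y, hy⟩ := h.exists_right_inv
  obtain ⟨b, rfl⟩ := WO.res_surjective (O := O) (p := p) y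
  obtain ⟨c, hc⟩ := (WO.res_eq_zero_iff hϖ (a * b - 1)).mp (by
    rw [map_sub, map_mul, hy, map_one, sub_self])
  have : a * b = 1 + algebraMap O (WO p O R) ϖ * c := by rw [← hc]; ring
  exact isUnit_of_mul_isUnit_left (this ▸ WO.isUnit_one_add hϖ c)

theorem WO.eq_zero_of_forall_pow_dvd {ϖ : O} (hϖ : Irreducible ϖ) {a : WO p O R}
    (h : ∀ m, algebraMap O (WO p O R) ϖ ^ m ∣ a) : a = 0 := by
  refine Subtype.ext (funext fun m => ?_)
  obtain ⟨b, rfl⟩ := h m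
  change WOLevel.ofBase p O R m ϖ ^ m * b.1 m = 0
  rw [WOLevel.ofBase_pow_uniformizer hϖ, zero_mul]

end WittLevels

/-! ### Geometric points of perfect rings -/

section GeometricPoints

/-- Every prime ideal is the kernel of a geometric point. -/
theorem exists_geometric_point (k : Type v) [Field k] {R : Type u} [CommRing R] [Algebra k R]
    (P : Ideal R) [P.IsPrime] :
    ∃ (K : Type u) (_ : Field K) (_ : IsAlgClosed K) (_ : Algebra k K) (f : R →ₐ[k] K),
      RingHom.ker f = P ∧ ∃ g : P.ResidueField →+* K, f.toRingHom = g.comp (algebraMap R P.ResidueField) := by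
  let g : P.ResidueField →+* AlgebraicClosure P.ResidueField := algebraMap _ _
  let F : R →+* AlgebraicClosure P.ResidueField := g.comp (algebraMap R P.ResidueField)
  let _ : Algebra k (AlgebraicClosure P.ResidueField) := (F.comp (algebraMap k R)).toAlgebra
  refine ⟨AlgebraicClosure P.ResidueField, inferInstance, inferInstance, ‹_›,
    ⟨F, fun _ => rfl⟩, ?_, g, rfl⟩
  ext x
  change g (algebraMap R P.ResidueField x) = 0 ↔ _
  rw [map_eq_zero, Ideal.algebraMap_residueField_eq_zero]

theorem isReduced_of_perfectRing (p : ℕ) [Fact p.Prime] (R : Type u) [CommRing R] [CharP R p]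
    [PerfectRing R p] : IsReduced R := by
  refine ⟨fun x ⟨m, hm⟩ => ?_⟩
  refine (iterateFrobeniusEquiv R p m).injective ?_
  rw [map_zero, iterateFrobeniusEquiv_apply, iterateFrobenius_def]
  exact pow_eq_zero_of_le (Nat.lt_pow_self (Fact.out : p.Prime).one_lt).le hm

/-- A perfect ring is reduced, so its primes intersect in zero, and each of them is the kernel of a
geometric point. -/
theorem eq_zero_of_forall_geometric (k : Type v) [Field k] (p : ℕ) [Fact p.Prime] {R : Type u}
    [CommRing R] [Algebra k R] [CharP R p] [PerfectRing R p] (x : R)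
    (h : ∀ (K : Type u) [Field K] [IsAlgClosed K] [Algebra k K] (f : R →ₐ[k] K), f x = 0) :
    x = 0 := by
  have := isReduced_of_perfectRing p R
  rw [← isNilpotent_iff_eq_zero, nilpotent_iff_mem_prime]
  intro P hP
  obtain ⟨K, _, _, _, f, hf, -⟩ := exists_geometric_point k P
  rw [← hf]
  exact h K f

theorem charP_of_algebra (k : Type v) [Field k] (p : ℕ) [CharP k p] (K : Type u) [Field K]
    [Algebra k K] : CharP K p :=
  charP_of_injective_algebraMap (algebraMap k K).injective p

theorem perfectRing_of_isAlgClosed (K : Type u) [Field K] [IsAlgClosed K] (p : ℕ) [Fact p.Prime]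
    [CharP K p] : PerfectRing K p := inferInstance

end GeometricPoints

/-! ### Functoriality of ramified Witt vectors, and integrality at geometric points -/

section WittFunctoriality

variable {p : ℕ} [Fact p.Prime] {O : Type v} [CommRing O] [IsDomain O]
  [IsDiscreteValuationRing O] [IsAdicComplete (maximalIdeal O) O] [Finite (ResidueField O)]
  [CharP (ResidueField O) p] {R R' R'' : Type u} [CommRing R] [Algebra (ResidueField O) R]
  [CommRing R'] [Algebra (ResidueField O) R'] [CommRing R''] [Algebra (ResidueField O) R'']

attribute [local instance] algebraWitt

theorem WO.res_map (f : R →ₐ[ResidueField O] R') (a : WO p O R) :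
    WO.res p O R' (WO.map p O f a) = f (WO.res p O R a) := by
  rw [WO.res_eq, WO.res_eq]
  change WOLevel.res p O R' (WOLevel.map p O f 1 (a.1 1)) = _
  induction a.1 1 using TensorProduct.induction_on with
  | zero => simp
  | tmul w y =>
    obtain ⟨y, rfl⟩ := Ideal.Quotient.mk_surjective y
    rw [WOLevel.res_tmul, map_mul, f.commutes]
    refine (WOLevel.res_tmul (WittVector.map f.toRingHom w) y).trans ?_
    rw [WittVector.map_coeff]
    rfl
  | add x y hx hy => simp only [map_add, hx, hy]

theorem WO.map_comp (g : R' →ₐ[ResidueField O] R'') (f : R →ₐ[ResidueField O] R')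
    (a : WO p O R) : WO.map p O g (WO.map p O f a) = WO.map p O (g.comp f) a := by
  refine Subtype.ext (funext fun m => ?_)
  change WOLevel.map p O g m (WOLevel.map p O f m (a.1 m)) = WOLevel.map p O (g.comp f) m (a.1 m)
  induction a.1 m using TensorProduct.induction_on with
  | zero => simp
  | tmul w y =>
    change WittVector.map g.toRingHom (WittVector.map f.toRingHom w) ⊗ₜ _ =
      WittVector.map (g.comp f).toRingHom w ⊗ₜ _
    congr 1
  | add x y hx hy => simp only [map_add, hx, hy]

variable (ϖ : O)

theorem LO.map_algebraMap (f : R →ₐ[ResidueField O] R') (a : WO p O R) :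
    LO.map p ϖ f (algebraMap (WO p O R) (LO p ϖ R) a) =
      algebraMap (WO p O R') (LO p ϖ R') (WO.map p O f a) :=
  IsLocalization.Away.lift_eq _ _ _

theorem LO.map_comp (g : R' →ₐ[ResidueField O] R'') (f : R →ₐ[ResidueField O] R')
    (a : LO p ϖ R) : LO.map p ϖ g (LO.map p ϖ f a) = LO.map p ϖ (g.comp f) a := by
  have : (LO.map p ϖ g).comp (LO.map p ϖ f) = LO.map p ϖ (g.comp f) := by
    refine IsLocalization.ringHom_ext (Submonoid.powers (algebraMap O (WO p O R) ϖ)) ?_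
    ext a
    simp only [RingHom.comp_apply, LO.map_algebraMap, WO.map_comp]
  exact RingHom.congr_fun this a

theorem LO.map_unitϖ (f : R →ₐ[ResidueField O] R') :
    Units.map (LO.map p ϖ f).toMonoidHom (unitϖ p ϖ R) = unitϖ p ϖ R' := by
  ext
  change LO.map p ϖ f (algebraMap _ _ _) = algebraMap _ _ _
  rw [LO.map_algebraMap, WO.map_algebraMap]

theorem LO.map_unitϖ_zpow (f : R →ₐ[ResidueField O] R') (d : ℤ) :
    LO.map p ϖ f ((unitϖ p ϖ R ^ d : (LO p ϖ R)ˣ) : LO p ϖ R) =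
      ((unitϖ p ϖ R' ^ d : (LO p ϖ R')ˣ) : LO p ϖ R') := by
  rw [← LO.map_unitϖ ϖ f, ← map_zpow]; rfl

theorem LO.exists_mul_pow_eq (x : LO p ϖ R) :
    ∃ (m : ℕ) (a : WO p O R), algebraMap (WO p O R) (LO p ϖ R) (algebraMap O (WO p O R) ϖ) ^ m * x =
      algebraMap (WO p O R) (LO p ϖ R) a := by
  obtain ⟨m, a, h⟩ := IsLocalization.Away.surj (algebraMap O (WO p O R) ϖ) x
  exact ⟨m, a, by rw [mul_comm]; exact h⟩

variable {ϖ} [CharP R p] [PerfectRing R p]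

theorem LO.algebraMap_injective (hϖ : Irreducible ϖ) :
    Function.Injective (algebraMap (WO p O R) (LO p ϖ R)) := by
  refine IsLocalization.injective (LO p ϖ R)
    (M := Submonoid.powers (algebraMap O (WO p O R) ϖ)) ?_
  rw [Submonoid.powers_le, mem_nonZeroDivisors_iff_right]
  exact fun a ha => WO.eq_zero_of_uniformizer_mul hϖ a (by rw [mul_comm]; exact ha)

/-- An element of `W_O(R)[1/ϖ]` is integral if it is so at all geometric points. -/
theorem LO.mem_range_of_forall_geometric (hϖ : Irreducible ϖ) (x : LO p ϖ R)
    (h : ∀ (K : Type u) [Field K] [IsAlgClosed K] [Algebra (ResidueField O) K]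
      (f : R →ₐ[ResidueField O] K),
      LO.map p ϖ f x ∈ (algebraMap (WO p O K) (LO p ϖ K)).range) :
    x ∈ (algebraMap (WO p O R) (LO p ϖ R)).range := by
  -- Induction on a bound `m` for the order of the pole of `x`.
  obtain ⟨m, a, ha⟩ := LO.exists_mul_pow_eq ϖ x
  induction m generalizing a with
  | zero => exact ⟨a, by rw [← ha, pow_zero, one_mul]⟩
  | succ m ih =>
    -- At a geometric point `a` becomes `ϖ ^ (m + 1)` times an integral element, so its residue
    -- vanishes there. The residue is therefore zero in `R`, so `ϖ` divides `a` and the bound drops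
    -- by one.
    have h0 : WO.res p O R a = 0 := eq_zero_of_forall_geometric (ResidueField O) p _
        fun K _ _ _ f => by
      have := charP_of_algebra (ResidueField O) p K
      have := perfectRing_of_isAlgClosed K p
      obtain ⟨c, hc⟩ := h K f
      have h1 := congrArg (LO.map p ϖ f) ha
      rw [map_mul, map_pow, LO.map_algebraMap, LO.map_algebraMap, WO.map_algebraMap, ← hc,
        ← map_pow, ← map_mul] at h1
      rw [← WO.res_map, ← LO.algebraMap_injective hϖ h1, map_mul, map_pow,
        WO.res_uniformizer hϖ, pow_succ, mul_zero, zero_mul]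
    obtain ⟨b, rfl⟩ := (WO.res_eq_zero_iff hϖ a).mp h0
    refine ih b ?_
    rw [map_mul, pow_succ', mul_assoc] at ha
    exact (IsLocalization.Away.algebraMap_isUnit (algebraMap O (WO p O R) ϖ)).mul_left_cancel ha

end WittFunctoriality

/-! ### Frames of lattices -/

section Frames

variable {A L : Type*} [CommRing A] [CommRing L] [Algebra A L] {n m m' : ℕ}

theorem mulVec_apply_eq_sum (X : Matrix (Fin m) (Fin n) L) (v : Fin n → L) (a : Fin m) :
    X.mulVec v a = ∑ b, X a b * v b := rfl

/-- The columns of `B` generate `M`, and `C` gives coordinates with respect to them. -/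
structure IsFrame (B : Matrix (Fin n) (Fin m) L) (C : Matrix (Fin m) (Fin n) L)
    (M : Submodule A (Fin n → L)) : Prop where
  mul_eq_one : B * C = 1
  int : ∀ a b, (C * B) a b ∈ (algebraMap A L).range
  mem_iff : ∀ x, x ∈ M ↔ ∀ a, (C.mulVec x) a ∈ (algebraMap A L).range

namespace IsFrame

variable {B : Matrix (Fin n) (Fin m) L} {C : Matrix (Fin m) (Fin n) L}
  {B' : Matrix (Fin n) (Fin m') L} {C' : Matrix (Fin m') (Fin n) L}
  {M N : Submodule A (Fin n → L)}

theorem mulVec_mulVec (h : IsFrame B C M) (x : Fin n → L) : B.mulVec (C.mulVec x) = x := by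
  rw [Matrix.mulVec_mulVec, h.mul_eq_one, Matrix.one_mulVec]

theorem mulVec_mem (h : IsFrame B C M) {y : Fin m → L}
    (hy : ∀ a, y a ∈ (algebraMap A L).range) : B.mulVec y ∈ M := by
  rw [h.mem_iff]
  intro a
  rw [Matrix.mulVec_mulVec, mulVec_apply_eq_sum]
  exact Subring.sum_mem _ fun b _ => Subring.mul_mem _ (h.int a b) (hy b)

theorem col_mem (h : IsFrame B C M) (a : Fin m) : (fun j => B j a) ∈ M := by
  rw [h.mem_iff]
  intro b
  exact h.int b a

theorem eq_of_frame (h : IsFrame B C M) (h' : IsFrame B C N) : M = N := by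
  ext x
  rw [h.mem_iff, h'.mem_iff]

/-- The entries of `C' * B` are the coordinates in `N` of the generators of `M`. Inclusion thus
becomes integrality of finitely many elements, which can be tested at geometric points and cut out
by an ideal. -/
theorem le_iff (h : IsFrame B C M) (h' : IsFrame B' C' N) :
    M ≤ N ↔ ∀ a b, (C' * B) a b ∈ (algebraMap A L).range := by
  constructor
  · intro hle a b
    exact (h'.mem_iff _).mp (hle (h.col_mem b)) a
  · intro hint x hx
    rw [h'.mem_iff]
    intro a
    rw [← h.mulVec_mulVec x, Matrix.mulVec_mulVec, mulVec_apply_eq_sum]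
    exact Subring.sum_mem _ fun b _ => Subring.mul_mem _ (hint a b) ((h.mem_iff x).mp hx b)

theorem eq_span (h : IsFrame B C M) : M = Submodule.span A (Set.range fun a j => B j a) := by
  apply le_antisymm
  · intro x hx
    rw [← h.mulVec_mulVec x, Matrix.mulVec_eq_sum]
    refine Submodule.sum_mem _ fun a _ => ?_
    obtain ⟨c, hc⟩ := (h.mem_iff x).mp hx a
    have : MulOpposite.op (C.mulVec x a) • B.transpose a = c • fun j => B j a := by
      rw [← hc]
      ext j
      simp [Algebra.smul_def, mul_comm]
    rw [this]
    exact Submodule.smul_mem _ _ (Submodule.subset_span ⟨a, rfl⟩)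
  · rw [Submodule.span_le]
    rintro _ ⟨a, rfl⟩
    exact h.col_mem a

theorem of_mul_eq_one {g h : Matrix (Fin n) (Fin n) L} (hgh : g * h = 1) :
    IsFrame g h (Submodule.span A (Set.range fun a j => g j a)) where
  mul_eq_one := hgh
  int a b := by
    rw [mul_eq_one_comm.mp hgh, Matrix.one_apply]
    split_ifs
    · exact Subring.one_mem _
    · exact Subring.zero_mem _
  mem_iff x := by
    constructor
    · intro hx
      induction hx using Submodule.span_induction with
      | mem x hx =>
        obtain ⟨b, rfl⟩ := hx
        intro a
        change (h * g) a b ∈ _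
        rw [mul_eq_one_comm.mp hgh, Matrix.one_apply]
        split_ifs
        · exact Subring.one_mem _
        · exact Subring.zero_mem _
      | zero => intro a; rw [Matrix.mulVec_zero]; exact Subring.zero_mem _
      | add x y _ _ hx hy =>
        intro a; rw [Matrix.mulVec_add]; exact Subring.add_mem _ (hx a) (hy a)
      | smul c x _ hx =>
        intro a
        rw [Matrix.mulVec_smul, Pi.smul_apply, Algebra.smul_def]
        exact Subring.mul_mem _ ⟨c, rfl⟩ (hx a)
    · intro hx
      have : x = g.mulVec (h.mulVec x) := by
        rw [Matrix.mulVec_mulVec, hgh, Matrix.one_mulVec]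
      rw [this, Matrix.mulVec_eq_sum]
      refine Submodule.sum_mem _ fun a _ => ?_
      obtain ⟨c, hc⟩ := hx a
      have : MulOpposite.op (h.mulVec x a) • g.transpose a = c • fun j => g j a := by
        rw [← hc]
        ext j
        simp [Algebra.smul_def, mul_comm]
      rw [this]
      exact Submodule.smul_mem _ _ (Submodule.subset_span ⟨a, rfl⟩)

theorem module_finite (h : IsFrame B C M) : Module.Finite A M := by
  rw [Module.Finite.iff_fg, h.eq_span]
  exact Submodule.fg_span (Set.finite_range _)

/-- The coordinates of an element of a module with a frame. -/
noncomputable def coord (h : IsFrame B C M) (hinj : Function.Injective (algebraMap A L)) :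
    M →ₗ[A] (Fin m → A) where
  toFun x a := ((h.mem_iff x.1).mp x.2 a).choose
  map_add' x y := by
    ext a
    apply hinj
    have h1 := ((h.mem_iff (x + y).1).mp (x + y).2 a).choose_spec
    have h2 := ((h.mem_iff x.1).mp x.2 a).choose_spec
    have h3 := ((h.mem_iff y.1).mp y.2 a).choose_spec
    rw [Pi.add_apply, map_add, h1, h2, h3, Submodule.coe_add, Matrix.mulVec_add, Pi.add_apply]
  map_smul' c x := by
    ext a
    apply hinj
    have h1 := ((h.mem_iff (c • x).1).mp (c • x).2 a).choose_spec
    have h2 := ((h.mem_iff x.1).mp x.2 a).choose_spec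
    rw [Pi.smul_apply, smul_eq_mul, map_mul, h1, RingHom.id_apply, h2, Submodule.coe_smul,
      Matrix.mulVec_smul, Pi.smul_apply, Algebra.smul_def]

theorem algebraMap_coord (h : IsFrame B C M) (hinj : Function.Injective (algebraMap A L))
    (x : M) (a : Fin m) : algebraMap A L (h.coord hinj x a) = C.mulVec x.1 a :=
  ((h.mem_iff x.1).mp x.2 a).choose_spec

/-- The linear combinations of the columns. -/
noncomputable def comb (h : IsFrame B C M) : (Fin m → A) →ₗ[A] M where
  toFun y := ⟨B.mulVec fun a => algebraMap A L (y a), h.mulVec_mem fun a => ⟨_, rfl⟩⟩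
  map_add' x y := by
    ext j
    simp only [Submodule.coe_add, Pi.add_apply, map_add, mulVec_apply_eq_sum, mul_add,
      Finset.sum_add_distrib]
  map_smul' c y := by
    ext j
    simp only [Submodule.coe_smul, Pi.smul_apply, smul_eq_mul, map_mul, RingHom.id_apply,
      mulVec_apply_eq_sum, Algebra.smul_def c (_ : L), Finset.mul_sum]
    exact Finset.sum_congr rfl fun a _ => by ring

theorem comb_coord (h : IsFrame B C M) (hinj : Function.Injective (algebraMap A L)) (x : M) :
    h.comb (h.coord hinj x) = x := by
  ext1
  change B.mulVec _ = _
  simp_rw [h.algebraMap_coord hinj]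
  exact h.mulVec_mulVec _

theorem comb_surjective (h : IsFrame B C M) (hinj : Function.Injective (algebraMap A L)) :
    Function.Surjective h.comb := fun x => ⟨_, h.comb_coord hinj x⟩

theorem module_projective (h : IsFrame B C M) (hinj : Function.Injective (algebraMap A L)) :
    Module.Projective A M :=
  Module.Projective.of_split (h.coord hinj) h.comb (LinearMap.ext (h.comb_coord hinj))

theorem span_eq_top (h : IsFrame B C M) : Submodule.span L (M : Set (Fin n → L)) = ⊤ := by
  rw [eq_top_iff]
  intro x _
  rw [← h.mulVec_mulVec x, Matrix.mulVec_eq_sum]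
  refine Submodule.sum_mem _ fun a _ => ?_
  have : MulOpposite.op (C.mulVec x a) • B.transpose a = C.mulVec x a • fun j => B j a := by
    ext j
    simp [mul_comm]
  rw [this]
  exact Submodule.smul_mem _ _ (Submodule.subset_span (h.col_mem a))

end IsFrame

/-! ### Frames of finite projective spanning submodules -/

section Localization

variable (t : A) [IsLocalization.Away t L]

/-- All large exponents are allowed, rather than a single one, because the summands of a sum need a
common exponent. -/
theorem exists_pow_smul_mem {M : Submodule A (Fin n → L)}
    (hM : Submodule.span L (M : Set (Fin n → L)) = ⊤) (x : Fin n → L) :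
    ∃ k : ℕ, ∀ l, k ≤ l → t ^ l • x ∈ M := by
  have hx : x ∈ Submodule.span L (M : Set (Fin n → L)) := hM ▸ Submodule.mem_top
  induction hx using Submodule.span_induction with
  | mem x hx => exact ⟨0, fun l _ => M.smul_mem _ hx⟩
  | zero => exact ⟨0, fun l _ => by simp⟩
  | add x y _ _ hx hy =>
    obtain ⟨k, hk⟩ := hx
    obtain ⟨l, hl⟩ := hy
    refine ⟨max k l, fun r hr => ?_⟩
    rw [smul_add]
    exact M.add_mem (hk r (le_of_max_le_left hr)) (hl r (le_of_max_le_right hr))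
  | smul c x _ hx =>
    obtain ⟨k, hk⟩ := hx
    obtain ⟨l, a, ha⟩ := IsLocalization.Away.surj t c
    refine ⟨k + l, fun r hr => ?_⟩
    obtain ⟨s, rfl⟩ := Nat.exists_eq_add_of_le hr
    have : t ^ (k + l + s) • c • x = a • t ^ (k + s) • x := by
      ext j
      simp only [Pi.smul_apply, smul_eq_mul]
      simp only [Algebra.smul_def, map_pow, ← ha]
      ring
    rw [this]
    exact M.smul_mem _ (hk _ (Nat.le_add_right _ _))

theorem exists_pow_smul_mem_forall {ι : Type*} [Finite ι] {M : Submodule A (Fin n → L)}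
    (hM : Submodule.span L (M : Set (Fin n → L)) = ⊤) (x : ι → Fin n → L) :
    ∃ k : ℕ, ∀ i, t ^ k • x i ∈ M := by
  have := Fintype.ofFinite ι
  choose k hk using fun i => exists_pow_smul_mem t hM (x i)
  exact ⟨Finset.univ.sup k, fun i => hk i _ (Finset.le_sup (Finset.mem_univ i))⟩

include t in
/-- A linear map from a spanning module to `A ^ m` extends to a matrix. -/
theorem exists_matrix_of_linearMap {M : Submodule A (Fin n → L)}
    (hM : Submodule.span L (M : Set (Fin n → L)) = ⊤) (s : M →ₗ[A] (Fin m → A)) :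
    ∃ C : Matrix (Fin m) (Fin n) L, ∀ x a, C.mulVec x.1 a = algebraMap A L (s x a) := by
  have hu : IsUnit (algebraMap A L t) := IsLocalization.Away.algebraMap_isUnit t
  -- The unit vectors `e_j` need not lie in `M`, but `t ^ k • e_j` does. Column `j` of the matrix is
  -- forced to be `t ^ (-k)` times the image of `t ^ k • e_j`.
  obtain ⟨k, hk⟩ := exists_pow_smul_mem_forall t hM fun j : Fin n => Pi.single j (1 : L)
  refine ⟨Matrix.of fun a j => (↑(hu.unit ^ k)⁻¹ : L) * algebraMap A L (s ⟨_, hk j⟩ a),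
    fun x a => ?_⟩
  choose l α hα using fun j => IsLocalization.Away.surj t (x.1 j)
  -- `t ^ r` is a common denominator of the coordinates of `x`, so `t ^ (k + r) • x` is an
  -- `A`-linear combination of the vectors `t ^ k • e_j`.
  let r := Finset.univ.sup l
  have hr : ∀ j, algebraMap A L (t ^ (r - l j) * α j) = algebraMap A L t ^ r * x.1 j := fun j => by
    have : r = (r - l j) + l j := (Nat.sub_add_cancel (Finset.le_sup (Finset.mem_univ j))).symm
    conv_rhs => rw [this]
    rw [map_mul, ← hα, map_pow]
    ring
  have hsum : t ^ (k + r) • x = ∑ j, (t ^ (r - l j) * α j) • ⟨_, hk j⟩ := by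
    ext i
    simp only [Submodule.coe_smul, Pi.smul_apply, Submodule.coe_sum, Finset.sum_apply]
    simp only [Algebra.smul_def, hr, Pi.single_apply, map_pow, mul_ite, mul_one, mul_zero]
    rw [Finset.sum_ite_eq Finset.univ i, if_pos (Finset.mem_univ i)]
    ring
  have h1 := congrArg (fun y => algebraMap A L (s y a)) hsum
  simp only [map_smul, map_sum, Pi.smul_apply, smul_eq_mul, map_mul, Finset.sum_apply] at h1
  refine (hu.pow (k + r)).mul_left_cancel ?_
  rw [← map_pow, ← map_mul, map_mul, h1, Matrix.mulVec, dotProduct, Finset.mul_sum]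
  refine Finset.sum_congr rfl fun j _ => ?_
  rw [← map_mul, hr, Matrix.of_apply]
  have h2 : (↑(hu.unit ^ k)⁻¹ : L) * algebraMap A L t ^ k = 1 := by
    have := (hu.unit ^ k).inv_mul
    rwa [Units.val_pow_eq_pow_val, IsUnit.unit_spec] at this
  rw [map_pow, pow_add]
  calc _ = ((↑(hu.unit ^ k)⁻¹ : L) * algebraMap A L t ^ k) * (algebraMap A L t ^ r *
        algebraMap A L (s ⟨_, hk j⟩ a) * x.1 j) := by ring
    _ = _ := by rw [h2]; ring

include t in
-- A surjection `A ^ m → M` provides the columns of `B`, and the extension of a section to `L ^ n`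
-- provides `C`. The formulas for `C * B` and `B` are recorded in order to recognize square frames
-- when the surjection comes from a basis.
theorem exists_isFrame {M : Submodule A (Fin n → L)}
    (hM : Submodule.span L (M : Set (Fin n → L)) = ⊤) (f : (Fin m → A) →ₗ[A] M)
    (s : M →ₗ[A] (Fin m → A)) (hfs : ∀ x, f (s x) = x) :
    ∃ (B : Matrix (Fin n) (Fin m) L) (C : Matrix (Fin m) (Fin n) L), IsFrame B C M ∧
      (∀ a b, (C * B) a b = algebraMap A L (s (f (Pi.single b 1)) a)) ∧
      ∀ b j, B j b = (f (Pi.single b 1)).1 j := by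
  obtain ⟨C, hC⟩ := exists_matrix_of_linearMap t hM s
  let B : Matrix (Fin n) (Fin m) L := Matrix.of fun j b => (f (Pi.single b 1)).1 j
  have hCB : ∀ a b, (C * B) a b = algebraMap A L (s (f (Pi.single b 1)) a) := fun a b =>
    hC _ a
  have hB : ∀ y : Fin m → A, B.mulVec (fun a => algebraMap A L (y a)) = (f y).1 := fun y => by
    conv_rhs => rw [pi_eq_sum_univ' y]
    ext j
    simp only [map_sum, map_smul, Submodule.coe_sum, Submodule.coe_smul, Finset.sum_apply,
      Pi.smul_apply, Matrix.mulVec, dotProduct]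
    refine Finset.sum_congr rfl fun a _ => ?_
    rw [Algebra.smul_def, mul_comm]
    rfl
  have h1 : ∀ x : M, B.mulVec (C.mulVec x.1) = x.1 := fun x => by
    have : C.mulVec x.1 = fun a => algebraMap A L (s x a) := funext (hC x)
    rw [this, hB, hfs]
  have hu : IsUnit (algebraMap A L t) := IsLocalization.Away.algebraMap_isUnit t
  -- The identity holds on `M`. Every vector lies in `M` after multiplication by a power of `t`,
  -- which is a unit of `L`.
  have h2 : ∀ x, B.mulVec (C.mulVec x) = x := fun x => by
    obtain ⟨k, hk⟩ := exists_pow_smul_mem t hM x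
    have := h1 ⟨_, hk k le_rfl⟩
    simp only [Matrix.mulVec_smul] at this
    ext j
    have := congrFun this j
    rw [Pi.smul_apply, Pi.smul_apply, Algebra.smul_def, Algebra.smul_def, map_pow] at this
    exact (hu.pow k).mul_left_cancel this
  refine ⟨B, C, ⟨?_, fun a b => ⟨_, (hCB a b).symm⟩, fun x => ⟨fun hx a => ⟨_, (hC ⟨x, hx⟩ a).symm⟩,
    fun hx => ?_⟩⟩, hCB, fun _ _ => rfl⟩
  · refine Matrix.ext_of_mulVec_single fun j => ?_
    rw [← Matrix.mulVec_mulVec, h2, Matrix.one_mulVec]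
  · choose y hy using hx
    have : C.mulVec x = fun a => algebraMap A L (y a) := funext fun a => (hy a).symm
    rw [← h2 x, this, hB]
    exact (f y).2

end Localization

end Frames

/-! ### Operations on lattices -/

section LatticeOperations

variable {p : ℕ} [Fact p.Prime] {O : Type v} [CommRing O] [IsDomain O]
  [IsDiscreteValuationRing O] [IsAdicComplete (maximalIdeal O) O] [Finite (ResidueField O)]
  [CharP (ResidueField O) p] {ϖ : O} {n m : ℕ}
  {R R' R'' : Type u} [CommRing R] [Algebra (ResidueField O) R]
  [CommRing R'] [Algebra (ResidueField O) R'] [CommRing R''] [Algebra (ResidueField O) R'']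
  {M N : Submodule (WO p O R) (Amb p ϖ n R)}

theorem pullback_mono (f : R →ₐ[ResidueField O] R') (h : M ≤ N) : pullback f M ≤ pullback f N :=
  Submodule.span_mono (Set.image_mono h)

theorem mem_pullback_of_mem (f : R →ₐ[ResidueField O] R') {x : Amb p ϖ n R} (hx : x ∈ M) :
    (fun j => LO.map p ϖ f (x j)) ∈ pullback f M :=
  Submodule.subset_span ⟨x, hx, rfl⟩

theorem pullback_pullback (g : R' →ₐ[ResidueField O] R'') (f : R →ₐ[ResidueField O] R')
    (M : Submodule (WO p O R) (Amb p ϖ n R)) :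
    pullback g (pullback f M) = pullback (g.comp f) M := by
  apply le_antisymm
  · refine Submodule.span_le.mpr ?_
    rintro _ ⟨x, hx, rfl⟩
    induction hx using Submodule.span_induction with
    | mem x hx =>
      obtain ⟨y, hy, rfl⟩ := hx
      simp only [LO.map_comp]
      exact mem_pullback_of_mem _ hy
    | zero => simp only [Pi.zero_apply, map_zero]; exact Submodule.zero_mem _
    | add x y _ _ hx hy => simp only [Pi.add_apply, map_add]; exact Submodule.add_mem _ hx hy
    | smul c x _ hx =>
      have : (fun j => LO.map p ϖ g ((c • x) j)) =
          WO.map p O g c • fun j => LO.map p ϖ g (x j) := by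
        ext j
        simp only [Pi.smul_apply]
        rw [Algebra.smul_def, Algebra.smul_def, map_mul, LO.map_algebraMap]
      simp only [this]
      exact Submodule.smul_mem _ _ hx
  · refine Submodule.span_le.mpr ?_
    rintro _ ⟨x, hx, rfl⟩
    simp only [← LO.map_comp]
    exact mem_pullback_of_mem _ (mem_pullback_of_mem _ hx)

theorem frob_comp (f : R →ₐ[ResidueField O] R') : (frob O R').comp f = f.comp (frob O R) := by
  ext x
  exact (map_pow f x _).symm

theorem pullback_twist (f : R →ₐ[ResidueField O] R') (M : Submodule (WO p O R) (Amb p ϖ n R)) :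
    pullback f (twist M) = twist (pullback f M) := by
  rw [twist, twist, pullback_pullback, pullback_pullback, frob_comp]

theorem map_mem_range (f : R →ₐ[ResidueField O] R') {x : LO p ϖ R}
    (hx : x ∈ (algebraMap (WO p O R) (LO p ϖ R)).range) :
    LO.map p ϖ f x ∈ (algebraMap (WO p O R') (LO p ϖ R')).range := by
  obtain ⟨c, rfl⟩ := hx
  exact ⟨_, (LO.map_algebraMap ϖ f c).symm⟩

theorem matrix_map_mulVec {S S' : Type*} [CommRing S] [CommRing S'] {m n : ℕ} (f : S →+* S')
    (X : Matrix (Fin m) (Fin n) S) (v : Fin n → S) :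
    (X.map f).mulVec (fun j => f (v j)) = fun a => f (X.mulVec v a) := by
  ext a
  simp [mulVec_apply_eq_sum]

/-- The relations `B * C = 1` and integrality of `C * B` survive any ring homomorphism, so no
flatness of `R → R'` is needed. -/
theorem IsFrame.pullback {B : Matrix (Fin n) (Fin m) (LO p ϖ R)}
    {C : Matrix (Fin m) (Fin n) (LO p ϖ R)} (h : IsFrame B C M) (f : R →ₐ[ResidueField O] R') :
    IsFrame (B.map (LO.map p ϖ f)) (C.map (LO.map p ϖ f)) (pullback f M) where
  mul_eq_one := by rw [← Matrix.map_mul, h.mul_eq_one, Matrix.map_one _ (map_zero _) (map_one _)]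
  int a b := by rw [← Matrix.map_mul]; exact map_mem_range f (h.int a b)
  mem_iff x := by
    constructor
    · intro hx
      induction hx using Submodule.span_induction with
      | mem x hx =>
        obtain ⟨y, hy, rfl⟩ := hx
        rw [matrix_map_mulVec]
        exact fun a => map_mem_range f ((h.mem_iff y).mp hy a)
      | zero => intro a; rw [Matrix.mulVec_zero]; exact Subring.zero_mem _
      | add x y _ _ hx hy =>
        intro a; rw [Matrix.mulVec_add]; exact Subring.add_mem _ (hx a) (hy a)
      | smul c x _ hx =>
        intro a
        rw [Matrix.mulVec_smul, Pi.smul_apply, Algebra.smul_def]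
        exact Subring.mul_mem _ ⟨c, rfl⟩ (hx a)
    · intro hx
      have h1 : x = (B.map (LO.map p ϖ f)).mulVec ((C.map (LO.map p ϖ f)).mulVec x) := by
        rw [Matrix.mulVec_mulVec, ← Matrix.map_mul, h.mul_eq_one,
          Matrix.map_one _ (map_zero _) (map_one _), Matrix.one_mulVec]
      rw [h1, Matrix.mulVec_eq_sum]
      refine Submodule.sum_mem _ fun a _ => ?_
      obtain ⟨c, hc⟩ := hx a
      rw [← hc]
      convert Submodule.smul_mem _ c (mem_pullback_of_mem f (h.col_mem a)) using 1
      ext j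
      simp [Algebra.smul_def, mul_comm]

/-- The frame of the dual. -/
theorem IsFrame.dual {B : Matrix (Fin n) (Fin m) (LO p ϖ R)}
    {C : Matrix (Fin m) (Fin n) (LO p ϖ R)} (h : IsFrame B C M) :
    IsFrame (Matrix.of fun j a => C a (Fin.rev j)) (Matrix.of fun a j => B (Fin.rev j) a)
      (dual M) where
  mul_eq_one := by
    ext i j
    rw [Matrix.mul_apply]
    simp only [Matrix.of_apply]
    have := congrFun (congrFun h.mul_eq_one (Fin.rev j)) (Fin.rev i)
    rw [Matrix.mul_apply, Matrix.one_apply] at this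
    rw [Matrix.one_apply, Finset.sum_congr rfl fun a _ => mul_comm _ _, this]
    simp only [Fin.rev_inj, eq_comm]
  int a b := by
    have := h.int b a
    rw [Matrix.mul_apply] at this ⊢
    simp only [Matrix.of_apply]
    convert this using 1
    rw [← Equiv.sum_comp Fin.revPerm]
    exact Finset.sum_congr rfl fun j _ => by simp [mul_comm]
  mem_iff y := by
    -- In the coordinates of `x` given by `C` and of `y` given by the transposed and reversed `B`,
    -- the pairing is the standard one.
    have key : ∀ x : Amb p ϖ n R, ∑ j, x j * y (Fin.rev j) =
        ∑ a, C.mulVec x a * (Matrix.of fun a j => B (Fin.rev j) a).mulVec y a := fun x => by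
      conv_lhs => rw [← h.mulVec_mulVec x]
      generalize C.mulVec x = z
      simp only [mulVec_apply_eq_sum (X := B), Finset.sum_mul]
      rw [Finset.sum_comm]
      refine Finset.sum_congr rfl fun a _ => ?_
      rw [mulVec_apply_eq_sum, Finset.mul_sum,
        ← Equiv.sum_comp Fin.revPerm (fun j => z a * _)]
      exact Finset.sum_congr rfl fun j _ => by simp; ring
    constructor
    · intro hy a
      have h1 := hy _ (h.col_mem a)
      rw [Submodule.mem_one] at h1
      obtain ⟨c, hc⟩ := h1
      refine ⟨c, hc.trans ?_⟩
      rw [mulVec_apply_eq_sum, ← Equiv.sum_comp Fin.revPerm]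
      exact Finset.sum_congr rfl fun j _ => by simp
    · intro hy x hx
      rw [key, Submodule.mem_one]
      exact Subring.sum_mem (algebraMap (WO p O R) (LO p ϖ R)).range fun a _ =>
        Subring.mul_mem _ ((h.mem_iff x).mp hx a) (hy a)

theorem mem_scale {x : Amb p ϖ n R} :
    x ∈ scale M ↔ ((unitϖ p ϖ R)⁻¹ : (LO p ϖ R)ˣ) • x ∈ M := by
  have h1 : ∀ y : Amb p ϖ n R, LinearMap.lsmul (WO p O R) (Amb p ϖ n R)
      (algebraMap O (WO p O R) ϖ) y = unitϖ p ϖ R • y := fun y => by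
    ext j
    rw [LinearMap.lsmul_apply, Pi.smul_apply, Pi.smul_apply, Algebra.smul_def]
    rfl
  constructor
  · rintro ⟨y, hy, rfl⟩
    rw [h1, inv_smul_smul]
    exact hy
  · intro h
    exact ⟨_, h, by rw [h1, smul_inv_smul]⟩

theorem unitϖ_smul (x : Amb p ϖ n R) :
    unitϖ p ϖ R • x = algebraMap O (WO p O R) ϖ • x := by
  ext j
  rw [Pi.smul_apply, Pi.smul_apply, Algebra.smul_def]
  rfl

theorem scale_mono (h : M ≤ N) : scale M ≤ scale N := Submodule.map_mono h

theorem scale_le_scale_iff : scale M ≤ scale N ↔ M ≤ N := by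
  refine ⟨fun h x hx => ?_, scale_mono⟩
  have := mem_scale.mp (h (mem_scale.mpr (by rwa [inv_smul_smul]) : unitϖ p ϖ R • x ∈ scale M))
  rwa [inv_smul_smul] at this

theorem scale_le_self : scale M ≤ M := by
  rintro _ ⟨x, hx, rfl⟩
  exact M.smul_mem _ hx

/-- `ϖ⁻¹ M`. -/
noncomputable def unscale (M : Submodule (WO p O R) (Amb p ϖ n R)) :
    Submodule (WO p O R) (Amb p ϖ n R) :=
  M.comap (LinearMap.lsmul (WO p O R) (Amb p ϖ n R) (algebraMap O (WO p O R) ϖ))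

theorem mem_unscale {x : Amb p ϖ n R} : x ∈ unscale M ↔ unitϖ p ϖ R • x ∈ M := by
  rw [unitϖ_smul]; rfl

theorem scale_unscale (M : Submodule (WO p O R) (Amb p ϖ n R)) : scale (unscale M) = M := by
  ext x
  rw [mem_scale, mem_unscale, smul_inv_smul]

theorem isFrame_units_smul {B : Matrix (Fin n) (Fin m) (LO p ϖ R)}
    {C : Matrix (Fin m) (Fin n) (LO p ϖ R)} (h : IsFrame B C M) (t : (LO p ϖ R)ˣ)
    (hN : ∀ x, x ∈ N ↔ t⁻¹ • x ∈ M) : IsFrame (t • B) (t⁻¹ • C) N where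
  mul_eq_one := by rw [Matrix.smul_mul, Matrix.mul_smul, smul_inv_smul, h.mul_eq_one]
  int a b := by
    rw [Matrix.smul_mul, Matrix.mul_smul, inv_smul_smul]; exact h.int a b
  mem_iff x := by rw [hN, h.mem_iff, Matrix.mulVec_smul, Matrix.smul_mulVec]

theorem IsFrame.scale {B : Matrix (Fin n) (Fin m) (LO p ϖ R)}
    {C : Matrix (Fin m) (Fin n) (LO p ϖ R)} (h : IsFrame B C M) :
    IsFrame (unitϖ p ϖ R • B) ((unitϖ p ϖ R)⁻¹ • C) (scale M) :=
  isFrame_units_smul h _ fun _ => mem_scale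

theorem IsFrame.unscale {B : Matrix (Fin n) (Fin m) (LO p ϖ R)}
    {C : Matrix (Fin m) (Fin n) (LO p ϖ R)} (h : IsFrame B C M) :
    IsFrame ((unitϖ p ϖ R)⁻¹ • B) ((unitϖ p ϖ R)⁻¹⁻¹ • C) (unscale M) :=
  isFrame_units_smul h _ fun x => by rw [mem_unscale, inv_inv]

theorem mem_trivialLattice {x : Amb p ϖ n R} :
    x ∈ trivialLattice p ϖ n R ↔ ∀ j, x j ∈ (algebraMap (WO p O R) (LO p ϖ R)).range := by
  simp only [trivialLattice, Submodule.mem_pi, Set.mem_univ, true_imp_iff, Submodule.mem_one]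
  rfl

variable (p ϖ n R) in
theorem isFrame_trivialLattice : IsFrame (1 : Matrix (Fin n) (Fin n) (LO p ϖ R)) 1
    (trivialLattice p ϖ n R) where
  mul_eq_one := one_mul 1
  int a b := by
    rw [one_mul, Matrix.one_apply]
    split_ifs
    · exact Subring.one_mem _
    · exact Subring.zero_mem _
  mem_iff x := by rw [Matrix.one_mulVec, mem_trivialLattice]

theorem dual_anti (h : M ≤ N) : dual N ≤ dual M := fun _ hy x hx => hy x (h hx)

theorem exists_frame (hM : IsLattice M) : ∃ (m : ℕ) (B : Matrix (Fin n) (Fin m) (LO p ϖ R))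
    (C : Matrix (Fin m) (Fin n) (LO p ϖ R)), IsFrame B C M := by
  have := hM.finite
  have := hM.projective
  obtain ⟨m, f, hf⟩ := Module.Finite.exists_fin' (WO p O R) M
  obtain ⟨s, hs⟩ := Module.projective_lifting_property f LinearMap.id hf
  obtain ⟨B, C, h, -⟩ := exists_isFrame (algebraMap O (WO p O R) ϖ) hM.span_eq_top f s
    (LinearMap.congr_fun hs)
  exact ⟨m, B, C, h⟩

/-- Both sides have the same frame, since the frame of a dual is obtained by rearranging entries and
this commutes with ring homomorphisms. -/
theorem pullback_dual (f : R →ₐ[ResidueField O] R') (hM : IsLattice M) :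
    pullback f (dual M) = dual (pullback f M) := by
  obtain ⟨m, B, C, h⟩ := exists_frame hM
  exact (h.dual.pullback f).eq_of_frame (h.pullback f).dual

theorem matrix_map_units_smul {k l : ℕ} (f : R →ₐ[ResidueField O] R') (d : ℤ)
    (X : Matrix (Fin k) (Fin l) (LO p ϖ R)) :
    ((unitϖ p ϖ R ^ d) • X).map (LO.map p ϖ f) = (unitϖ p ϖ R' ^ d) • X.map (LO.map p ϖ f) := by
  ext i j
  simp only [Matrix.map_apply, Matrix.smul_apply, Units.smul_def, smul_eq_mul, map_mul,
    LO.map_unitϖ_zpow]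

theorem pullback_scale (f : R →ₐ[ResidueField O] R') (hM : IsLattice M) :
    pullback f (scale M) = scale (pullback f M) := by
  obtain ⟨m, B, C, h⟩ := exists_frame hM
  have h1 := h.scale.pullback f
  rw [← zpow_one (unitϖ p ϖ R), ← zpow_neg, matrix_map_units_smul, matrix_map_units_smul,
    zpow_neg, zpow_one] at h1
  exact h1.eq_of_frame (h.pullback f).scale

theorem pullback_trivialLattice (f : R →ₐ[ResidueField O] R') :
    pullback f (trivialLattice p ϖ n R) = trivialLattice p ϖ n R' := by
  have h := (isFrame_trivialLattice p ϖ n R).pullback f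
  rw [Matrix.map_one _ (map_zero _) (map_one _)] at h
  exact h.eq_of_frame (isFrame_trivialLattice p ϖ n R')

theorem twist_trivialLattice : twist (trivialLattice p ϖ n R) = trivialLattice p ϖ n R :=
  pullback_trivialLattice _

theorem dual_trivialLattice : dual (trivialLattice p ϖ n R) = trivialLattice p ϖ n R := by
  ext y
  rw [(isFrame_trivialLattice p ϖ n R).dual.mem_iff, mem_trivialLattice]
  have : ∀ a, (Matrix.of fun a j => (1 : Matrix (Fin n) (Fin n) (LO p ϖ R)) (Fin.rev j) a).mulVec y a =
      y (Fin.rev a) := fun a => by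
    rw [mulVec_apply_eq_sum, Finset.sum_eq_single (Fin.rev a)]
    · rw [Matrix.of_apply, Fin.rev_rev, Matrix.one_apply_eq, one_mul]
    · intro b _ hb
      rw [Matrix.of_apply, Matrix.one_apply_ne, zero_mul]
      rintro rfl
      simp at hb
    · simp
  simp only [this]
  exact ⟨fun h j => by simpa using h (Fin.rev j), fun h j => h _⟩

theorem dual_scale (M : Submodule (WO p O R) (Amb p ϖ n R)) : dual (scale M) = unscale (dual M) := by
  ext y
  rw [mem_unscale]
  constructor
  · intro h x hx
    have := h (unitϖ p ϖ R • x) (mem_scale.mpr (by rwa [inv_smul_smul]))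
    convert this using 1
    refine Finset.sum_congr rfl fun j _ => ?_
    simp only [Pi.smul_apply, Units.smul_def, smul_eq_mul]
    ring
  · intro h x hx
    have := h _ (mem_scale.mp hx)
    convert this using 1
    refine Finset.sum_congr rfl fun j _ => ?_
    simp only [Pi.smul_apply, Units.smul_def, smul_eq_mul]
    rw [mul_mul_mul_comm, Units.inv_mul, one_mul]

theorem isLattice_of_frame [CharP R p] [PerfectRing R p] (hϖ : Irreducible ϖ)
    {B : Matrix (Fin n) (Fin m) (LO p ϖ R)} {C : Matrix (Fin m) (Fin n) (LO p ϖ R)}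
    (h : IsFrame B C M) : IsLattice M :=
  ⟨h.module_finite, h.module_projective (LO.algebraMap_injective hϖ), h.span_eq_top⟩

section Perfect

variable [CharP R p] [PerfectRing R p] [CharP R' p] [PerfectRing R' p] (hϖ : Irreducible ϖ)

include hϖ

theorem IsLattice.pullback (hM : IsLattice M) (f : R →ₐ[ResidueField O] R') :
    IsLattice (pullback f M) := by
  obtain ⟨m, B, C, h⟩ := exists_frame hM
  exact isLattice_of_frame hϖ (h.pullback f)

theorem IsLattice.twist (hM : IsLattice M) : IsLattice (twist M) := hM.pullback hϖ _

theorem IsLattice.dual (hM : IsLattice M) : IsLattice (dual M) := by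
  obtain ⟨m, B, C, h⟩ := exists_frame hM
  exact isLattice_of_frame hϖ h.dual

theorem IsLattice.scale (hM : IsLattice M) : IsLattice (scale M) := by
  obtain ⟨m, B, C, h⟩ := exists_frame hM
  exact isLattice_of_frame hϖ h.scale

theorem IsLattice.unscale (hM : IsLattice M) : IsLattice (unscale M) := by
  obtain ⟨m, B, C, h⟩ := exists_frame hM
  exact isLattice_of_frame hϖ h.unscale

theorem isLattice_trivialLattice : IsLattice (trivialLattice p ϖ n R) :=
  isLattice_of_frame hϖ (isFrame_trivialLattice p ϖ n R)

/-- Inclusion of lattices can be tested at geometric points. -/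
theorem le_of_forall_geometric (hM : IsLattice M) (hN : IsLattice N)
    (h : ∀ (K : Type u) [Field K] [IsAlgClosed K] [Algebra (ResidueField O) K]
      (f : R →ₐ[ResidueField O] K), Unitary.pullback f M ≤ Unitary.pullback f N) : M ≤ N := by
  obtain ⟨m, B, C, hB⟩ := exists_frame hM
  obtain ⟨m', B', C', hB'⟩ := exists_frame hN
  rw [hB.le_iff hB']
  intro a b
  refine LO.mem_range_of_forall_geometric hϖ _ fun K _ _ _ f => ?_
  have := ((hB.pullback f).le_iff (hB'.pullback f)).mp (h K f) a b
  rwa [← Matrix.map_mul] at this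

end Perfect

end LatticeOperations

/-! ### Relative positions -/

section RelativePosition

variable {p : ℕ} [Fact p.Prime] {O : Type v} [CommRing O] [IsDomain O]
  [IsDiscreteValuationRing O] [IsAdicComplete (maximalIdeal O) O] [Finite (ResidueField O)]
  [CharP (ResidueField O) p] {ϖ : O} {n m : ℕ}
  {R R' : Type u} [CommRing R] [Algebra (ResidueField O) R]
  [CommRing R'] [Algebra (ResidueField O) R']
  {M N P : Submodule (WO p O R) (Amb p ϖ n R)} {μ : Fin n → ℤ}

variable (p ϖ R) in
/-- The diagonal matrix `ϖ^μ`. -/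
noncomputable def diagϖ (μ : Fin n → ℤ) : Matrix (Fin n) (Fin n) (LO p ϖ R) :=
  Matrix.diagonal fun j => ((unitϖ p ϖ R ^ μ j : (LO p ϖ R)ˣ) : LO p ϖ R)

theorem diagϖ_mul_neg (μ : Fin n → ℤ) : diagϖ p ϖ R μ * diagϖ p ϖ R (-μ) = 1 := by
  rw [diagϖ, diagϖ, Matrix.diagonal_mul_diagonal, ← Matrix.diagonal_one]
  congr 1
  ext j
  rw [Pi.neg_apply, zpow_neg, Units.mul_inv]

theorem mul_diagϖ_mul {g h : Matrix (Fin n) (Fin n) (LO p ϖ R)} (hgh : g * h = 1)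
    (μ : Fin n → ℤ) : (g * diagϖ p ϖ R μ) * (diagϖ p ϖ R (-μ) * h) = 1 := by
  rw [Matrix.mul_assoc, ← Matrix.mul_assoc (diagϖ p ϖ R μ), diagϖ_mul_neg, Matrix.one_mul, hgh]

/-- The basis of `L ^ n` formed by the columns of an invertible matrix. -/
noncomputable def basisOfMulEqOne {L : Type*} [CommRing L] {g h : Matrix (Fin n) (Fin n) L}
    (hgh : g * h = 1) : Module.Basis (Fin n) L (Fin n → L) :=
  (Pi.basisFun L (Fin n)).map (Matrix.toLin'OfInv (mul_eq_one_comm.mp hgh) hgh)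

theorem basisOfMulEqOne_apply {L : Type*} [CommRing L] {g h : Matrix (Fin n) (Fin n) L}
    (hgh : g * h = 1) (a : Fin n) : basisOfMulEqOne hgh a = fun j => g j a := by
  rw [basisOfMulEqOne, Module.Basis.map_apply, Pi.basisFun_apply]
  refine (Matrix.mulVec_single_one g a).trans ?_
  rfl

theorem hasRelPos_iff : HasRelPos M N μ ↔ ∃ g h : Matrix (Fin n) (Fin n) (LO p ϖ R),
    IsFrame g h N ∧ IsFrame (g * diagϖ p ϖ R μ) (diagϖ p ϖ R (-μ) * h) M := by
  have hcol : ∀ (g : Matrix (Fin n) (Fin n) (LO p ϖ R)) a j, (g * diagϖ p ϖ R μ) j a =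
      ((unitϖ p ϖ R ^ μ a : (LO p ϖ R)ˣ) : LO p ϖ R) * g j a := fun g a j => by
    rw [diagϖ, Matrix.mul_diagonal, mul_comm]
  constructor
  · rintro ⟨b, rfl, rfl⟩
    let g : Matrix (Fin n) (Fin n) (LO p ϖ R) := (Pi.basisFun (LO p ϖ R) (Fin n)).toMatrix b
    let h : Matrix (Fin n) (Fin n) (LO p ϖ R) := b.toMatrix (Pi.basisFun (LO p ϖ R) (Fin n))
    have hg : ∀ a j, g j a = b a j := fun a j => rfl
    have hgh : g * h = 1 := Module.Basis.toMatrix_mul_toMatrix_flip _ _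
    refine ⟨g, h, IsFrame.of_mul_eq_one hgh, ?_⟩
    convert IsFrame.of_mul_eq_one (A := WO p O R) (mul_diagϖ_mul hgh μ) using 4
    ext j
    rw [hcol, hg]
    rfl
  · rintro ⟨g, h, hN, hM⟩
    have hgh := hN.mul_eq_one
    refine ⟨basisOfMulEqOne hgh, ?_, ?_⟩
    · rw [hN.eq_span]
      congr 2
      ext a j
      rw [basisOfMulEqOne_apply]
    · rw [hM.eq_span]
      congr 2
      ext a j
      rw [hcol, Pi.smul_apply, basisOfMulEqOne_apply]
      rfl

theorem HasRelPos.neg (H : HasRelPos M N μ) : HasRelPos N M (-μ) := by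
  rw [hasRelPos_iff] at H ⊢
  obtain ⟨g, h, hN, hM⟩ := H
  refine ⟨_, _, hM, ?_⟩
  rw [neg_neg, Matrix.mul_assoc, diagϖ_mul_neg, Matrix.mul_one, ← Matrix.mul_assoc, diagϖ_mul_neg,
    Matrix.one_mul]
  exact hN

theorem HasRelPos.perm (H : HasRelPos M N μ) (σ : Equiv.Perm (Fin n)) :
    HasRelPos M N (μ ∘ σ) := by
  obtain ⟨b, rfl, rfl⟩ := H
  refine ⟨b.reindex σ.symm, ?_, ?_⟩
  · rw [Module.Basis.range_reindex]
  · congr 1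
    rw [← σ.surjective.range_comp]
    congr 1
    ext a j
    simp

/-- Exchanging the lattices inverts `ϖ^μ`, and reversing the order of the basis makes the negative
of a dominant cocharacter dominant again. -/
theorem HasRelPos.symm (H : HasRelPos M N μ) : HasRelPos N M (dualCochar μ) :=
  H.neg.perm Fin.revPerm

/-- Dual bases scale inversely: if the basis of `M` is `ϖ^μ` times that of `N`, then the dual basis
for `N` is `ϖ^μ` times the one for `M`. So the two lattices change roles and `μ` stays. -/
theorem HasRelPos.dual (H : HasRelPos M N μ) : HasRelPos (dual N) (dual M) μ := by
  rw [hasRelPos_iff] at H ⊢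
  obtain ⟨g, h, hN, hM⟩ := H
  refine ⟨_, _, hM.dual, ?_⟩
  convert hN.dual using 1
  · ext j a
    simp only [diagϖ, Matrix.mul_diagonal, Matrix.diagonal_mul, Matrix.of_apply, Pi.neg_apply,
      zpow_neg]
    rw [mul_right_comm, Units.inv_mul, one_mul]
  · ext a j
    simp only [diagϖ, Matrix.mul_diagonal, Matrix.diagonal_mul, Matrix.of_apply, Pi.neg_apply,
      zpow_neg]
    rw [mul_left_comm, Units.inv_mul, mul_one]

/-! ### Boundedness -/

theorem dualCochar_dualCochar (μ : Fin n → ℤ) : dualCochar (dualCochar μ) = μ := by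
  ext j; simp [dualCochar]

theorem Antitone.dualCochar {l : Fin n → ℤ} (h : Antitone l) : Antitone (dualCochar l) :=
  fun _ _ hab => neg_le_neg (h (Fin.rev_le_rev.mpr hab))

theorem sum_dualCochar (l : Fin n → ℤ) : ∑ j, dualCochar l j = - ∑ j, l j := by
  simp only [dualCochar, Finset.sum_neg_distrib]
  exact congrArg Neg.neg (Equiv.sum_comp Fin.revPerm l)

/-- The first `m` entries of the dual cocharacter are the last `m` entries of `l` with the opposite
sign. The truncated `n - m` is harmless, as it is `0` for `m ≥ n`. -/
theorem sum_dualCochar_lt (l : Fin n → ℤ) (m : ℕ) :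
    ∑ j with j.val < m, dualCochar l j = (∑ j with j.val < n - m, l j) - ∑ j, l j := by
  have h1 : ∑ j with j.val < m, dualCochar l j = - ∑ j with ¬ j.val < n - m, l j := by
    simp only [dualCochar, Finset.sum_neg_distrib, Finset.sum_filter]
    rw [← Equiv.sum_comp Fin.revPerm]
    congr 1
    refine Finset.sum_congr rfl fun j _ => ?_
    simp only [Fin.revPerm_apply, Fin.rev_rev, Fin.val_rev]
    refine if_congr ?_ rfl rfl
    have := j.2
    omega
  rw [h1, ← Finset.sum_filter_add_sum_filter_not Finset.univ (fun j : Fin n => j.val < n - m) l]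
  ring

theorem Dominated.dualCochar {l μ : Fin n → ℤ} (h : Dominated l μ) :
    Dominated (dualCochar l) (dualCochar μ) := by
  refine ⟨fun m => ?_, by rw [sum_dualCochar, sum_dualCochar, h.2]⟩
  rw [sum_dualCochar_lt, sum_dualCochar_lt, h.2]
  exact sub_le_sub_right (h.1 _) _

theorem IsBounded.symm (H : IsBounded M N μ) : IsBounded N M (dualCochar μ) := fun K _ _ _ f => by
  obtain ⟨l, h1, h2, h3⟩ := H K f
  exact ⟨_, Antitone.dualCochar h1, h2.dualCochar, h3.symm⟩

theorem IsBounded.pullback (H : IsBounded M N μ) (f : R →ₐ[ResidueField O] R') :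
    IsBounded (pullback f M) (pullback f N) μ := fun K _ _ _ g => by
  rw [pullback_pullback, pullback_pullback]
  exact H K (g.comp f)

theorem IsBounded.dual (hM : IsLattice M) (hN : IsLattice N) (H : IsBounded M N μ) :
    IsBounded (dual N) (dual M) μ := fun K _ _ _ f => by
  obtain ⟨l, h1, h2, h3⟩ := H K f
  refine ⟨l, h1, h2, ?_⟩
  rw [pullback_dual f hM, pullback_dual f hN]
  exact h3.dual

/-- Minuscule cocharacters are minimal in the dominance order. The first partial sum bounds all
entries of `l` by `1`, and the last one together with the total bounds them below by `0`. -/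
theorem dominated_omega {l : Fin n → ℤ} {d : ℕ} (hl : Antitone l) (h : Dominated l (omega n d)) :
    l = omega n d := by
  rcases n with _ | n
  · exact Subsingleton.elim _ _
  have h0 : ∀ j, l j ≤ 1 := fun j => by
    refine (hl (Fin.zero_le j)).trans ?_
    have := h.1 1
    have h1 : (Finset.univ.filter fun j : Fin (n + 1) => j.val < 1) = {0} := by
      ext j
      simp only [Finset.mem_filter, Finset.mem_univ, true_and, Finset.mem_singleton, Fin.ext_iff,
        Fin.val_zero]
      omega
    rw [h1, Finset.sum_singleton, Finset.sum_singleton, omega] at this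
    refine this.trans ?_
    split_ifs <;> norm_num
  have h2 : ∀ j, 0 ≤ l j := fun j => by
    refine le_trans ?_ (hl (Fin.le_last j))
    have := h.1 n
    have h1 : (Finset.univ.filter fun j : Fin (n + 1) => ¬ j.val < n) = {Fin.last n} := by
      ext j
      simp only [Finset.mem_filter, Finset.mem_univ, true_and, Finset.mem_singleton, Fin.ext_iff,
        Fin.val_last]
      omega
    have h3 := h.2
    rw [← Finset.sum_filter_add_sum_filter_not Finset.univ (fun j : Fin (n + 1) => j.val < n) l,
      ← Finset.sum_filter_add_sum_filter_not Finset.univ (fun j : Fin (n + 1) => j.val < n)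
        (omega (n + 1) d), h1, Finset.sum_singleton, Finset.sum_singleton] at h3
    have h4 : 0 ≤ omega (n + 1) d (Fin.last n) := by
      rw [omega]; split_ifs <;> norm_num
    linarith
  -- If the first `d` entries summed to less, some later entry would be positive. As `l` is
  -- decreasing, the first `d` entries would then all be `1`, a contradiction.
  have hsum : ∑ j with j.val < d, l j = ∑ j with j.val < d, omega (n + 1) d j := by
    refine le_antisymm (h.1 d) ?_
    have h5 : ∑ j with j.val < d, omega (n + 1) d j = ∑ j, omega (n + 1) d j := by
      simp only [omega, Finset.sum_filter]
      exact Finset.sum_congr rfl fun j _ => by split_ifs <;> rfl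
    rw [h5, ← h.2]
    by_contra! hlt
    rw [← Finset.sum_filter_add_sum_filter_not Finset.univ (fun j : Fin (n + 1) => j.val < d) l] at hlt
    have hpos : 0 < ∑ j with ¬ j.val < d, l j := by linarith
    obtain ⟨j, hj, hj'⟩ : ∃ j : Fin (n + 1), d ≤ j.val ∧ 0 < l j := by
      by_contra! hc
      exact absurd hpos (not_lt.mpr (Finset.sum_nonpos fun j hj => hc j (by simpa using hj)))
    have h6 : ∑ j with j.val < d, l j = ∑ j with j.val < d, omega (n + 1) d j := by
      refine Finset.sum_congr rfl fun i hi => ?_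
      simp only [Finset.mem_filter, Finset.mem_univ, true_and] at hi
      rw [omega, if_pos hi]
      have h7 : l j ≤ l i := hl (Fin.le_def.mpr (by omega))
      have h8 : 0 < l j := hj'
      have := h0 i
      omega
    have h9 := h.2
    rw [← Finset.sum_filter_add_sum_filter_not Finset.univ (fun j : Fin (n + 1) => j.val < d) l,
      h6, h5] at h9
    linarith
  have hzero : ∀ j : Fin (n + 1), ¬ j.val < d → l j = 0 := by
    have h5 : ∑ j with j.val < d, omega (n + 1) d j = ∑ j, omega (n + 1) d j := by
      simp only [omega, Finset.sum_filter]
      exact Finset.sum_congr rfl fun j _ => by split_ifs <;> rfl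
    have h9 := h.2
    rw [← Finset.sum_filter_add_sum_filter_not Finset.univ (fun j : Fin (n + 1) => j.val < d) l,
      hsum, h5] at h9
    have h10 : ∑ j with ¬ j.val < d, l j = 0 := by linarith
    intro j hj
    exact (Finset.sum_eq_zero_iff_of_nonneg fun i _ => h2 i).mp h10 j (by simpa using hj)
  have hone : ∀ j : Fin (n + 1), j.val < d → l j = 1 := by
    intro j hj
    have h11 : ∑ j with j.val < d, (omega (n + 1) d j - l j) = 0 := by
      rw [Finset.sum_sub_distrib, hsum, sub_self]
    have := (Finset.sum_eq_zero_iff_of_nonneg fun i hi => by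
      simp only [Finset.mem_filter, Finset.mem_univ, true_and] at hi
      rw [omega, if_pos hi]
      have := h0 i
      omega).mp h11 j (by simpa using hj)
    rw [omega, if_pos hj] at this
    omega
  ext j
  rw [omega]
  split_ifs with hj
  · exact hone j hj
  · exact hzero j hj

theorem antitone_omega (n d : ℕ) : Antitone (omega n d) := fun i j hij => by
  have := Fin.le_def.mp hij
  rw [omega, omega]
  split_ifs <;> omega

theorem Dominated.refl (μ : Fin n → ℤ) : Dominated μ μ := ⟨fun _ => le_rfl, rfl⟩

theorem isBounded_omega_iff {d : ℕ} : IsBounded M N (omega n d) ↔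
    ∀ (K : Type u) [Field K] [IsAlgClosed K] [Algebra (ResidueField O) K]
      (f : R →ₐ[ResidueField O] K), HasRelPos (pullback f M) (pullback f N) (omega n d) := by
  constructor
  · intro H K _ _ _ f
    obtain ⟨l, h1, h2, h3⟩ := H K f
    rwa [dominated_omega h1 h2] at h3
  · intro H K _ _ _ f
    exact ⟨_, antitone_omega n d, Dominated.refl _, H K f⟩

theorem isBounded_dualCochar_iff : IsBounded M N (dualCochar μ) ↔ IsBounded N M μ :=
  ⟨fun h => by simpa only [dualCochar_dualCochar] using h.symm, IsBounded.symm⟩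

theorem dualCochar_nuMinus (n i : ℕ) : dualCochar (nuMinus n i) = omega n i := by
  ext j
  have := j.2
  rw [dualCochar, nuMinus, omega, Fin.val_rev]
  by_cases h : j.val < i
  · rw [if_pos (by omega), if_pos h]; rfl
  · rw [if_neg (by omega), if_neg h]; rfl

theorem sum_omega {d : ℕ} (hd : d ≤ n) : ∑ j, omega n d j = d := by
  simp only [omega]
  rw [Finset.sum_boole]
  have : (Finset.univ.filter fun j : Fin n => j.val < d).card = d := by
    rw [Fin.card_filter_val_lt]; omega
  rw [this]

/-! ### The index of lattices -/

/-- `M` has index `d` in `N`: the determinant of a matrix which maps a basis of `N` to a basis of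
`M` is `ϖ^d` up to a unit. -/
def HasIndex (M N : Submodule (WO p O R) (Amb p ϖ n R)) (d : ℤ) : Prop :=
  ∃ g h g' h' : Matrix (Fin n) (Fin n) (LO p ϖ R), IsFrame g h N ∧ IsFrame g' h' M ∧
    ∃ u : (WO p O R)ˣ, (h * g').det = algebraMap _ _ (u : WO p O R) *
      ((unitϖ p ϖ R ^ d : (LO p ϖ R)ˣ) : LO p ϖ R)

theorem HasRelPos.hasIndex (H : HasRelPos M N μ) : HasIndex M N (∑ j, μ j) := by
  obtain ⟨g, h, hN, hM⟩ := hasRelPos_iff.mp H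
  refine ⟨g, h, _, _, hN, hM, 1, ?_⟩
  rw [← Matrix.mul_assoc, mul_eq_one_comm.mp hN.mul_eq_one, Matrix.one_mul, diagϖ,
    Matrix.det_diagonal, Units.val_one, map_one, one_mul]
  have : ∀ s : Finset (Fin n), ∏ j ∈ s, ((unitϖ p ϖ R ^ μ j : (LO p ϖ R)ˣ) : LO p ϖ R) =
      ((unitϖ p ϖ R ^ (∑ j ∈ s, μ j) : (LO p ϖ R)ˣ) : LO p ϖ R) := fun s => by
    induction s using Finset.induction_on with
    | empty => simp
    | insert a s ha ih => rw [Finset.prod_insert ha, Finset.sum_insert ha, zpow_add, Units.val_mul, ih]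
  exact this _

theorem HasIndex.symm {d : ℤ} (H : HasIndex M N d) : HasIndex N M (-d) := by
  obtain ⟨g, h, g', h', hN, hM, w, hu⟩ := H
  refine ⟨g', h', g, h, hM, hN, w⁻¹, ?_⟩
  have h1 : (h * g') * (h' * g) = 1 := by
    rw [Matrix.mul_assoc, ← Matrix.mul_assoc g', hM.mul_eq_one, Matrix.one_mul,
      mul_eq_one_comm.mp hN.mul_eq_one]
  have h2 := congrArg Matrix.det h1
  rw [Matrix.det_mul, Matrix.det_one, hu] at h2
  have h3 : (algebraMap (WO p O R) (LO p ϖ R) ((w⁻¹ : (WO p O R)ˣ) : WO p O R) *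
      ((unitϖ p ϖ R ^ (-d) : (LO p ϖ R)ˣ) : LO p ϖ R)) *
      (algebraMap (WO p O R) (LO p ϖ R) (w : WO p O R) *
      ((unitϖ p ϖ R ^ d : (LO p ϖ R)ˣ) : LO p ϖ R)) = 1 := by
    rw [mul_mul_mul_comm, ← map_mul, Units.inv_mul, map_one, one_mul, zpow_neg, Units.inv_mul]
  exact (left_inv_eq_right_inv h3 h2).symm

section Perfect

variable [CharP R p] [PerfectRing R p]

theorem exists_map_eq {k l : ℕ} {X : Matrix (Fin k) (Fin l) (LO p ϖ R)}
    (h : ∀ a b, X a b ∈ (algebraMap (WO p O R) (LO p ϖ R)).range) :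
    ∃ Y : Matrix (Fin k) (Fin l) (WO p O R), Y.map (algebraMap (WO p O R) (LO p ϖ R)) = X := by
  choose Y hY using h
  exact ⟨Matrix.of Y, Matrix.ext hY⟩

/-- The transition matrices between two bases of one lattice are integral in both directions. This
makes the index independent of the bases. -/
theorem IsFrame.det_mul (hϖ : Irreducible ϖ) {g h g' h' : Matrix (Fin n) (Fin n) (LO p ϖ R)}
    (H : IsFrame g h M) (H' : IsFrame g' h' M) :
    ∃ u : (WO p O R)ˣ, (h * g').det = algebraMap _ _ (u : WO p O R) := by
  obtain ⟨X, hX⟩ := exists_map_eq ((H'.le_iff H).mp le_rfl)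
  obtain ⟨Y, hY⟩ := exists_map_eq ((H.le_iff H').mp le_rfl)
  have h1 : X.det * Y.det = 1 := by
    apply LO.algebraMap_injective (ϖ := ϖ) hϖ
    rw [map_mul, RingHom.map_det, RingHom.map_det, RingHom.mapMatrix_apply,
      RingHom.mapMatrix_apply, hX, hY, ← Matrix.det_mul, Matrix.mul_assoc,
      ← Matrix.mul_assoc g', H'.mul_eq_one, Matrix.one_mul, mul_eq_one_comm.mp H.mul_eq_one,
      Matrix.det_one, map_one]
  refine ⟨Units.mkOfMulEqOne _ _ h1, ?_⟩
  rw [Units.val_mkOfMulEqOne, RingHom.map_det, RingHom.mapMatrix_apply, hX]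

theorem HasIndex.trans (hϖ : Irreducible ϖ) {d e : ℤ} (H : HasIndex M N d) (H' : HasIndex N P e) :
    HasIndex M P (d + e) := by
  obtain ⟨g, h, g', h', hN, hM, w, hw⟩ := H
  obtain ⟨k, l, k', l', hP, hN', w', hw'⟩ := H'
  obtain ⟨u, hu⟩ := hN'.det_mul hϖ hN
  refine ⟨k, l, g', h', hP, hM, w * w' * u, ?_⟩
  have : l * g' = (l * k') * ((l' * g) * (h * g')) := by
    rw [Matrix.mul_assoc, Matrix.mul_assoc l', ← Matrix.mul_assoc g, hN.mul_eq_one, Matrix.one_mul,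
      ← Matrix.mul_assoc k', hN'.mul_eq_one, Matrix.one_mul]
  rw [this, Matrix.det_mul, Matrix.det_mul (l' * g), hw, hw', hu, zpow_add, Units.val_mul, Units.val_mul,
    Units.val_mul, map_mul, map_mul]
  ring

/-- The determinant of an integral matrix is integral. If it were a unit times a negative power of
`ϖ`, a unit of `W_O(R)` would be divisible by `ϖ` and reduce to zero in `R`. -/
theorem HasIndex.nonneg [Nontrivial R] (hϖ : Irreducible ϖ) {d : ℤ} (H : HasIndex M N d)
    (hle : M ≤ N) : 0 ≤ d := by
  obtain ⟨g, h, g', h', hN, hM, w, hw⟩ := H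
  obtain ⟨X, hX⟩ := exists_map_eq ((hM.le_iff hN).mp hle)
  by_contra! hd
  obtain ⟨k, hk⟩ : ∃ k : ℕ, d = -(k + 1 : ℕ) := ⟨(-d - 1).toNat, by push_cast; omega⟩
  have h1 : X.det * algebraMap O (WO p O R) ϖ ^ (k + 1) = w := by
    apply LO.algebraMap_injective (ϖ := ϖ) hϖ
    rw [map_mul, RingHom.map_det, RingHom.mapMatrix_apply, hX, hw, hk, zpow_neg, zpow_natCast,
      map_pow, mul_assoc]
    have : algebraMap (WO p O R) (LO p ϖ R) (algebraMap O (WO p O R) ϖ) =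
      ((unitϖ p ϖ R : (LO p ϖ R)ˣ) : LO p ϖ R) := rfl
    rw [this, ← Units.val_pow_eq_pow_val, Units.inv_mul, mul_one]
  have h2 : IsUnit (WO.res p O R (X.det * algebraMap O (WO p O R) ϖ ^ (k + 1))) := by
    rw [h1]; exact w.isUnit.map _
  rw [map_mul, map_pow, WO.res_uniformizer hϖ, pow_succ, mul_zero, mul_zero] at h2
  exact not_isUnit_zero h2

/-- Going from `M` to `N` and back, `M` has index `d - e` and also `e - d` in itself, and neither
can be negative. -/
theorem HasIndex.unique [Nontrivial R] (hϖ : Irreducible ϖ) {d e : ℤ} (H : HasIndex M N d)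
    (H' : HasIndex M N e) : d = e := by
  have h1 := (H.trans hϖ H'.symm).nonneg hϖ le_rfl
  have h2 := (H'.trans hϖ H.symm).nonneg hϖ le_rfl
  omega

end Perfect

end RelativePosition

/-! ### The Cartan decomposition over a perfect field -/

section Cartan

variable {p : ℕ} [Fact p.Prime] {O : Type v} [CommRing O] [IsDomain O]
  [IsDiscreteValuationRing O] [IsAdicComplete (maximalIdeal O) O] [Finite (ResidueField O)]
  [CharP (ResidueField O) p] {ϖ : O} {n : ℕ}
  {K : Type u} [Field K] [Algebra (ResidueField O) K] [CharP K p] [PerfectRing K p]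
  {M N : Submodule (WO p O K) (Amb p ϖ n K)}

/-- By separatedness there is a largest power of `ϖ` dividing `a`. The cofactor has nonzero residue
in the field `K`, so it is a unit. Hence `W_O(K)` is a discrete valuation ring. -/
theorem WO.exists_eq_pow_mul_unit (hϖ : Irreducible ϖ) {a : WO p O K} (ha : a ≠ 0) :
    ∃ (k : ℕ) (u : (WO p O K)ˣ), a = algebraMap O (WO p O K) ϖ ^ k * u := by
  classical
  have hex : ∃ k, ¬ algebraMap O (WO p O K) ϖ ^ k ∣ a := by
    by_contra! h
    exact ha (WO.eq_zero_of_forall_pow_dvd hϖ h)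
  obtain ⟨k, hk⟩ : ∃ k, Nat.find hex = k + 1 := Nat.exists_eq_succ_of_ne_zero fun h0 =>
    Nat.find_spec hex (by rw [h0, pow_zero]; exact one_dvd a)
  obtain ⟨b, rfl⟩ : algebraMap O (WO p O K) ϖ ^ k ∣ a :=
    not_not.mp (Nat.find_min hex (by omega : k < Nat.find hex))
  have hb : WO.res p O K b ≠ 0 := fun h => by
    obtain ⟨c, rfl⟩ := (WO.res_eq_zero_iff hϖ b).mp h
    refine Nat.find_spec hex ?_
    rw [hk, pow_succ]
    exact mul_dvd_mul_left _ (dvd_mul_right _ _)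
  exact ⟨k, (WO.isUnit_of_isUnit_res hϖ (isUnit_iff_ne_zero.mpr hb)).unit, rfl⟩

theorem WO.nontrivial : Nontrivial (WO p O K) :=
  (WO.res p O K).domain_nontrivial

theorem WO.pow_mul_eq_zero (hϖ : Irreducible ϖ) {a : WO p O K} (k : ℕ)
    (h : algebraMap O (WO p O K) ϖ ^ k * a = 0) : a = 0 := by
  induction k with
  | zero => simpa using h
  | succ k ih =>
    rw [pow_succ', mul_assoc] at h
    exact ih (WO.eq_zero_of_uniformizer_mul hϖ _ h)

theorem WO.isDomain (hϖ : Irreducible ϖ) : IsDomain (WO p O K) := by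
  have := WO.nontrivial (p := p) (O := O) (K := K)
  have : NoZeroDivisors (WO p O K) := ⟨fun {a b} hab => by
    by_contra! h
    obtain ⟨k, w, rfl⟩ := WO.exists_eq_pow_mul_unit hϖ h.1
    rw [mul_assoc] at hab
    have := WO.pow_mul_eq_zero hϖ k hab
    exact h.2 ((Units.mul_right_eq_zero w).mp this)⟩
  exact NoZeroDivisors.to_isDomain _

theorem WO.isPrincipalIdealRing (hϖ : Irreducible ϖ) : IsPrincipalIdealRing (WO p O K) := by
  have := WO.isDomain (p := p) (K := K) hϖ
  have : IsDiscreteValuationRing (WO p O K) := by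
    refine IsDiscreteValuationRing.ofHasUnitMulPowIrreducibleFactorization
      ⟨algebraMap O (WO p O K) ϖ, ⟨fun h => ?_, fun {a b} hab => ?_⟩, fun {a} ha => ?_⟩
    · have := h.map (WO.res p O K)
      rw [WO.res_uniformizer hϖ] at this
      exact not_isUnit_zero this
    · have h0 : WO.res p O K a * WO.res p O K b = 0 := by
        rw [← map_mul, ← hab, WO.res_uniformizer hϖ]
      have hne : algebraMap O (WO p O K) ϖ ≠ 0 := fun h => one_ne_zero
        (WO.eq_zero_of_uniformizer_mul hϖ (1 : WO p O K) (by rw [h, zero_mul]))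
      have key : ∀ x y : WO p O K, algebraMap O (WO p O K) ϖ = x * y → WO.res p O K x = 0 →
          IsUnit y := fun x y hxy hx => by
        obtain ⟨c, rfl⟩ := (WO.res_eq_zero_iff hϖ x).mp hx
        have : algebraMap O (WO p O K) ϖ * (c * y) = algebraMap O (WO p O K) ϖ * 1 := by
          rw [← mul_assoc, ← hxy, mul_one]
        exact IsUnit.of_mul_eq_one_right c (mul_left_cancel₀ hne this)
      rcases mul_eq_zero.mp h0 with h1 | h1
      · exact Or.inr (key a b hab h1)
      · exact Or.inl (key b a (by rw [hab, mul_comm]) h1)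
    · obtain ⟨k, w, h⟩ := WO.exists_eq_pow_mul_unit hϖ ha
      exact ⟨k, w, h.symm⟩
  infer_instance

theorem IsLattice.isTorsionFree (hϖ : Irreducible ϖ) [IsDomain (WO p O K)] :
    Module.IsTorsionFree (WO p O K) M := by
  refine Module.IsTorsionFree.mk fun a ha x y hxy => ?_
  obtain ⟨k, w, rfl⟩ := WO.exists_eq_pow_mul_unit hϖ ha.ne_zero
  ext j
  have h1 := congrFun (congrArg Subtype.val hxy) j
  simp only [Submodule.coe_smul, Pi.smul_apply] at h1
  rw [Algebra.smul_def, Algebra.smul_def] at h1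
  refine IsUnit.mul_left_cancel ?_ h1
  rw [map_mul, map_pow]
  exact ((unitϖ p ϖ K).isUnit.pow k).mul (w.isUnit.map _)

theorem LO.nontrivial (hϖ : Irreducible ϖ) : Nontrivial (LO p ϖ K) :=
  have := WO.nontrivial (p := p) (O := O) (K := K)
  (LO.algebraMap_injective hϖ).nontrivial

/-- For a basis the coordinate map is a two-sided inverse, so `C * B = 1` holds besides `B * C = 1`,
and invertible matrices over a nonzero commutative ring are square. -/
theorem IsLattice.exists_square_frame (hϖ : Irreducible ϖ) (hM : IsLattice M) {r : ℕ}
    (b : Module.Basis (Fin r) (WO p O K) M) :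
    ∃ (B : Matrix (Fin n) (Fin r) (LO p ϖ K)) (C : Matrix (Fin r) (Fin n) (LO p ϖ K)),
      IsFrame B C M ∧ r = n ∧ ∀ a j, B j a = (b a).1 j := by
  obtain ⟨B, C, h, hCB, hB⟩ := exists_isFrame (algebraMap O (WO p O K) ϖ) hM.span_eq_top
    b.equivFun.symm.toLinearMap b.equivFun.toLinearMap fun x => b.equivFun.symm_apply_apply x
  refine ⟨B, C, h, ?_, fun a j => ?_⟩
  · have := LO.nontrivial (p := p) (K := K) hϖ
    have hCB' : C * B = 1 := by
      ext a c
      rw [hCB]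
      simp only [LinearEquiv.coe_coe, LinearEquiv.apply_symm_apply]
      rw [Pi.single_apply, Matrix.one_apply]
      split_ifs <;> simp
    have := (Matrix.toLin'OfInv hCB' h.mul_eq_one).finrank_eq
    simpa using this
  · rw [hB]
    simp

theorem IsLattice.free (hϖ : Irreducible ϖ) (hM : IsLattice M) : Module.Free (WO p O K) M := by
  have := WO.isDomain (p := p) (K := K) hϖ
  have := WO.isPrincipalIdealRing (p := p) (K := K) hϖ
  have := hM.finite
  have := IsLattice.isTorsionFree (M := M) hϖ
  exact Module.free_of_finite_type_torsion_free'

theorem IsLattice.finrank_eq (hϖ : Irreducible ϖ) (hM : IsLattice M) :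
    Module.finrank (WO p O K) M = n := by
  have := WO.nontrivial (p := p) (O := O) (K := K)
  have := hM.finite
  have := hM.free hϖ
  obtain ⟨_, _, _, h, -⟩ := hM.exists_square_frame hϖ (Module.finBasis (WO p O K) M)
  exact h

theorem hasRelPos_of_frame {μ : Fin n → ℤ} {g h : Matrix (Fin n) (Fin n) (LO p ϖ K)}
    (hN : IsFrame g h N) (hM : ∀ x, x ∈ M ↔ ∀ j, ((unitϖ p ϖ K ^ (-μ j) : (LO p ϖ K)ˣ) : LO p ϖ K) *
      h.mulVec x j ∈ (algebraMap (WO p O K) (LO p ϖ K)).range) : HasRelPos M N μ := by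
  rw [hasRelPos_iff]
  have h1 := mul_diagϖ_mul hN.mul_eq_one μ
  refine ⟨g, h, hN, h1, fun a b => ?_, fun x => ?_⟩
  · rw [mul_eq_one_comm.mp h1, Matrix.one_apply]
    split_ifs
    · exact Subring.one_mem _
    · exact Subring.zero_mem _
  · rw [hM]
    refine forall_congr' fun j => ?_
    rw [← Matrix.mulVec_mulVec, diagϖ, Matrix.mulVec_diagonal]
    rfl

theorem mem_iterate_scale (k : ℕ) {x : Amb p ϖ n K} :
    x ∈ scale^[k] M ↔ (unitϖ p ϖ K ^ k)⁻¹ • x ∈ M := by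
  induction k generalizing x with
  | zero => simp
  | succ k ih =>
    rw [Function.iterate_succ_apply', mem_scale, ih, smul_smul, pow_succ', mul_inv_rev]

theorem isLattice_iterate_scale (hϖ : Irreducible ϖ) (hM : IsLattice M) (k : ℕ) :
    IsLattice (scale^[k] M) := by
  induction k with
  | zero => exact hM
  | succ k ih => rw [Function.iterate_succ_apply']; exact ih.scale hϖ

theorem exists_iterate_scale_le (hM : IsLattice M) (hN : IsLattice N) :
    ∃ k, scale^[k] M ≤ N := by
  obtain ⟨m, B, C, h⟩ := exists_frame hM
  obtain ⟨k, hk⟩ := exists_pow_smul_mem_forall (algebraMap O (WO p O K) ϖ) hN.span_eq_top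
    fun a j => B j a
  refine ⟨k, fun x hx => ?_⟩
  rw [mem_iterate_scale] at hx
  have key : ∀ y ∈ M, algebraMap O (WO p O K) ϖ ^ k • y ∈ N := fun y hy => by
    rw [h.eq_span] at hy
    induction hy using Submodule.span_induction with
    | mem y hy => obtain ⟨a, rfl⟩ := hy; exact hk a
    | zero => rw [smul_zero]; exact N.zero_mem
    | add y z _ _ hy hz => rw [smul_add]; exact N.add_mem hy hz
    | smul c y _ hy => rw [smul_comm]; exact N.smul_mem _ hy
  have h1 := key _ hx
  have h2 : ∀ y : Amb p ϖ n K, algebraMap O (WO p O K) ϖ ^ k • y = unitϖ p ϖ K ^ k • y := fun y => by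
    ext j
    rw [Pi.smul_apply, Pi.smul_apply, Algebra.smul_def, map_pow]
    rfl
  rwa [h2, smul_inv_smul] at h1

/-- The diagonal entries `a i` of a Smith normal form matter only through their valuations `e i`;
the unit factors `w i` are absorbed into the coordinates. -/
theorem mem_iff_of_smith (hk : M ≤ N) {g h : Matrix (Fin n) (Fin n) (LO p ϖ K)}
    (hgh : IsFrame g h N) {b : Module.Basis (Fin n) (WO p O K) N}
    (hg : ∀ j a, g j a = (b a).1 j) {c : Module.Basis (Fin n) (WO p O K) (M.submoduleOf N)}
    {a : Fin n → WO p O K} (hbc : ∀ i, (c i : N) = a i • b i) {e : Fin n → ℕ}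
    {w : Fin n → (WO p O K)ˣ} (hw : ∀ i, a i = algebraMap O (WO p O K) ϖ ^ e i * w i)
    (y : Amb p ϖ n K) :
    y ∈ M ↔ ∀ j, ((unitϖ p ϖ K ^ (-(e j : ℤ)) : (LO p ϖ K)ˣ) : LO p ϖ K) *
      h.mulVec y j ∈ (algebraMap (WO p O K) (LO p ϖ K)).range := by
  have haw : ∀ j, algebraMap (WO p O K) (LO p ϖ K) (a j) =
      ((unitϖ p ϖ K ^ e j : (LO p ϖ K)ˣ) : LO p ϖ K) * algebraMap _ _ (w j : WO p O K) :=
    fun j => by rw [hw, map_mul, map_pow, Units.val_pow_eq_pow_val]; rfl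
  have hcomb : ∀ z : Fin n → WO p O K, (∑ j, z j • (c j : N)).1 =
      g.mulVec fun j => algebraMap (WO p O K) (LO p ϖ K) (z j * a j) := fun z => by
    ext i
    simp only [Submodule.coe_sum, Finset.sum_apply, mulVec_apply_eq_sum, hg, hbc, smul_smul,
      Submodule.coe_smul, Pi.smul_apply]
    exact Finset.sum_congr rfl fun j _ => by rw [Algebra.smul_def, mul_comm]
  constructor
  · intro hy j
    have h1 := c.sum_repr ⟨⟨y, hk hy⟩, hy⟩
    have h2 := congrArg (fun z => (z.1 : N).1) h1
    simp only [Submodule.coe_sum, Submodule.coe_smul] at h2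
    have h3 := hcomb (c.repr ⟨⟨y, hk hy⟩, hy⟩)
    simp only [Submodule.coe_sum, Submodule.coe_smul] at h3
    rw [h2] at h3
    rw [h3, Matrix.mulVec_mulVec, mul_eq_one_comm.mp hgh.mul_eq_one, Matrix.one_mulVec]
    refine ⟨c.repr ⟨⟨y, hk hy⟩, hy⟩ j * (w j : WO p O K), ?_⟩
    rw [map_mul, map_mul, haw, mul_left_comm, ← mul_assoc (Units.val _), zpow_neg, zpow_natCast,
      Units.inv_mul, one_mul]
  · intro hy
    choose z hz using hy
    have h1 : y = (∑ j, (z j * ((w j)⁻¹ : (WO p O K)ˣ)) • (c j : N)).1 := by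
      rw [hcomb, ← hgh.mulVec_mulVec y]
      congr 1
      ext j
      rw [mul_assoc, map_mul, map_mul, haw, hz, mul_left_comm (algebraMap _ _ _), ← map_mul,
        Units.inv_mul, map_one, mul_one, mul_comm, ← mul_assoc, zpow_neg, zpow_natCast,
        Units.mul_inv, one_mul]
    have h2 : ∑ j, (z j * ((w j)⁻¹ : (WO p O K)ˣ)) • (c j : N) ∈ M.submoduleOf N :=
      Submodule.sum_mem _ fun j _ => Submodule.smul_mem _ _ (c j).2
    rw [h1]
    exact h2

/-- This is the Cartan decomposition, obtained from the Smith normal form of `ϖ^k M` inside `N` over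
the principal ideal ring `W_O(K)`. Sorting the basis makes the cocharacter dominant. -/
theorem exists_hasRelPos (hϖ : Irreducible ϖ) (hM : IsLattice M) (hN : IsLattice N) :
    ∃ l : Fin n → ℤ, Antitone l ∧ HasRelPos M N l := by
  suffices h : ∃ l : Fin n → ℤ, HasRelPos M N l by
    obtain ⟨l, hl⟩ := h
    refine ⟨_, fun i j hij => ?_, hl.perm (Tuple.sort (-l))⟩
    have := Tuple.monotone_sort (-l) hij
    simpa using this
  have := WO.isDomain (p := p) (K := K) hϖ
  have := WO.isPrincipalIdealRing (p := p) (K := K) hϖ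
  have := hN.finite
  have := hN.free hϖ
  obtain ⟨k, hk⟩ := exists_iterate_scale_le hM hN
  have hM' := isLattice_iterate_scale hϖ hM k
  have hr : Module.finrank (WO p O K) N = n := hN.finrank_eq hϖ
  have hr' : Module.finrank (WO p O K) ((scale^[k] M).submoduleOf N) =
      Module.finrank (WO p O K) N := by
    rw [(Submodule.submoduleOfEquivOfLe hk).finrank_eq, hM'.finrank_eq hϖ, hr]
  obtain ⟨b, a, c, hbc⟩ := Submodule.exists_smith_normal_form_of_rank_eq
    ((Module.finBasis (WO p O K) N).reindex (finCongr hr)) hr'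
  have ha : ∀ i, a i ≠ 0 := fun i h0 => by
    have h1 := hbc i
    rw [h0, zero_smul] at h1
    exact c.ne_zero i (Subtype.ext h1)
  choose e w hw using fun i => WO.exists_eq_pow_mul_unit hϖ (ha i)
  obtain ⟨g, h, hgh, -, hg⟩ := hN.exists_square_frame hϖ b
  -- The exponents `e` describe `ϖ^k M`; subtracting `k` returns to `M`.
  refine ⟨fun i => (e i : ℤ) - k, hasRelPos_of_frame hgh fun x => ?_⟩
  have key := mem_iff_of_smith hk hgh (fun j a => hg a j) hbc hw
  have h4 : x ∈ M ↔ unitϖ p ϖ K ^ k • x ∈ scale^[k] M := by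
    rw [mem_iterate_scale, inv_smul_smul]
  rw [h4, key]
  refine forall_congr' fun j => ?_
  have h5 : ((unitϖ p ϖ K ^ (-(e j : ℤ)) : (LO p ϖ K)ˣ) : LO p ϖ K) *
      h.mulVec (unitϖ p ϖ K ^ k • x) j =
      ((unitϖ p ϖ K ^ (-((e j : ℤ) - k)) : (LO p ϖ K)ˣ) : LO p ϖ K) * h.mulVec x j := by
    rw [Matrix.mulVec_smul, Pi.smul_apply, Units.smul_def, smul_eq_mul, ← mul_assoc,
      ← Units.val_mul, ← zpow_natCast, ← zpow_add]
    congr 4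
    ring
  rw [h5]

end Cartan

/-! ### Vector bundles over reduced rings -/

section VectorBundles

theorem IsVectorBundle.congr {S M M' : Type*} [CommRing S] [AddCommGroup M] [Module S M]
    [AddCommGroup M'] [Module S M'] (e : M ≃ₗ[S] M') {d : ℕ} (h : IsVectorBundle S M d) :
    IsVectorBundle S M' d where
  finite := have := h.finite; Module.Finite.equiv e
  projective := have := h.projective; Module.Projective.of_equiv e
  rank_eq x := by rw [← h.rank_eq x, Module.rankAtStalk_eq_of_equiv e]

theorem isVectorBundle_field_iff {K M : Type*} [Field K] [AddCommGroup M] [Module K M] {d : ℕ} :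
    IsVectorBundle K M d ↔ Module.Finite K M ∧ Module.finrank K M = d := by
  constructor
  · intro h
    have := h.finite
    have h1 := h.rank_eq (⊥ : PrimeSpectrum K)
    rw [Module.rankAtStalk_eq_finrank_of_free] at h1
    exact ⟨h.finite, h1⟩
  · rintro ⟨h, h1⟩
    refine ⟨h, inferInstance, fun x => ?_⟩
    rw [Module.rankAtStalk_eq_finrank_of_free]
    exact h1

theorem IsVectorBundle.finrank_baseChange {R : Type u} [CommRing R] {M : Type*} [AddCommGroup M]
    [Module R M] {d : ℕ} (h : IsVectorBundle R M d) (K : Type*) [Field K] [Algebra R K] :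
    Module.finrank K (K ⊗[R] M) = d := by
  have := h.finite
  have := h.projective
  have h1 := Module.rankAtStalk_baseChange (R := R) (M := M) (⊥ : PrimeSpectrum K)
  rw [h.rank_eq, Module.rankAtStalk_eq_finrank_of_free] at h1
  exact h1

/-- A finitely presented module over a reduced local ring is free if its fibre dimension is
constant. -/
theorem free_of_finrank_eq {R : Type u} [CommRing R] [IsLocalRing R] [IsReduced R] {M : Type*}
    [AddCommGroup M] [Module R M] [Module.Finite R M] {d : ℕ}
    (h : ∀ (K : Type u) [Field K] [Algebra R K], Module.finrank K (K ⊗[R] M) = d) :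
    Module.Free R M := by
  let b : Module.Basis (Fin d) (ResidueField R) (ResidueField R ⊗[R] M) :=
    Module.finBasisOfFinrankEq _ _ (h _)
  -- Lifts of a basis of the special fibre generate `M` by Nakayama, so only their linear
  -- independence remains.
  obtain ⟨x, hx⟩ := (TensorProduct.mk_surjective R M (ResidueField R)
    Ideal.Quotient.mk_surjective).comp_left b
  have hspan := IsLocalRing.span_eq_top_of_tmul_eq_basis x b (congrFun hx)
  refine .of_basis (.mk (v := x) ?_ hspan.ge)
  rw [Fintype.linearIndependent_iff]
  intro a ha i
  -- As `R` is reduced, a coefficient of a relation vanishes if it lies in every prime `q`. In the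
  -- fibre at `q` the `d` generators span a space of dimension `d`, so they are independent there.
  rw [← isNilpotent_iff_eq_zero, nilpotent_iff_mem_prime]
  intro q hq
  let K := q.ResidueField
  have hspan' : Submodule.span K (Set.range fun i => (1 : K) ⊗ₜ[R] x i) = ⊤ := by
    rw [eq_top_iff]
    have hmk : ∀ y : M, (1 : K) ⊗ₜ[R] y ∈ Submodule.span K (Set.range fun i => (1 : K) ⊗ₜ[R] x i) :=
      fun y => by
      have hy : y ∈ Submodule.span R (Set.range x) := hspan ▸ Submodule.mem_top
      induction hy using Submodule.span_induction with
      | mem y hy => obtain ⟨i, rfl⟩ := hy; exact Submodule.subset_span ⟨i, rfl⟩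
      | zero => rw [TensorProduct.tmul_zero]; exact Submodule.zero_mem _
      | add y z _ _ hy hz => rw [TensorProduct.tmul_add]; exact Submodule.add_mem _ hy hz
      | smul r y _ hy =>
        rw [TensorProduct.tmul_smul, ← algebraMap_smul K r]
        exact Submodule.smul_mem _ _ hy
    intro z _
    induction z using TensorProduct.induction_on with
    | zero => exact Submodule.zero_mem _
    | add y z hy hz => exact Submodule.add_mem _ (hy trivial) (hz trivial)
    | tmul c y =>
      rw [← mul_one c, ← smul_eq_mul, ← TensorProduct.smul_tmul']
      exact Submodule.smul_mem _ _ (hmk y)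
  have hli := linearIndependent_of_top_le_span_of_card_eq_finrank hspan'.ge
    (by rw [Fintype.card_fin, h K])
  rw [Fintype.linearIndependent_iff] at hli
  have := hli (fun i => algebraMap R K (a i)) (by
    simp only [algebraMap_smul, ← TensorProduct.tmul_smul, ← TensorProduct.tmul_sum, ha,
      TensorProduct.tmul_zero]) i
  rwa [Ideal.algebraMap_residueField_eq_zero] at this

/-- A finitely presented module over a reduced ring whose dimension is `d` at all geometric points
is a vector bundle of rank `d`. -/
theorem isVectorBundle_of_geometric (k : Type v) [Field k] {R : Type u} [CommRing R] [Algebra k R]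
    [IsReduced R] {M : Type u} [AddCommGroup M] [Module R M] [Module.FinitePresentation R M] {d : ℕ}
    (h : ∀ (K : Type u) [Field K] [IsAlgClosed K] [Algebra k K] [Algebra R K] [IsScalarTower k R K],
      Module.finrank K (K ⊗[R] M) = d) : IsVectorBundle R M d := by
  have h1 : ∀ (K : Type u) [Field K] [Algebra R K], Module.finrank K (K ⊗[R] M) = d := by
    intro K _ _
    let _ : Algebra k K := ((algebraMap R K).comp (algebraMap k R)).toAlgebra
    have : IsScalarTower k R K := .of_algebraMap_eq fun _ => rfl
    rw [← h (AlgebraicClosure K),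
      ← (AlgebraTensorModule.cancelBaseChange R K (AlgebraicClosure K) (AlgebraicClosure K) M).finrank_eq]
    exact Module.finrank_baseChange.symm
  -- A finitely presented module is projective if all its localizations are free. Localizations of
  -- `R` are reduced local rings, over which the fibre dimension is still `d`.
  have hproj : Module.Projective R M := by
    rw [← Module.freeLocus_eq_univ_iff, Set.eq_univ_iff_forall]
    intro q
    rw [Module.mem_freeLocus_iff_tensor q (Localization.AtPrime q.asIdeal)]
    refine free_of_finrank_eq (d := d) fun K _ _ => ?_
    let _ : Algebra R K := ((algebraMap (Localization.AtPrime q.asIdeal) K).comp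
      (algebraMap R _)).toAlgebra
    have : IsScalarTower R (Localization.AtPrime q.asIdeal) K := .of_algebraMap_eq fun _ => rfl
    rw [(AlgebraTensorModule.cancelBaseChange R (Localization.AtPrime q.asIdeal) K K M).finrank_eq,
      h1]
  refine ⟨inferInstance, hproj, fun q => ?_⟩
  rw [Module.rankAtStalk_eq, ← h1 q.asIdeal.ResidueField]

/-- The cokernel of a matrix commutes with base change. -/
noncomputable def cokerBaseChange {R S : Type*} [CommRing R] [CommRing S] [Algebra R S]
    {a b : Type*} [Fintype a] [Fintype b] [DecidableEq b] (X : Matrix b a R) :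
    (S ⊗[R] ((b → R) ⧸ LinearMap.range X.mulVecLin)) ≃ₗ[S]
      (b → S) ⧸ LinearMap.range (X.map (algebraMap R S)).mulVecLin := by
  classical
  have hker : ∀ v ∈ LinearMap.range X.mulVecLin, ((LinearMap.range
      (X.map (algebraMap R S)).mulVecLin).mkQ.restrictScalars R ∘ₗ
      (Algebra.linearMap R S).compLeft b) v = 0 := by
    rintro _ ⟨w, rfl⟩
    rw [LinearMap.comp_apply, LinearMap.restrictScalars_apply, Submodule.mkQ_apply,
      Submodule.Quotient.mk_eq_zero]
    refine ⟨fun j => algebraMap R S (w j), ?_⟩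
    ext j
    simp [Matrix.mulVec, dotProduct, map_sum]
  have hker' : LinearMap.range (X.map (algebraMap R S)).mulVecLin ≤ LinearMap.ker
      ((Pi.basisFun S b).constr S fun j => (1 : S) ⊗ₜ[R]
        (Submodule.Quotient.mk (Pi.single j 1) : (b → R) ⧸ LinearMap.range X.mulVecLin)) := by
    rintro _ ⟨w, rfl⟩
    rw [LinearMap.mem_ker, Module.Basis.constr_apply_fintype]
    simp only [Pi.basisFun_equivFun, LinearEquiv.refl_apply, Matrix.mulVecLin_apply, Matrix.mulVec,
      dotProduct, Matrix.map_apply, Finset.sum_smul]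
    rw [Finset.sum_comm]
    refine Finset.sum_eq_zero fun l _ => ?_
    have : ∀ j, (algebraMap R S (X j l) * w l) • ((1 : S) ⊗ₜ[R]
        (Submodule.Quotient.mk (Pi.single j 1) : (b → R) ⧸ LinearMap.range X.mulVecLin)) =
        w l ⊗ₜ (Submodule.Quotient.mk (X j l • Pi.single j 1)) := fun j => by
      rw [Submodule.Quotient.mk_smul, TensorProduct.tmul_smul, TensorProduct.smul_tmul',
        TensorProduct.smul_tmul', smul_eq_mul, mul_one, Algebra.smul_def]
    simp only [this]
    have h1 : (∑ j, (Submodule.Quotient.mk (X j l • Pi.single j 1) :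
        (b → R) ⧸ LinearMap.range X.mulVecLin)) =
        Submodule.mkQ _ (∑ j, X j l • Pi.single j 1) := (map_sum (Submodule.mkQ _) _ _).symm
    have h2 : Submodule.mkQ (LinearMap.range X.mulVecLin) (∑ j, X j l • Pi.single j 1) = 0 := by
      refine (Submodule.Quotient.mk_eq_zero _).mpr ⟨Pi.single l 1, ?_⟩
      rw [Matrix.mulVecLin_apply, Matrix.mulVec_single_one]
      exact pi_eq_sum_univ' _
    rw [← TensorProduct.tmul_sum, h1, h2, TensorProduct.tmul_zero]
  have hsingle : ∀ j, (Algebra.linearMap R S).compLeft b (Pi.single j 1) = Pi.single j 1 := fun j => by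
    ext i
    rw [LinearMap.compLeft_apply, Function.comp_apply, Algebra.linearMap_apply, Pi.single_apply,
      Pi.single_apply]
    split_ifs <;> simp
  refine LinearEquiv.ofLinearMap (LinearMap.liftBaseChange S (Submodule.liftQ _ _ hker))
    (Submodule.liftQ _ _ hker') ?_ ?_
  · refine Submodule.linearMap_qext _ ((Pi.basisFun S b).ext fun j => ?_)
    simp only [LinearMap.comp_apply, Submodule.mkQ_apply, Submodule.liftQ_apply]
    rw [Module.Basis.constr_basis, LinearMap.liftBaseChange_tmul, one_smul, Pi.basisFun_apply]
    exact congrArg Submodule.Quotient.mk (hsingle j)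
  · ext : 3
    refine (Pi.basisFun R b).ext fun j => ?_
    have h1 : (LinearMap.liftBaseChange S (Submodule.liftQ _ _ hker))
        (1 ⊗ₜ Submodule.Quotient.mk (Pi.single j 1)) =
        Submodule.Quotient.mk (Pi.basisFun S b j) := by
      rw [LinearMap.liftBaseChange_tmul, one_smul, Pi.basisFun_apply]
      exact congrArg Submodule.Quotient.mk (hsingle j)
    rw [Pi.basisFun_apply]
    refine (congrArg (Submodule.liftQ _ _ hker') h1).trans ?_
    rw [← Submodule.mkQ_apply]
    exact Module.Basis.constr_basis (Pi.basisFun S b) S _ j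

end VectorBundles

/-! ### Subquotients of lattices -/

section ResidueBundles

variable {p : ℕ} [Fact p.Prime] {O : Type v} [CommRing O] [IsDomain O]
  [IsDiscreteValuationRing O] [IsAdicComplete (maximalIdeal O) O] [Finite (ResidueField O)]
  [CharP (ResidueField O) p] {ϖ : O} {n : ℕ}
  {R R' : Type u} [CommRing R] [Algebra (ResidueField O) R] [CharP R p] [PerfectRing R p]
  [CommRing R'] [Algebra (ResidueField O) R'] [CharP R' p] [PerfectRing R' p]

/-! ### Modules over `W_O(R)` killed by the uniformizer -/

section Modules

variable {X X' : Type*} [AddCommGroup X] [Module (WO p O R) X] [AddCommGroup X']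
  [Module (WO p O R) X']

/-- The kernel of `W_O(R) → R` is generated by `ϖ`, so the action on `X` factors through `R`. The
resulting map `R ⊗ X → X` is the inverse. -/
theorem mk_one_bijective (hϖ : Irreducible ϖ)
    (hX : ∀ x : X, algebraMap O (WO p O R) ϖ • x = 0) :
    Function.Bijective (TensorProduct.mk (WO p O R) R X 1) := by
  constructor
  · have hsurj : LinearMap.range (Algebra.linearMap (WO p O R) R) = ⊤ :=
      LinearMap.range_eq_top.mpr WO.res_surjective
    have hker : LinearMap.ker (Algebra.linearMap (WO p O R) R) ≤
        LinearMap.ker (LinearMap.lsmul (WO p O R) X) := by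
      intro a ha
      obtain ⟨b, rfl⟩ := (WO.res_eq_zero_iff hϖ a).mp ha
      ext x
      rw [LinearMap.lsmul_apply, mul_comm, mul_smul, hX, smul_zero]
      rfl
    let ψ : R →ₗ[WO p O R] (X →ₗ[WO p O R] X) :=
      (Submodule.liftQ _ _ hker) ∘ₗ
        ((Algebra.linearMap (WO p O R) R).quotKerEquivOfSurjective
          (LinearMap.range_eq_top.mp hsurj)).symm.toLinearMap
    have hψ : ψ 1 = LinearMap.id := by
      have : ((Algebra.linearMap (WO p O R) R).quotKerEquivOfSurjective
          (LinearMap.range_eq_top.mp hsurj)).symm 1 = Submodule.Quotient.mk 1 := by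
        rw [LinearEquiv.symm_apply_eq]
        exact (map_one (WO.res p O R)).symm
      change Submodule.liftQ _ _ hker _ = _
      rw [LinearEquiv.coe_coe, this]
      ext x
      exact one_smul _ x
    refine Function.LeftInverse.injective (g := TensorProduct.lift ψ) fun x => ?_
    rw [TensorProduct.mk_apply, TensorProduct.lift.tmul, hψ, LinearMap.id_apply]
  · exact TensorProduct.mk_surjective _ _ _ WO.res_surjective

/-- A module `X` which is killed by `ϖ` is `R ⊗ X`. -/
noncomputable def residueEquiv (hϖ : Irreducible ϖ)
    (hX : ∀ x : X, algebraMap O (WO p O R) ϖ • x = 0) : X ≃ₗ[WO p O R] R ⊗[WO p O R] X :=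
  LinearEquiv.ofBijective _ (mk_one_bijective hϖ hX)

theorem IsResidueBundle.congr {d : ℕ} (h : IsResidueBundle p ϖ R X d)
    (e : X ≃ₗ[WO p O R] X') : IsResidueBundle p ϖ R X' d where
  smul_eq_zero x := by rw [← e.apply_symm_apply x, ← map_smul, h.smul_eq_zero, map_zero]
  bundle := h.bundle.congr (e.baseChange (WO p O R) R X X')

theorem isResidueBundle_congr {d : ℕ} (e : X ≃ₗ[WO p O R] X') :
    IsResidueBundle p ϖ R X d ↔ IsResidueBundle p ϖ R X' d :=
  ⟨fun h => h.congr e, fun h => h.congr e.symm⟩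

/-- The map `r ⊗ x ↦ r • e x` identifies `R ⊗ X` with `V`, so an `R`-structure that is already
visible may replace the extension of scalars. -/
theorem isResidueBundle_iff_of_equiv (hϖ : Irreducible ϖ) {V : Type*} [AddCommGroup V] [Module R V]
    [Module (WO p O R) V] [IsScalarTower (WO p O R) R V] (e : X ≃ₗ[WO p O R] V) {d : ℕ} :
    IsResidueBundle p ϖ R X d ↔ IsVectorBundle R V d := by
  have hX : ∀ x : X, algebraMap O (WO p O R) ϖ • x = 0 := fun x => by
    apply e.injective
    rw [map_smul, map_zero, ← algebraMap_smul R]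
    change WO.res p O R _ • _ = _
    rw [WO.res_uniformizer hϖ, zero_smul]
  let φ : R ⊗[WO p O R] X →ₗ[R] V := LinearMap.liftBaseChange R e.toLinearMap
  have hφ : Function.Bijective φ := by
    have h1 : ∀ x, φ (residueEquiv hϖ hX x) = e x := fun x => by
      change LinearMap.liftBaseChange R e.toLinearMap (1 ⊗ₜ x) = _
      rw [LinearMap.liftBaseChange_tmul, one_smul]
      rfl
    have h2 : ⇑φ = e ∘ (residueEquiv hϖ hX).symm := by
      ext y
      rw [Function.comp_apply, ← h1, LinearEquiv.apply_symm_apply]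
    rw [h2]
    exact e.bijective.comp (LinearEquiv.bijective _)
  let E := LinearEquiv.ofBijective φ hφ
  exact ⟨fun h => h.bundle.congr E, fun h => ⟨hX, h.congr E.symm⟩⟩

end Modules

variable {M N P : Submodule (WO p O R) (Amb p ϖ n R)}

/-- Two surjections with the same kernel have isomorphic targets. -/
noncomputable def equivOfKerEq {S X Y Z : Type*} [Ring S] [AddCommGroup X] [Module S X]
    [AddCommGroup Y] [Module S Y] [AddCommGroup Z] [Module S Z] (f : X →ₗ[S] Y) (g : X →ₗ[S] Z)
    (hf : Function.Surjective f) (hg : Function.Surjective g)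
    (h : LinearMap.ker f = LinearMap.ker g) : Y ≃ₗ[S] Z :=
  (f.quotKerEquivOfSurjective hf).symm ≪≫ₗ Submodule.quotEquivOfEq _ _ h ≪≫ₗ
    g.quotKerEquivOfSurjective hg

theorem smul_mem_of_scale_le (h : scale N ≤ M) {x : Amb p ϖ n R} (hx : x ∈ N) :
    algebraMap O (WO p O R) ϖ • x ∈ M := h ⟨x, hx, rfl⟩

/-! ### Presentations of subquotients over the residue ring -/

section Presentation

variable {m m' : ℕ} {B : Matrix (Fin n) (Fin m) (LO p ϖ R)} {C : Matrix (Fin m) (Fin n) (LO p ϖ R)}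
  {B' : Matrix (Fin n) (Fin m') (LO p ϖ R)} {C' : Matrix (Fin m') (Fin n) (LO p ϖ R)}

/-- The matrix over `R` whose cokernel is `N / M`. -/
noncomputable def presMatrix (D : Matrix (Fin m') (Fin m) (WO p O R))
    (E : Matrix (Fin m') (Fin m') (WO p O R)) : Matrix (Fin m') (Fin m ⊕ Fin m') R :=
  Matrix.fromCols (D.map (WO.res p O R)) (E.map (WO.res p O R))

/-- `N / M` is generated by the columns of `B'`. Their relations come from the generators of `M`,
with coordinates `D = C' * B`, and from the redundancy of the generators, given by `E = 1 - C' * B'`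
with `B' * E = 0`. Because `ϖ N ≤ M`, everything may be read modulo `ϖ`. -/
theorem exists_equiv_coker (hϖ : Irreducible ϖ) (hM : IsFrame B C M) (hN : IsFrame B' C' N)
    (hsc : scale N ≤ M) {D : Matrix (Fin m') (Fin m) (WO p O R)}
    {E : Matrix (Fin m') (Fin m') (WO p O R)}
    (hD : D.map (algebraMap (WO p O R) (LO p ϖ R)) = C' * B)
    (hE : E.map (algebraMap (WO p O R) (LO p ϖ R)) = 1 - C' * B') :
    Nonempty (SubQuot N M ≃ₗ[WO p O R]
      ((Fin m' → R) ⧸ LinearMap.range (presMatrix D E).mulVecLin)) := by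
  have hinj := LO.algebraMap_injective (p := p) (R := R) hϖ
  let π : (Fin m' → WO p O R) →ₗ[WO p O R] SubQuot N M := (M.submoduleOf N).mkQ ∘ₗ hN.comb
  let ρ : (Fin m' → WO p O R) →ₗ[WO p O R]
      ((Fin m' → R) ⧸ LinearMap.range (presMatrix D E).mulVecLin) :=
    (Submodule.mkQ (LinearMap.range (presMatrix D E).mulVecLin)).restrictScalars (WO p O R) ∘ₗ
      (Algebra.linearMap (WO p O R) R).compLeft (Fin m')
  have hπ : Function.Surjective π :=
    (Submodule.mkQ_surjective _).comp (hN.comb_surjective hinj)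
  have hρ : Function.Surjective ρ := by
    refine (Submodule.mkQ_surjective _).comp fun y => ?_
    choose x hx using fun j => WO.res_surjective (O := O) (p := p) (y j)
    exact ⟨x, funext hx⟩
  refine ⟨equivOfKerEq π ρ hπ hρ ?_⟩
  ext y
  rw [LinearMap.mem_ker, LinearMap.mem_ker]
  have h1 : π y = 0 ↔ (hN.comb y).1 ∈ M := Submodule.Quotient.mk_eq_zero _
  have h2 : ρ y = 0 ↔ (fun j => WO.res p O R (y j)) ∈ LinearMap.range (presMatrix D E).mulVecLin :=
    Submodule.Quotient.mk_eq_zero _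
  rw [h1, h2]
  have hcomb : (hN.comb y).1 = B'.mulVec fun j => algebraMap _ _ (y j) := rfl
  have hmap : ∀ {k l : ℕ} (X : Matrix (Fin k) (Fin l) (WO p O R)) (z : Fin l → WO p O R) j,
      algebraMap (WO p O R) (LO p ϖ R) (X.mulVec z j) =
        (X.map (algebraMap (WO p O R) (LO p ϖ R))).mulVec (fun j => algebraMap _ _ (z j)) j :=
    fun X z j => by rw [matrix_map_mulVec]
  have hres : ∀ (z₁ : Fin m → WO p O R) (z₂ : Fin m' → WO p O R),
      (presMatrix D E).mulVecLin (Sum.elim (fun j => WO.res p O R (z₁ j))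
        fun j => WO.res p O R (z₂ j)) =
        fun j => WO.res p O R (D.mulVec z₁ j + E.mulVec z₂ j) := fun z₁ z₂ => by
    rw [Matrix.mulVecLin_apply, presMatrix, Matrix.fromCols_mulVec, Sum.elim_comp_inl,
      Sum.elim_comp_inr, matrix_map_mulVec, matrix_map_mulVec]
    ext j
    rw [map_add]; rfl
  constructor
  · intro hy
    -- If `B' y` lies in `M` with coordinates `c`, then `D c = C' B' y`, so `y = D c + E y`.
    refine ⟨Sum.elim (fun j => WO.res p O R (hM.coord hinj ⟨_, hy⟩ j))
      fun j => WO.res p O R (y j), ?_⟩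
    rw [hres]
    ext j
    congr 1
    apply hinj
    rw [map_add, hmap, hmap, hD, hE, Matrix.sub_mulVec, Matrix.one_mulVec, Pi.sub_apply]
    have h3 : (fun j => algebraMap (WO p O R) (LO p ϖ R) (hM.coord hinj ⟨_, hy⟩ j)) =
        C.mulVec (hN.comb y).1 := funext fun j => hM.algebraMap_coord hinj _ j
    rw [h3, ← Matrix.mulVec_mulVec, hM.mulVec_mulVec, hcomb, Matrix.mulVec_mulVec]
    ring
  · rintro ⟨z, hz⟩
    choose z₁ hz₁ using fun j => WO.res_surjective (O := O) (p := p) (z (Sum.inl j))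
    choose z₂ hz₂ using fun j => WO.res_surjective (O := O) (p := p) (z (Sum.inr j))
    have h3 : z = Sum.elim (fun j => WO.res p O R (z₁ j)) fun j => WO.res p O R (z₂ j) := by
      ext (j | j)
      · exact (hz₁ j).symm
      · exact (hz₂ j).symm
    rw [h3, hres] at hz
    have h4 : ∀ j, ∃ w, y j = D.mulVec z₁ j + E.mulVec z₂ j + algebraMap O (WO p O R) ϖ * w :=
      fun j => by
      obtain ⟨w, hw⟩ := (WO.res_eq_zero_iff hϖ (y j - (D.mulVec z₁ j + E.mulVec z₂ j))).mp (by
        rw [map_sub, ← congrFun hz j, sub_self])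
      exact ⟨w, by rw [← hw]; ring⟩
    choose w hw using h4
    have h5 : y = D.mulVec z₁ + E.mulVec z₂ + algebraMap O (WO p O R) ϖ • w := funext hw
    rw [h5, map_add, map_add, map_smul, Submodule.coe_add, Submodule.coe_add, Submodule.coe_smul]
    refine M.add_mem (M.add_mem ?_ ?_) (smul_mem_of_scale_le hsc (hN.comb w).2)
    · change B'.mulVec (fun j => algebraMap _ _ (D.mulVec z₁ j)) ∈ M
      simp_rw [hmap]
      rw [hD, ← Matrix.mulVec_mulVec, hN.mulVec_mulVec]
      exact hM.mulVec_mem fun j => ⟨_, rfl⟩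
    · change B'.mulVec (fun j => algebraMap _ _ (E.mulVec z₂ j)) ∈ M
      simp_rw [hmap]
      rw [hE, Matrix.mulVec_mulVec, Matrix.mul_sub, ← Matrix.mul_assoc, hN.mul_eq_one,
        Matrix.one_mul, Matrix.mul_one, sub_self, Matrix.zero_mulVec]
      exact M.zero_mem

end Presentation

/-- Whether `N / M` is a vector bundle of rank `d` can be tested at geometric points. -/
theorem isResidueBundle_iff_geometric (hϖ : Irreducible ϖ) (hM : IsLattice M) (hN : IsLattice N)
    (hle : M ≤ N) (hsc : scale N ≤ M) {d : ℕ} :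
    IsResidueBundle p ϖ R (SubQuot N M) d ↔
      ∀ (K : Type u) [Field K] [IsAlgClosed K] [Algebra (ResidueField O) K]
        (f : R →ₐ[ResidueField O] K),
        IsResidueBundle p ϖ K (SubQuot (pullback f N) (pullback f M)) d := by
  have hred := isReduced_of_perfectRing p R
  obtain ⟨m, B, C, h⟩ := exists_frame hM
  obtain ⟨m', B', C', h'⟩ := exists_frame hN
  obtain ⟨D, hD⟩ := exists_map_eq ((h.le_iff h').mp hle)
  obtain ⟨E, hE⟩ := exists_map_eq (ϖ := ϖ) (X := 1 - C' * B') fun a b => by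
    rw [Matrix.sub_apply, Matrix.one_apply]
    refine Subring.sub_mem _ ?_ (h'.int a b)
    split_ifs
    · exact Subring.one_mem _
    · exact Subring.zero_mem _
  obtain ⟨e⟩ := exists_equiv_coker hϖ h h' hsc hD hE
  rw [isResidueBundle_iff_of_equiv hϖ e]
  -- The pulled back lattices are presented by the image of the same matrix, so the fibre of the
  -- cokernel is the subquotient at the geometric point.
  have key : ∀ (K : Type u) [Field K] [IsAlgClosed K] [Algebra (ResidueField O) K] [Algebra R K]
      (f : R →ₐ[ResidueField O] K), (∀ x, f x = algebraMap R K x) →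
      (IsResidueBundle p ϖ K (SubQuot (pullback f N) (pullback f M)) d ↔
        Module.finrank K (K ⊗[R] ((Fin m' → R) ⧸ LinearMap.range (presMatrix D E).mulVecLin)) = d) := by
    intro K _ _ _ _ f hf
    have := charP_of_algebra (ResidueField O) p K
    have := perfectRing_of_isAlgClosed K p
    have hDf : (D.map (WO.map p O f)).map (algebraMap (WO p O K) (LO p ϖ K)) =
        C'.map (LO.map p ϖ f) * B.map (LO.map p ϖ f) := by
      rw [← Matrix.map_mul, ← hD]
      ext a b
      exact (LO.map_algebraMap ϖ f _).symm
    have hEf : (E.map (WO.map p O f)).map (algebraMap (WO p O K) (LO p ϖ K)) =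
        1 - C'.map (LO.map p ϖ f) * B'.map (LO.map p ϖ f) := by
      rw [← Matrix.map_mul, ← Matrix.map_one (LO.map p ϖ f) (map_zero _) (map_one _),
        ← Matrix.map_sub _ (map_sub _), ← hE]
      ext a b
      exact (LO.map_algebraMap ϖ f _).symm
    obtain ⟨e'⟩ := exists_equiv_coker hϖ (h.pullback f) (h'.pullback f)
      (by rw [← pullback_scale f hN]; exact pullback_mono f hsc) hDf hEf
    rw [isResidueBundle_iff_of_equiv hϖ e', isVectorBundle_field_iff,
      (cokerBaseChange (S := K) (presMatrix D E)).finrank_eq]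
    have hP : presMatrix (D.map (WO.map p O f)) (E.map (WO.map p O f)) =
        (presMatrix D E).map (algebraMap R K) := by
      ext a (b | b)
      · change WO.res p O K (WO.map p O f _) = algebraMap R K (WO.res p O R _)
        rw [WO.res_map, hf]
      · change WO.res p O K (WO.map p O f _) = algebraMap R K (WO.res p O R _)
        rw [WO.res_map, hf]
    rw [hP]
    exact and_iff_right inferInstance
  constructor
  · intro H K _ _ _ f
    let _ : Algebra R K := f.toRingHom.toAlgebra
    exact (key K f fun _ => rfl).mpr (H.finrank_baseChange K)
  · intro H
    have : Module.FinitePresentation R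
        ((Fin m' → R) ⧸ LinearMap.range (presMatrix D E).mulVecLin) :=
      Module.finitePresentation_of_surjective (Submodule.mkQ _) (Submodule.mkQ_surjective _) (by
        rw [Submodule.ker_mkQ, LinearMap.range_eq_map]
        exact Module.Finite.fg_top.map _)
    refine isVectorBundle_of_geometric (ResidueField O) fun K _ _ _ _ _ => ?_
    exact (key K (IsScalarTower.toAlgHom (ResidueField O) R K) fun _ => rfl).mp (H K _)

end ResidueBundles

/-! ### Minuscule relative positions -/

section Minuscule

variable {p : ℕ} [Fact p.Prime] {O : Type v} [CommRing O] [IsDomain O]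
  [IsDiscreteValuationRing O] [IsAdicComplete (maximalIdeal O) O] [Finite (ResidueField O)]
  [CharP (ResidueField O) p] {ϖ : O} {n : ℕ}
  {R R' : Type u} [CommRing R] [Algebra (ResidueField O) R] [CharP R p] [PerfectRing R p]
  [CommRing R'] [Algebra (ResidueField O) R'] [CharP R' p] [PerfectRing R' p]
  {M N P : Submodule (WO p O R) (Amb p ϖ n R)} {μ : Fin n → ℤ}

theorem zpow_mem_range {d : ℤ} (hd : 0 ≤ d) :
    ((unitϖ p ϖ R ^ d : (LO p ϖ R)ˣ) : LO p ϖ R) ∈ (algebraMap (WO p O R) (LO p ϖ R)).range := by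
  obtain ⟨k, rfl⟩ := Int.eq_ofNat_of_zero_le hd
  refine ⟨algebraMap O (WO p O R) ϖ ^ k, ?_⟩
  rw [zpow_natCast, map_pow, Units.val_pow_eq_pow_val]
  rfl

theorem nonneg_of_zpow_mem_range [Nontrivial R] (hϖ : Irreducible ϖ) {d : ℤ}
    (h : ((unitϖ p ϖ R ^ d : (LO p ϖ R)ˣ) : LO p ϖ R) ∈
      (algebraMap (WO p O R) (LO p ϖ R)).range) : 0 ≤ d := by
  obtain ⟨a, ha⟩ := h
  by_contra! hd
  obtain ⟨k, hk⟩ : ∃ k : ℕ, d = -(k + 1 : ℕ) := ⟨(-d - 1).toNat, by push_cast; omega⟩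
  have h1 : a * algebraMap O (WO p O R) ϖ ^ (k + 1) = 1 := by
    apply LO.algebraMap_injective (ϖ := ϖ) hϖ
    rw [map_mul, ha, hk, zpow_neg, zpow_natCast, map_pow, map_one]
    have : algebraMap (WO p O R) (LO p ϖ R) (algebraMap O (WO p O R) ϖ) =
      ((unitϖ p ϖ R : (LO p ϖ R)ˣ) : LO p ϖ R) := rfl
    rw [this, ← Units.val_pow_eq_pow_val, Units.inv_mul]
  have h2 := congrArg (WO.res p O R) h1
  rw [map_mul, map_pow, WO.res_uniformizer hϖ, pow_succ, mul_zero, mul_zero, map_one] at h2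
  exact zero_ne_one h2

theorem HasRelPos.mem_iff (H : HasRelPos M N μ) : ∃ g h : Matrix (Fin n) (Fin n) (LO p ϖ R),
    IsFrame g h N ∧ ∀ x, x ∈ M ↔ ∀ j, ((unitϖ p ϖ R ^ (-μ j) : (LO p ϖ R)ˣ) : LO p ϖ R) *
      h.mulVec x j ∈ (algebraMap (WO p O R) (LO p ϖ R)).range := by
  obtain ⟨g, h, hN, hM⟩ := hasRelPos_iff.mp H
  refine ⟨g, h, hN, fun x => ?_⟩
  rw [hM.mem_iff]
  refine forall_congr' fun j => ?_
  rw [← Matrix.mulVec_mulVec, diagϖ, Matrix.mulVec_diagonal]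
  rfl

theorem HasRelPos.le (H : HasRelPos M N μ) (hμ : ∀ j, 0 ≤ μ j) : M ≤ N := by
  obtain ⟨g, h, hN, hM⟩ := H.mem_iff
  intro x hx
  rw [hN.mem_iff]
  intro j
  have h1 : h.mulVec x j = ((unitϖ p ϖ R ^ μ j : (LO p ϖ R)ˣ) : LO p ϖ R) *
      (((unitϖ p ϖ R ^ (-μ j) : (LO p ϖ R)ˣ) : LO p ϖ R) * h.mulVec x j) := by
    rw [← mul_assoc, zpow_neg, Units.mul_inv, one_mul]
  rw [h1]
  exact Subring.mul_mem _ (zpow_mem_range (hμ j)) ((hM x).mp hx j)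

theorem HasRelPos.nonneg [Nontrivial R] (hϖ : Irreducible ϖ) (H : HasRelPos M N μ) (hle : M ≤ N)
    (j : Fin n) : 0 ≤ μ j := by
  obtain ⟨g, h, hN, hM⟩ := hasRelPos_iff.mp H
  have h1 := (hM.le_iff hN).mp hle j j
  rw [← Matrix.mul_assoc, mul_eq_one_comm.mp hN.mul_eq_one, Matrix.one_mul, diagϖ,
    Matrix.diagonal_apply_eq] at h1
  exact nonneg_of_zpow_mem_range hϖ h1

theorem HasRelPos.scale (H : HasRelPos M N μ) : HasRelPos (scale M) N (μ + 1) := by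
  obtain ⟨g, h, hN, hM⟩ := hasRelPos_iff.mp H
  rw [hasRelPos_iff]
  refine ⟨g, h, hN, ?_⟩
  convert hM.scale using 1
  · ext i j
    simp only [diagϖ, Matrix.mul_diagonal, Matrix.smul_apply, Pi.add_apply, Pi.one_apply,
      zpow_add, zpow_one, Units.val_mul, Units.smul_def, smul_eq_mul]
    ring
  · ext i j
    simp only [diagϖ, Matrix.diagonal_mul, Matrix.smul_apply, Pi.add_apply, Pi.one_apply,
      Pi.neg_apply, neg_add, zpow_add, zpow_neg, zpow_one, Units.val_mul, Units.smul_def,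
      smul_eq_mul]
    ring

theorem HasRelPos.scale_le (H : HasRelPos M N μ) (hμ : ∀ j, μ j ≤ 1) : Unitary.scale N ≤ M :=
  H.neg.scale.le fun j => by
    have := hμ j
    simp only [Pi.add_apply, Pi.neg_apply, Pi.one_apply]
    omega

theorem HasRelPos.le_one [Nontrivial R] (hϖ : Irreducible ϖ) (H : HasRelPos M N μ)
    (hle : Unitary.scale N ≤ M) (j : Fin n) : μ j ≤ 1 := by
  have := H.neg.scale.nonneg hϖ hle j
  simp only [Pi.add_apply, Pi.neg_apply, Pi.one_apply] at this
  omega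

theorem omega_nonneg (n d : ℕ) (j : Fin n) : 0 ≤ omega n d j := by
  rw [omega]; split_ifs <;> norm_num

theorem omega_le_one (n d : ℕ) (j : Fin n) : omega n d j ≤ 1 := by
  rw [omega]; split_ifs <;> norm_num

theorem isVectorBundle_pi (R : Type u) [CommRing R] (d : ℕ) : IsVectorBundle R (Fin d → R) d where
  finite := inferInstance
  projective := inferInstance
  rank_eq x := by
    have := x.nontrivial
    rw [Module.rankAtStalk_eq_finrank_of_free]
    simp

/-- In a basis of `N` adapted to `M`, the first `d` coordinates modulo `ϖ` identify `N / M` with `R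
^ d`. -/
theorem HasRelPos.isResidueBundle (hϖ : Irreducible ϖ) {d : ℕ} (hd : d ≤ n)
    (H : HasRelPos M N (omega n d)) : IsResidueBundle p ϖ R (SubQuot N M) d := by
  obtain ⟨g, h, hN, hM⟩ := H.mem_iff
  have hinj := LO.algebraMap_injective (p := p) (R := R) hϖ
  let ψ : N →ₗ[WO p O R] (Fin d → R) :=
    LinearMap.funLeft _ _ (Fin.castLE hd) ∘ₗ (Algebra.linearMap (WO p O R) R).compLeft (Fin n) ∘ₗ
      hN.coord hinj
  have hψ : Function.Surjective ψ := by
    intro y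
    choose x hx using fun j => WO.res_surjective (O := O) (p := p) (y j)
    let z : Fin n → WO p O R := fun j => if hj : j.val < d then x ⟨j, hj⟩ else 0
    refine ⟨hN.comb z, ?_⟩
    ext j
    change WO.res p O R (hN.coord hinj (hN.comb z) _) = _
    have : hN.coord hinj (hN.comb z) = z := by
      ext j
      apply hinj
      rw [hN.algebraMap_coord hinj]
      change h.mulVec (g.mulVec fun a => _) j = _
      rw [Matrix.mulVec_mulVec, mul_eq_one_comm.mp hN.mul_eq_one, Matrix.one_mulVec]
    rw [this]
    simp only [z, Fin.val_castLE, Fin.is_lt, dif_pos, Fin.eta]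
    exact hx j
  refine (isResidueBundle_iff_of_equiv hϖ (equivOfKerEq (M.submoduleOf N).mkQ ψ
    (Submodule.mkQ_surjective _) hψ ?_)).mpr (isVectorBundle_pi R d)
  ext x
  rw [Submodule.ker_mkQ, LinearMap.mem_ker]
  change x.1 ∈ M ↔ _
  rw [hM]
  constructor
  · intro hx
    ext j
    change WO.res p O R (hN.coord hinj x _) = 0
    obtain ⟨c, hc⟩ := hx (Fin.castLE hd j)
    rw [WO.res_eq_zero_iff hϖ]
    refine ⟨c, hinj ?_⟩
    rw [hN.algebraMap_coord hinj, map_mul, hc, omega, if_pos (by simp), ← mul_assoc]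
    have : algebraMap (WO p O R) (LO p ϖ R) (algebraMap O (WO p O R) ϖ) =
      ((unitϖ p ϖ R : (LO p ϖ R)ˣ) : LO p ϖ R) := rfl
    rw [this, zpow_neg, zpow_one, Units.mul_inv, one_mul]
  · intro hx j
    by_cases hj : j.val < d
    · have h1 : WO.res p O R (hN.coord hinj x j) = 0 := congrFun hx ⟨j, hj⟩
      obtain ⟨c, hc⟩ := (WO.res_eq_zero_iff hϖ _).mp h1
      refine ⟨c, ?_⟩
      rw [← hN.algebraMap_coord hinj, hc, map_mul, omega, if_pos hj, ← mul_assoc]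
      have : algebraMap (WO p O R) (LO p ϖ R) (algebraMap O (WO p O R) ϖ) =
        ((unitϖ p ϖ R : (LO p ϖ R)ˣ) : LO p ϖ R) := rfl
      rw [this, zpow_neg, zpow_one, Units.inv_mul, one_mul]
    · rw [omega, if_neg hj, neg_zero, zpow_zero, Units.val_one, one_mul]
      exact (hN.mem_iff _).mp x.2 j

theorem eq_omega_of_antitone {l : Fin n → ℤ} (hl : Antitone l) (h0 : ∀ j, 0 ≤ l j)
    (h1 : ∀ j, l j ≤ 1) : ∃ d ≤ n, l = omega n d := by
  refine ⟨(Finset.univ.filter fun j => l j = 1).card,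
    (Finset.card_le_univ _).trans (Fintype.card_fin n).le, ?_⟩
  ext j
  rw [omega]
  rcases (show l j = 0 ∨ l j = 1 by have := h0 j; have := h1 j; omega) with h | h
  · rw [if_neg, h]
    rw [not_lt]
    calc _ ≤ (Finset.univ.filter fun i : Fin n => i.val < j.val).card := by
          refine Finset.card_le_card fun i hi => ?_
          simp only [Finset.mem_filter, Finset.mem_univ, true_and] at hi ⊢
          by_contra! hc
          have := hl (Fin.le_def.mpr hc)
          omega
      _ ≤ j.val := by rw [Fin.card_filter_val_lt]; omega
  · rw [if_pos, h]
    calc j.val < (Finset.univ.filter fun i : Fin n => i.val < j.val + 1).card := by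
          rw [Fin.card_filter_val_lt]; omega
      _ ≤ _ := by
          refine Finset.card_le_card fun i hi => ?_
          simp only [Finset.mem_filter, Finset.mem_univ, true_and] at hi ⊢
          have := hl (Fin.le_def.mpr (Nat.lt_succ_iff.mp hi))
          have := h1 i
          omega

theorem IsResidueBundle.rank_unique [Nontrivial R] {X : Type*} [AddCommGroup X]
    [Module (WO p O R) X] {d e : ℕ} (h : IsResidueBundle p ϖ R X d)
    (h' : IsResidueBundle p ϖ R X e) : d = e := by
  obtain ⟨q⟩ : Nonempty (PrimeSpectrum R) := inferInstance
  have h1 := h.bundle.rank_eq q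
  rw [h'.bundle.rank_eq q] at h1
  exact_mod_cast h1.symm

/-- By Cartan there is some dominant relative position. The two inclusions force its entries into
`{0, 1}`, and the rank of `N / M` counts the ones. -/
theorem hasRelPos_omega_iff {K : Type u} [Field K] [Algebra (ResidueField O) K] [CharP K p]
    [PerfectRing K p] {M N : Submodule (WO p O K) (Amb p ϖ n K)} (hϖ : Irreducible ϖ)
    (hM : IsLattice M) (hN : IsLattice N) {d : ℕ} (hd : d ≤ n) :
    HasRelPos M N (omega n d) ↔
      M ≤ N ∧ scale N ≤ M ∧ IsResidueBundle p ϖ K (SubQuot N M) d := by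
  constructor
  · intro H
    exact ⟨H.le (omega_nonneg n d), H.scale_le (omega_le_one n d), H.isResidueBundle hϖ hd⟩
  · rintro ⟨h1, h2, h3⟩
    obtain ⟨l, hl, H⟩ := exists_hasRelPos hϖ hM hN
    obtain ⟨e, he, rfl⟩ := eq_omega_of_antitone hl (H.nonneg hϖ h1) (H.le_one hϖ h2)
    rwa [h3.rank_unique (H.isResidueBundle hϖ he)]

/-- A modification of lattices is bounded by a minuscule cocharacter `ω_d` if and only if it is
given by a vector bundle of rank `d`. -/
theorem isBounded_omega_iff_bundle (hϖ : Irreducible ϖ) (hM : IsLattice M) (hN : IsLattice N)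
    {d : ℕ} (hd : d ≤ n) : IsBounded M N (omega n d) ↔
      M ≤ N ∧ scale N ≤ M ∧ IsResidueBundle p ϖ R (SubQuot N M) d := by
  rw [isBounded_omega_iff]
  constructor
  · intro H
    have hle : M ≤ N := le_of_forall_geometric hϖ hM hN fun K _ _ _ f => by
      have := charP_of_algebra (ResidueField O) p K
      have := perfectRing_of_isAlgClosed K p
      exact (H K f).le (omega_nonneg n d)
    have hsc : scale N ≤ M := le_of_forall_geometric hϖ (hN.scale hϖ) hM fun K _ _ _ f => by
      have := charP_of_algebra (ResidueField O) p K
      have := perfectRing_of_isAlgClosed K p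
      rw [pullback_scale f hN]
      exact (H K f).scale_le (omega_le_one n d)
    refine ⟨hle, hsc, (isResidueBundle_iff_geometric hϖ hM hN hle hsc).mpr fun K _ _ _ f => ?_⟩
    have := charP_of_algebra (ResidueField O) p K
    have := perfectRing_of_isAlgClosed K p
    exact (H K f).isResidueBundle hϖ hd
  · rintro ⟨hle, hsc, h⟩ K _ _ _ f
    have := charP_of_algebra (ResidueField O) p K
    have := perfectRing_of_isAlgClosed K p
    rw [hasRelPos_omega_iff hϖ (hM.pullback hϖ f) (hN.pullback hϖ f) hd]
    refine ⟨pullback_mono f hle, ?_,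
      (isResidueBundle_iff_geometric hϖ hM hN hle hsc).mp h K f⟩
    rw [← pullback_scale f hN]
    exact pullback_mono f hsc

/-! ### Lattices from subbundles -/

theorem mk_eq_mk_iff {x y : N} : (Submodule.Quotient.mk x : SubQuot N M) = Submodule.Quotient.mk y ↔
    x.1 - y.1 ∈ M :=
  Submodule.Quotient.eq (M.submoduleOf N)

theorem mk_eq_zero_iff {x : N} : (Submodule.Quotient.mk x : SubQuot N M) = 0 ↔ x.1 ∈ M :=
  Submodule.Quotient.mk_eq_zero (M.submoduleOf N)

/-- The projector of `N / ϖ N` given by a direct summand lifts to `N`. -/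
theorem exists_lift_projector (hϖ : Irreducible ϖ) (hN : IsLattice N)
    (hsc : scale N ≤ M) (hproj : Module.Projective R (R ⊗[WO p O R] SubQuot N M)) :
    ∃ el : N →ₗ[WO p O R] N, (∀ x, x.1 - (el x).1 ∈ M) ∧ ∀ x : N, x.1 ∈ M → (el x).1 ∈ scale N := by
  have := hN.projective
  have hX : ∀ x : SubQuot N (scale N), algebraMap O (WO p O R) ϖ • x = 0 := by
    intro x
    obtain ⟨x, rfl⟩ := Submodule.mkQ_surjective _ x
    rw [← map_smul, Submodule.mkQ_apply, Submodule.Quotient.mk_eq_zero]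
    exact ⟨x.1, x.2, rfl⟩
  have hQ : ∀ x : SubQuot N M, algebraMap O (WO p O R) ϖ • x = 0 := by
    intro x
    obtain ⟨x, rfl⟩ := Submodule.mkQ_surjective _ x
    rw [← map_smul, Submodule.mkQ_apply, Submodule.Quotient.mk_eq_zero]
    exact hsc ⟨x.1, x.2, rfl⟩
  let q : SubQuot N (scale N) →ₗ[WO p O R] SubQuot N M := natMap le_rfl hsc
  have hq : Function.Surjective q := by
    intro x
    obtain ⟨x, rfl⟩ := Submodule.mkQ_surjective _ x
    exact ⟨Submodule.Quotient.mk x, rfl⟩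
  -- `σ` splits `N / ϖ N → N / M` over `R`. The endomorphism `el` of the projective module `N` lifts
  -- `x ↦ σ (x mod M)`; it is the identity modulo `M` and maps `M` into `ϖ N`.
  obtain ⟨σ, hσ⟩ := Module.projective_lifting_property (q.baseChange R) LinearMap.id
    (q.lTensor_surjective R hq)
  obtain ⟨el, hel⟩ := Module.projective_lifting_property ((scale N).submoduleOf N).mkQ
    ((residueEquiv hϖ hX).symm.toLinearMap ∘ₗ σ.restrictScalars (WO p O R) ∘ₗ
      (residueEquiv hϖ hQ).toLinearMap ∘ₗ (M.submoduleOf N).mkQ) (Submodule.mkQ_surjective _)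
  have hlift_mk : ∀ x, (Submodule.Quotient.mk (el x) : SubQuot N (scale N)) =
      (residueEquiv hϖ hX).symm (σ (residueEquiv hϖ hQ (Submodule.Quotient.mk x))) :=
    fun x => LinearMap.congr_fun hel x
  have hcomm : ∀ z, residueEquiv hϖ hQ (q z) = q.baseChange R (residueEquiv hϖ hX z) :=
    fun z => (LinearMap.baseChange_tmul (A := R) (f := q) 1 z).symm
  refine ⟨el, fun x => ?_, fun x hx => ?_⟩
  · have h2 : q (Submodule.Quotient.mk (el x)) = Submodule.Quotient.mk x := by
      apply (residueEquiv hϖ hQ).injective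
      rw [hcomm, hlift_mk, LinearEquiv.apply_symm_apply]
      exact LinearMap.congr_fun hσ _
    have h3 : (Submodule.Quotient.mk x : SubQuot N M) = Submodule.Quotient.mk (el x) := h2.symm
    exact mk_eq_mk_iff.mp h3
  · have h3 : (Submodule.Quotient.mk (el x) : SubQuot N (scale N)) = 0 := by
      rw [hlift_mk, mk_eq_zero_iff.mpr hx, map_zero, map_zero, map_zero]
    exact mk_eq_zero_iff.mp h3

/-- The preimage in a lattice `N` of a subbundle of `N / ϖ N` is a lattice. -/
theorem isLattice_of_projective (hϖ : Irreducible ϖ) (hN : IsLattice N) (hle : M ≤ N)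
    (hsc : scale N ≤ M) (hproj : Module.Projective R (R ⊗[WO p O R] SubQuot N M)) :
    IsLattice M := by
  have := hN.finite
  have := hN.projective
  obtain ⟨el, h1, h2⟩ := exists_lift_projector hϖ hN hsc hproj
  -- `M` is a retract of `N × N`: the retraction `r` is `(x, y) ↦ (x - el x) + ϖ y`, and its section
  -- `s` is `x ↦ (x, ϖ⁻¹ el x)`.
  let r : N × N →ₗ[WO p O R] M := LinearMap.codRestrict M
    (LinearMap.coprod (N.subtype - N.subtype ∘ₗ el)
      (algebraMap O (WO p O R) ϖ • N.subtype)) fun x =>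
        M.add_mem (h1 x.1) (hsc ⟨x.2.1, x.2.2, rfl⟩)
  let t : Amb p ϖ n R →ₗ[WO p O R] Amb p ϖ n R :=
    { toFun := fun x => (unitϖ p ϖ R)⁻¹ • x
      map_add' := smul_add _
      map_smul' := fun a x => smul_comm _ _ _ }
  let s : M →ₗ[WO p O R] N × N := LinearMap.prod (Submodule.inclusion hle)
    (LinearMap.codRestrict N (t ∘ₗ N.subtype ∘ₗ el ∘ₗ Submodule.inclusion hle) fun x =>
      mem_scale.mp (h2 ⟨x.1, hle x.2⟩ x.2))
  have hrs : r ∘ₗ s = LinearMap.id := by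
    refine LinearMap.ext fun x => Subtype.ext ?_
    change (x.1 - (el ⟨x.1, hle x.2⟩).1) + algebraMap O (WO p O R) ϖ •
      ((unitϖ p ϖ R)⁻¹ • (el ⟨x.1, hle x.2⟩).1) = x.1
    rw [← unitϖ_smul, smul_inv_smul, sub_add_cancel]
  refine ⟨Module.Finite.of_surjective r fun x => ⟨s x, LinearMap.congr_fun hrs x⟩,
    Module.Projective.of_split s r hrs, ?_⟩
  rw [eq_top_iff, ← hN.span_eq_top, Submodule.span_le]
  intro x hx
  have h3 : unitϖ p ϖ R • x ∈ M := hsc (mem_scale.mpr (by rwa [inv_smul_smul]))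
  have h4 := Submodule.smul_mem (Submodule.span (LO p ϖ R) (M : Set (Amb p ϖ n R)))
    (((unitϖ p ϖ R)⁻¹ : (LO p ϖ R)ˣ) : LO p ϖ R) (Submodule.subset_span h3)
  rwa [← Units.smul_def, inv_smul_smul] at h4

/-! ### Lattices between two lattices -/

variable {E Ep Em : Submodule (WO p O R) (Amb p ϖ n R)}

theorem mk_mem_toSub (h : Em ≤ E) (x : Ep) :
    (Submodule.Quotient.mk x : SubQuot Ep Em) ∈ toSub Ep Em E ↔ x.1 ∈ E := by
  constructor
  · rintro ⟨y, hy, hxy⟩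
    have h2 := E.sub_mem hy (h (mk_eq_mk_iff.mp hxy))
    rwa [Submodule.subtype_apply, sub_sub_cancel] at h2
  · intro hx
    exact ⟨x, hx, rfl⟩

theorem mem_ofSub {W : Submodule (WO p O R) (SubQuot Ep Em)} {x : Amb p ϖ n R} :
    x ∈ ofSub W ↔ ∃ h : x ∈ Ep, (Submodule.Quotient.mk ⟨x, h⟩ : SubQuot Ep Em) ∈ W := by
  constructor
  · rintro ⟨y, hy, rfl⟩
    exact ⟨y.2, hy⟩
  · rintro ⟨h, hW⟩
    exact ⟨⟨x, h⟩, hW, rfl⟩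

theorem ofSub_toSub (h : Em ≤ E) (h' : E ≤ Ep) : ofSub (toSub Ep Em E) = E := by
  ext x
  rw [mem_ofSub]
  constructor
  · rintro ⟨hx, hW⟩
    exact (mk_mem_toSub h _).mp hW
  · intro hx
    exact ⟨h' hx, (mk_mem_toSub h _).mpr hx⟩

theorem ofSub_le (W : Submodule (WO p O R) (SubQuot Ep Em)) : ofSub W ≤ Ep := fun _ hx =>
  (mem_ofSub.mp hx).1

theorem le_ofSub (h : Em ≤ Ep) (W : Submodule (WO p O R) (SubQuot Ep Em)) : Em ≤ ofSub W :=
  fun x hx => mem_ofSub.mpr ⟨h hx, by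
    rw [mk_eq_zero_iff.mpr hx]
    exact W.zero_mem⟩

theorem toSub_ofSub (h : Em ≤ Ep) (W : Submodule (WO p O R) (SubQuot Ep Em)) :
    toSub Ep Em (ofSub W) = W := by
  ext y
  obtain ⟨x, rfl⟩ := Submodule.mkQ_surjective _ y
  rw [Submodule.mkQ_apply, mk_mem_toSub (le_ofSub h W), mem_ofSub]
  exact ⟨fun h => h.2, fun h => ⟨x.2, h⟩⟩

/-- `E / Em` as a submodule of `Ep / Em`. -/
noncomputable def subQuotEquivToSub (h : Em ≤ E) (h' : E ≤ Ep) :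
    SubQuot E Em ≃ₗ[WO p O R] toSub Ep Em E :=
  equivOfKerEq (Em.submoduleOf E).mkQ
    (LinearMap.codRestrict (toSub Ep Em E) ((Em.submoduleOf Ep).mkQ ∘ₗ Submodule.inclusion h')
      fun x => (mk_mem_toSub h _).mpr x.2)
    (Submodule.mkQ_surjective _)
    (by
      rintro ⟨y, hy⟩
      obtain ⟨x, rfl⟩ := Submodule.mkQ_surjective _ y
      exact ⟨⟨x.1, (mk_mem_toSub h x).mp hy⟩, rfl⟩)
    (by
      ext x
      rw [Submodule.ker_mkQ, LinearMap.mem_ker, Subtype.ext_iff]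
      exact (mk_eq_zero_iff (M := Em) (x := Submodule.inclusion h' x)).symm)

/-- `Ep / E` as the quotient of `Ep / Em` by `E / Em`. -/
noncomputable def subQuotEquivQuot (h : Em ≤ E) :
    SubQuot Ep E ≃ₗ[WO p O R] (SubQuot Ep Em ⧸ toSub Ep Em E) :=
  equivOfKerEq (E.submoduleOf Ep).mkQ
    ((toSub Ep Em E).mkQ ∘ₗ (Em.submoduleOf Ep).mkQ)
    (Submodule.mkQ_surjective _)
    ((Submodule.mkQ_surjective _).comp (Submodule.mkQ_surjective _))
    (by
      ext x
      rw [Submodule.ker_mkQ, LinearMap.ker_comp, Submodule.ker_mkQ]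
      exact (mk_mem_toSub h x).symm)

theorem isResidueSubbundle_toSub_iff (h : Em ≤ E) (h' : E ≤ Ep) {r s : ℕ} :
    IsResidueSubbundle p ϖ R (toSub Ep Em E) r s ↔
      IsResidueBundle p ϖ R (SubQuot E Em) r ∧ IsResidueBundle p ϖ R (SubQuot Ep E) s := by
  rw [isResidueBundle_congr (subQuotEquivToSub h h'),
    isResidueBundle_congr (subQuotEquivQuot (Ep := Ep) h)]
  exact ⟨fun H => ⟨H.sub, H.quot⟩, fun H => ⟨H.1, H.2⟩⟩

end Minuscule

/-! ### Reduction modulo the uniformizer -/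

section Reduction

variable {p : ℕ} [Fact p.Prime] {O : Type v} [CommRing O] [IsDomain O]
  [IsDiscreteValuationRing O] [IsAdicComplete (maximalIdeal O) O] [Finite (ResidueField O)]
  [CharP (ResidueField O) p] {ϖ : O} {n : ℕ}
  {R R' : Type u} [CommRing R] [Algebra (ResidueField O) R] [CharP R p] [PerfectRing R p]
  [CommRing R'] [Algebra (ResidueField O) R'] [CharP R' p] [PerfectRing R' p]
  {M N P : Submodule (WO p O R) (Amb p ϖ n R)}

variable (p ϖ n R) in
/-- The map `W_O(R)ⁿ → W_O(R)[1/ϖ]ⁿ`. -/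
noncomputable def toAmb : (Fin n → WO p O R) →ₗ[WO p O R] Amb p ϖ n R :=
  (Algebra.linearMap (WO p O R) (LO p ϖ R)).compLeft (Fin n)

variable (p O n R) in
/-- The map `W_O(R)ⁿ → Rⁿ`. -/
noncomputable def resPi : (Fin n → WO p O R) →ₗ[WO p O R] (Fin n → R) :=
  (Algebra.linearMap (WO p O R) R).compLeft (Fin n)

theorem toAmb_apply (y : Fin n → WO p O R) (j : Fin n) :
    toAmb p ϖ n R y j = algebraMap (WO p O R) (LO p ϖ R) (y j) := rfl

theorem toAmb_injective (hϖ : Irreducible ϖ) : Function.Injective (toAmb p ϖ n R) :=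
  fun _ _ h => funext fun j => LO.algebraMap_injective hϖ (congrFun h j)

theorem resPi_surjective : Function.Surjective (resPi p O n R) := fun v => by
  choose x hx using fun j => WO.res_surjective (O := O) (p := p) (v j)
  exact ⟨x, funext hx⟩

theorem resPi_eq_zero_iff (hϖ : Irreducible ϖ) (y : Fin n → WO p O R) :
    resPi p O n R y = 0 ↔ ∃ w, y = algebraMap O (WO p O R) ϖ • w := by
  constructor
  · intro h
    choose w hw using fun j => (WO.res_eq_zero_iff hϖ (y j)).mp (congrFun h j)
    exact ⟨w, funext hw⟩
  · rintro ⟨w, rfl⟩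
    exact funext fun j => (WO.res_eq_zero_iff hϖ _).mpr ⟨w j, rfl⟩

theorem mem_trivialLattice_iff {x : Amb p ϖ n R} :
    x ∈ trivialLattice p ϖ n R ↔ ∃ y, toAmb p ϖ n R y = x := by
  rw [mem_trivialLattice]
  constructor
  · intro h
    choose y hy using h
    exact ⟨y, funext hy⟩
  · rintro ⟨y, rfl⟩ j
    exact ⟨y j, rfl⟩

theorem toAmb_mem (y : Fin n → WO p O R) : toAmb p ϖ n R y ∈ trivialLattice p ϖ n R :=
  mem_trivialLattice_iff.mpr ⟨y, rfl⟩

theorem toAmb_mem_scale (hϖ : Irreducible ϖ) (y : Fin n → WO p O R) :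
    toAmb p ϖ n R y ∈ scale (trivialLattice p ϖ n R) ↔ resPi p O n R y = 0 := by
  rw [resPi_eq_zero_iff hϖ]
  constructor
  · rintro ⟨x, hx, hxy⟩
    obtain ⟨w, rfl⟩ := mem_trivialLattice_iff.mp hx
    refine ⟨w, toAmb_injective hϖ ?_⟩
    rw [map_smul, ← hxy]
    rfl
  · rintro ⟨w, rfl⟩
    rw [map_smul]
    exact ⟨_, toAmb_mem w, rfl⟩

/-- The image is already stable under `R`, because scalars lift along the surjection `W_O(R) → R`;
the span adds nothing. -/
theorem mem_reduction {v : Fin n → R} :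
    v ∈ reduction M ↔ ∃ y, toAmb p ϖ n R y ∈ M ∧ resPi p O n R y = v := by
  constructor
  · intro hv
    induction hv using Submodule.span_induction with
    | mem v hv => exact hv
    | zero => exact ⟨0, by rw [map_zero]; exact M.zero_mem, map_zero _⟩
    | add v w _ _ hv hw =>
      obtain ⟨y, hy, rfl⟩ := hv
      obtain ⟨z, hz, rfl⟩ := hw
      exact ⟨y + z, by rw [map_add]; exact M.add_mem hy hz, map_add _ _ _⟩
    | smul a v _ hv =>
      obtain ⟨y, hy, rfl⟩ := hv
      obtain ⟨b, rfl⟩ := WO.res_surjective (O := O) (p := p) a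
      refine ⟨b • y, by rw [map_smul]; exact M.smul_mem _ hy, ?_⟩
      rw [map_smul, ← algebraMap_smul R b]
      rfl
  · rintro ⟨y, hy, rfl⟩
    exact Submodule.subset_span ⟨y, hy, rfl⟩

theorem resPi_mem_reduction (hϖ : Irreducible ϖ) (hsc : scale (trivialLattice p ϖ n R) ≤ M)
    (y : Fin n → WO p O R) : resPi p O n R y ∈ reduction M ↔ toAmb p ϖ n R y ∈ M := by
  rw [mem_reduction]
  constructor
  · rintro ⟨z, hz, h⟩
    have h1 := hsc ((toAmb_mem_scale hϖ (y - z)).mpr (by rw [map_sub, h, sub_self]))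
    rw [map_sub] at h1
    exact (Submodule.sub_mem_iff_left M hz).mp h1
  · exact fun h => ⟨y, h, rfl⟩

theorem reduction_mono (h : M ≤ N) : reduction M ≤ reduction N := fun v hv => by
  obtain ⟨y, hy, rfl⟩ := mem_reduction.mp hv
  exact mem_reduction.mpr ⟨y, h hy, rfl⟩

theorem reduction_le_iff (hϖ : Irreducible ϖ) (hle : M ≤ trivialLattice p ϖ n R)
    (hsc : scale (trivialLattice p ϖ n R) ≤ N) : reduction M ≤ reduction N ↔ M ≤ N := by
  refine ⟨fun h x hx => ?_, reduction_mono⟩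
  obtain ⟨y, rfl⟩ := mem_trivialLattice_iff.mp (hle hx)
  exact (resPi_mem_reduction hϖ hsc y).mp (h (mem_reduction.mpr ⟨y, hx, rfl⟩))

variable (p ϖ) in
/-- The preimage in `𝓔⁰` of a submodule of `Rⁿ`. -/
noncomputable def ofReduction (V : Submodule R (Fin n → R)) :
    Submodule (WO p O R) (Amb p ϖ n R) :=
  ((V.restrictScalars (WO p O R)).comap (resPi p O n R)).map (toAmb p ϖ n R)

variable {V : Submodule R (Fin n → R)}

theorem ofReduction_le (V : Submodule R (Fin n → R)) :
    ofReduction p ϖ V ≤ trivialLattice p ϖ n R := by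
  rintro _ ⟨y, -, rfl⟩
  exact toAmb_mem y

theorem le_ofReduction (hϖ : Irreducible ϖ) (V : Submodule R (Fin n → R)) :
    scale (trivialLattice p ϖ n R) ≤ ofReduction p ϖ V := fun x hx => by
  obtain ⟨y, rfl⟩ := mem_trivialLattice_iff.mp (scale_le_self hx)
  refine ⟨y, ?_, rfl⟩
  change resPi p O n R y ∈ V
  rw [(toAmb_mem_scale hϖ y).mp hx]
  exact V.zero_mem

theorem reduction_ofReduction (hϖ : Irreducible ϖ) (V : Submodule R (Fin n → R)) :
    reduction (ofReduction p ϖ V) = V := by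
  ext v
  obtain ⟨y, rfl⟩ := resPi_surjective (O := O) (p := p) v
  rw [resPi_mem_reduction hϖ (le_ofReduction hϖ V)]
  constructor
  · rintro ⟨z, hz, h⟩
    rwa [toAmb_injective hϖ h] at hz
  · exact fun h => ⟨y, h, rfl⟩

theorem reduction_pullback (hϖ : Irreducible ϖ) (f : R →ₐ[ResidueField O] R')
    (hle : M ≤ trivialLattice p ϖ n R) :
    reduction (pullback f M) = pullbackSub f (reduction M) := by
  apply le_antisymm
  · rw [← reduction_ofReduction (p := p) hϖ (pullbackSub f (reduction M))]
    refine reduction_mono (Submodule.span_le.mpr ?_)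
    rintro _ ⟨x, hx, rfl⟩
    obtain ⟨y, rfl⟩ := mem_trivialLattice_iff.mp (hle hx)
    refine ⟨fun j => WO.map p O f (y j), ?_, funext fun j => (LO.map_algebraMap ϖ f (y j)).symm⟩
    refine Submodule.subset_span ⟨resPi p O n R y, mem_reduction.mpr ⟨y, hx, rfl⟩, ?_⟩
    exact funext fun j => (WO.res_map f (y j)).symm
  · refine Submodule.span_le.mpr ?_
    rintro _ ⟨v, hv, rfl⟩
    obtain ⟨y, hy, rfl⟩ := mem_reduction.mp hv
    refine mem_reduction.mpr ⟨fun j => WO.map p O f (y j), ?_, funext fun j => WO.res_map f (y j)⟩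
    convert mem_pullback_of_mem f hy using 1
    exact funext fun j => (LO.map_algebraMap ϖ f (y j)).symm

theorem frobSub_reduction (hϖ : Irreducible ϖ) (hle : M ≤ trivialLattice p ϖ n R) :
    frobSub (ResidueField O) (reduction M) = reduction (twist M) :=
  (reduction_pullback hϖ (frob O R) hle).symm

/-- For integral vectors, `⟨x, y⟩` vanishes modulo `ϖ` exactly when `⟨x, ϖ⁻¹ y⟩` is integral. -/
theorem perp_reduction (hϖ : Irreducible ϖ) (hle : M ≤ trivialLattice p ϖ n R) :
    perp (reduction M) = reduction (scale (dual M)) := by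
  have hpair : ∀ x y : Fin n → WO p O R,
      ∑ j, resPi p O n R x j * resPi p O n R y (Fin.rev j) = 0 ↔
        ∑ j, toAmb p ϖ n R x j * ((unitϖ p ϖ R)⁻¹ • toAmb p ϖ n R y) (Fin.rev j) ∈
          (1 : Submodule (WO p O R) (LO p ϖ R)) := by
    intro x y
    have h1 : ∑ j, resPi p O n R x j * resPi p O n R y (Fin.rev j) =
        WO.res p O R (∑ j, x j * y (Fin.rev j)) := by
      rw [map_sum]
      exact Finset.sum_congr rfl fun j _ => (map_mul (WO.res p O R) _ _).symm
    have h2 : ∑ j, toAmb p ϖ n R x j * ((unitϖ p ϖ R)⁻¹ • toAmb p ϖ n R y) (Fin.rev j) =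
        ((unitϖ p ϖ R)⁻¹ : (LO p ϖ R)ˣ) *
          algebraMap (WO p O R) (LO p ϖ R) (∑ j, x j * y (Fin.rev j)) := by
      rw [map_sum, Finset.mul_sum]
      refine Finset.sum_congr rfl fun j _ => ?_
      rw [Pi.smul_apply, Units.smul_def, smul_eq_mul, toAmb_apply, toAmb_apply, map_mul]
      ring
    rw [h1, h2, WO.res_eq_zero_iff hϖ, Submodule.mem_one]
    refine exists_congr fun b => ?_
    rw [eq_comm (a := algebraMap (WO p O R) (LO p ϖ R) b), Units.inv_mul_eq_iff_eq_mul,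
      ← (LO.algebraMap_injective (p := p) (R := R) hϖ).eq_iff, map_mul]
    rfl
  ext v
  rw [mem_reduction]
  constructor
  · intro hv
    obtain ⟨y, rfl⟩ := resPi_surjective (O := O) (p := p) v
    refine ⟨y, mem_scale.mpr fun x hx => ?_, rfl⟩
    obtain ⟨x, rfl⟩ := mem_trivialLattice_iff.mp (hle hx)
    exact (hpair x y).mp (hv _ (mem_reduction.mpr ⟨x, hx, rfl⟩))
  · rintro ⟨y, hy, rfl⟩ v hv
    obtain ⟨x, hx, rfl⟩ := mem_reduction.mp hv
    exact (hpair x y).mpr (mem_scale.mp hy _ hx)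

/-- The coordinates on `𝓔⁰`. -/
noncomputable def trivialEquiv (hϖ : Irreducible ϖ) :
    (Fin n → WO p O R) ≃ₗ[WO p O R] trivialLattice p ϖ n R :=
  LinearEquiv.ofBijective (LinearMap.codRestrict _ (toAmb p ϖ n R) toAmb_mem)
    ⟨fun _ _ h => toAmb_injective hϖ (congrArg Subtype.val h), fun x => by
      obtain ⟨y, hy⟩ := mem_trivialLattice_iff.mp x.2
      exact ⟨y, Subtype.ext hy⟩⟩

theorem toAmb_trivialEquiv_symm (hϖ : Irreducible ϖ) (x : trivialLattice p ϖ n R) :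
    toAmb p ϖ n R ((trivialEquiv hϖ).symm x) = x :=
  congrArg Subtype.val ((trivialEquiv hϖ).apply_symm_apply x)

theorem isResidueBundle_quot_iff (hϖ : Irreducible ϖ) (hsc : scale (trivialLattice p ϖ n R) ≤ M)
    {d : ℕ} : IsResidueBundle p ϖ R (SubQuot (trivialLattice p ϖ n R) M) d ↔
      IsVectorBundle R ((Fin n → R) ⧸ reduction M) d := by
  refine isResidueBundle_iff_of_equiv hϖ (equivOfKerEq (M.submoduleOf _).mkQ
    ((Submodule.mkQ (reduction M)).restrictScalars (WO p O R) ∘ₗ resPi p O n R ∘ₗ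
      (trivialEquiv hϖ).symm.toLinearMap) (Submodule.mkQ_surjective _)
    ((Submodule.mkQ_surjective _).comp (resPi_surjective.comp (LinearEquiv.surjective _))) ?_)
  ext x
  rw [Submodule.ker_mkQ, LinearMap.mem_ker]
  change x.1 ∈ M ↔ (Submodule.Quotient.mk (resPi p O n R ((trivialEquiv hϖ).symm x)) :
    (Fin n → R) ⧸ reduction M) = 0
  rw [Submodule.Quotient.mk_eq_zero, resPi_mem_reduction hϖ hsc, toAmb_trivialEquiv_symm]

theorem isResidueBundle_sub_iff (hϖ : Irreducible ϖ) (hle : M ≤ trivialLattice p ϖ n R)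
    {d : ℕ} : IsResidueBundle p ϖ R (SubQuot M (scale (trivialLattice p ϖ n R))) d ↔
      IsVectorBundle R (reduction M) d := by
  let g₀ : M →ₗ[WO p O R] (Fin n → R) := resPi p O n R ∘ₗ
    (trivialEquiv hϖ).symm.toLinearMap ∘ₗ Submodule.inclusion hle
  let g : M →ₗ[WO p O R] reduction M :=
    { toFun := fun x => ⟨g₀ x, mem_reduction.mpr ⟨(trivialEquiv hϖ).symm ⟨x.1, hle x.2⟩, by
        rw [toAmb_trivialEquiv_symm]
        exact x.2, rfl⟩⟩
      map_add' := fun x y => Subtype.ext (map_add g₀ x y)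
      map_smul' := fun a x => Subtype.ext (map_smul g₀ a x) }
  have hg : Function.Surjective g := by
    rintro ⟨v, hv⟩
    obtain ⟨y, hy, rfl⟩ := mem_reduction.mp hv
    refine ⟨⟨_, hy⟩, Subtype.ext ?_⟩
    change resPi p O n R ((trivialEquiv hϖ).symm ⟨toAmb p ϖ n R y, _⟩) = _
    congr 1
    rw [LinearEquiv.symm_apply_eq]
    rfl
  have : IsScalarTower (WO p O R) R (reduction M) :=
    ⟨fun a b x => Subtype.ext (smul_assoc a b x.1)⟩
  refine isResidueBundle_iff_of_equiv (V := reduction M) hϖ (equivOfKerEq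
    ((scale (trivialLattice p ϖ n R)).submoduleOf M).mkQ g (Submodule.mkQ_surjective _) hg ?_)
  ext x
  rw [Submodule.ker_mkQ, LinearMap.mem_ker, Subtype.ext_iff]
  change x.1 ∈ scale (trivialLattice p ϖ n R) ↔
    resPi p O n R ((trivialEquiv hϖ).symm ⟨x.1, hle x.2⟩) = 0
  rw [← toAmb_mem_scale hϖ, toAmb_trivialEquiv_symm]

theorem isLattice_ofReduction (hϖ : Irreducible ϖ) {d : ℕ}
    (h : IsVectorBundle R ((Fin n → R) ⧸ V) d) : IsLattice (ofReduction p ϖ V) := by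
  refine isLattice_of_projective hϖ (isLattice_trivialLattice hϖ) (ofReduction_le V)
    (le_ofReduction hϖ V) ?_
  have h1 : IsResidueBundle p ϖ R (SubQuot (trivialLattice p ϖ n R) (ofReduction p ϖ V)) d := by
    rw [isResidueBundle_quot_iff hϖ (le_ofReduction hϖ V), reduction_ofReduction hϖ]
    exact h
  exact h1.bundle.projective

/-- Multiplication by `ϖ`. -/
noncomputable def subQuotScaleEquiv (N M : Submodule (WO p O R) (Amb p ϖ n R)) :
    SubQuot N M ≃ₗ[WO p O R] SubQuot (scale N) (scale M) :=
  equivOfKerEq (M.submoduleOf N).mkQ (((scale M).submoduleOf (scale N)).mkQ ∘ₗ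
    LinearMap.codRestrict (scale N) (LinearMap.lsmul (WO p O R) (Amb p ϖ n R)
      (algebraMap O (WO p O R) ϖ) ∘ₗ N.subtype) fun x => ⟨x.1, x.2, rfl⟩)
    (Submodule.mkQ_surjective _)
    ((Submodule.mkQ_surjective _).comp (by
      rintro ⟨_, x, hx, rfl⟩
      exact ⟨⟨x, hx⟩, rfl⟩))
    (by
      ext x
      rw [Submodule.ker_mkQ, LinearMap.ker_comp, Submodule.ker_mkQ]
      change x.1 ∈ M ↔ algebraMap O (WO p O R) ϖ • x.1 ∈ scale M
      rw [mem_scale, ← unitϖ_smul, inv_smul_smul])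

/-! ### Index -/

theorem IsBounded.hasIndex {μ : Fin n → ℤ} (H : IsBounded M N μ) {K : Type u} [Field K]
    [IsAlgClosed K] [Algebra (ResidueField O) K] (f : R →ₐ[ResidueField O] K) :
    HasIndex (Unitary.pullback f M) (Unitary.pullback f N) (∑ j, μ j) := by
  obtain ⟨l, -, h, H⟩ := H K f
  rw [← h.2]
  exact H.hasIndex

theorem HasIndex.scale (hϖ : Irreducible ϖ) {d : ℤ} (H : HasIndex M N d) :
    HasIndex (scale M) N (n + d) := by
  have H' := H
  obtain ⟨g, h, g', h', hN, hM, w, hw⟩ := H'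
  -- Scaling shifts the relative position `0` of `M` to itself to `(1, …, 1)`, of sum `n`.
  have h1 : HasRelPos M M 0 := hasRelPos_iff.mpr ⟨g', h', hM, by
    simpa only [diagϖ, Pi.zero_apply, neg_zero, zpow_zero, Units.val_one, Matrix.diagonal_one,
      Matrix.mul_one, Matrix.one_mul] using hM⟩
  have h2 := h1.scale.hasIndex
  simp only [zero_add, Pi.one_apply, Finset.sum_const, Finset.card_univ, Fintype.card_fin,
    nsmul_eq_mul, mul_one] at h2
  exact h2.trans hϖ H

/-- A modification of lattices which is minuscule and has index `d` is bounded by `ω_d`. -/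
theorem isBounded_omega_of_hasIndex (hϖ : Irreducible ϖ) (hM : IsLattice M) (hN : IsLattice N)
    (hle : M ≤ N) (hsc : scale N ≤ M) {d : ℕ}
    (H : ∀ (K : Type u) [Field K] [IsAlgClosed K] [Algebra (ResidueField O) K]
      (f : R →ₐ[ResidueField O] K), HasIndex (pullback f M) (pullback f N) d) :
    IsBounded M N (omega n d) := by
  rw [isBounded_omega_iff]
  intro K _ _ _ f
  have := charP_of_algebra (ResidueField O) p K
  have := perfectRing_of_isAlgClosed K p
  obtain ⟨l, hl, h⟩ := exists_hasRelPos hϖ (hM.pullback hϖ f) (hN.pullback hϖ f)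
  obtain ⟨e, he, rfl⟩ := eq_omega_of_antitone hl (h.nonneg hϖ (pullback_mono f hle))
    (h.le_one hϖ (by rw [← pullback_scale f hN]; exact pullback_mono f hsc))
  have h1 := h.hasIndex.unique hϖ (H K f)
  rw [sum_omega he] at h1
  rwa [← Nat.cast_injective h1]

/-! ### Flags -/

theorem exists_flag_of_chain {α : Type*} [PartialOrder α] {a b c d : α} (h₁ : a ≤ b) (h₂ : b ≤ c)
    (h₃ : c ≤ d) : ∃ F : Flag α, a ∈ F ∧ b ∈ F ∧ c ∈ F ∧ d ∈ F := by
  have hc : IsChain (· ≤ ·) ({a, b, c, d} : Set α) := by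
    have h₄ := h₁.trans h₂
    have h₅ := h₂.trans h₃
    have h₆ := h₄.trans h₃
    rintro x (rfl | rfl | rfl | rfl) y (rfl | rfl | rfl | rfl) - <;> simp [*]
  obtain ⟨F, hF⟩ := hc.exists_subset_flag
  exact ⟨F, hF (by simp), hF (by simp), hF (by simp), hF (by simp)⟩

end Reduction

/-! ### The Deligne-Lusztig variety and pairs of lattices -/

section PairPoints

variable {p : ℕ} [Fact p.Prime] {O : Type v} [CommRing O] [IsDomain O]
  [IsDiscreteValuationRing O] [IsAdicComplete (maximalIdeal O) O] [Finite (ResidueField O)]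
  [CharP (ResidueField O) p] {ϖ : O} {n i : ℕ}
  {R R' : Type u} [CommRing R] [Algebra (ResidueField O) R] [CharP R p] [PerfectRing R p]
  [CommRing R'] [Algebra (ResidueField O) R'] [CharP R' p] [PerfectRing R' p]
  {M N P : Submodule (WO p O R) (Amb p ϖ n R)}

theorem twist_mono (h : M ≤ N) : twist M ≤ twist N := pullback_mono _ h

theorem twist_scale (hM : IsLattice M) : twist (scale M) = scale (twist M) := pullback_scale _ hM

theorem twist_dual_anti (h : M ≤ N) : twist (dual N) ≤ twist (dual M) := twist_mono (dual_anti h)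

theorem twist_dual_trivialLattice :
    twist (dual (trivialLattice p ϖ n R)) = trivialLattice p ϖ n R := by
  rw [dual_trivialLattice, twist_trivialLattice]

theorem pullback_twist_dual (f : R →ₐ[ResidueField O] R') (hM : IsLattice M) :
    pullback f (twist (dual M)) = twist (dual (pullback f M)) := by
  rw [pullback_twist, pullback_dual f hM]

theorem scale_twist_dual_scale (hϖ : Irreducible ϖ) (hM : IsLattice M) :
    scale (twist (dual (scale M))) = twist (dual M) := by
  rw [dual_scale, ← twist_scale ((hM.dual hϖ).unscale hϖ), scale_unscale]

theorem IsBounded.twist_dual {μ : Fin n → ℤ} (hM : IsLattice M) (hN : IsLattice N)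
    (H : IsBounded M N μ) : IsBounded (twist (Unitary.dual N)) (twist (Unitary.dual M)) μ :=
  (H.dual hM hN).pullback _

theorem HasIndex.scale_scale (hϖ : Irreducible ϖ) {d : ℤ} (H : HasIndex M N d) :
    HasIndex (Unitary.scale M) (Unitary.scale N) d := by
  convert (H.scale hϖ).trans hϖ ((H.symm.trans hϖ H).scale hϖ).symm using 1
  ring

/-- Orthogonality modulo `ϖ` becomes the scaled dual lattice, and reduction commutes with Frobenius.
This expresses `F(V^⊥)` in the Deligne-Lusztig condition through lattices. -/
theorem frobSub_perp_reduction (hϖ : Irreducible ϖ) (hM : IsLattice M)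
    (hle : M ≤ trivialLattice p ϖ n R) (hsc : scale (trivialLattice p ϖ n R) ≤ M) :
    frobSub (ResidueField O) (perp (reduction M)) = reduction (scale (twist (dual M))) := by
  have h1 : scale (dual M) ≤ trivialLattice p ϖ n R := by
    have := scale_mono (dual_anti hsc)
    rwa [dual_scale, scale_unscale, dual_trivialLattice] at this
  rw [perp_reduction hϖ hle, frobSub_reduction hϖ h1, twist_scale (hM.dual hϖ)]

/-- Members of a flag are comparable, and the sign of the index excludes the wrong inclusion. -/
theorem le_of_mem_flag [Nontrivial R] (hϖ : Irreducible ϖ) {c : Flag (Submodule R (Fin n → R))}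
    (hM : reduction M ∈ c) (hN : reduction N ∈ c) (hM' : M ≤ trivialLattice p ϖ n R)
    (hM'' : scale (trivialLattice p ϖ n R) ≤ M) (hN' : N ≤ trivialLattice p ϖ n R)
    (hN'' : scale (trivialLattice p ϖ n R) ≤ N) {d : ℤ} (hd : 0 < d) (H : HasIndex M N d) :
    M ≤ N := by
  rcases c.le_or_le hM hN with h | h
  · exact (reduction_le_iff hϖ hM' hN'').mp h
  · have := H.symm.nonneg hϖ ((reduction_le_iff hϖ hN' hM'').mp h)
    omega

variable {E Ep Em : Submodule (WO p O R) (Amb p ϖ n R)}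

theorem isBounded_nuPlus_iff :
    IsBounded M N (dualCochar (nuPlus n i)) ↔ IsBounded N M (omega n (i - 1)) :=
  isBounded_dualCochar_iff

theorem isBounded_nuMinus_iff :
    IsBounded M N (dualCochar (nuMinus n i)) ↔ IsBounded M N (omega n i) := by
  rw [dualCochar_nuMinus]

theorem IsBounded.le (hϖ : Irreducible ϖ) (hM : IsLattice M) (hN : IsLattice N) {d : ℕ}
    (hd : d ≤ n) (H : IsBounded M N (omega n d)) : M ≤ N :=
  ((isBounded_omega_iff_bundle hϖ hM hN hd).mp H).1

theorem IsBounded.scale_le (hϖ : Irreducible ϖ) (hM : IsLattice M) (hN : IsLattice N) {d : ℕ}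
    (hd : d ≤ n) (H : IsBounded M N (omega n d)) : Unitary.scale N ≤ M :=
  ((isBounded_omega_iff_bundle hϖ hM hN hd).mp H).2.1

theorem IsBounded.isResidueBundle (hϖ : Irreducible ϖ) (hM : IsLattice M) (hN : IsLattice N) {d : ℕ}
    (hd : d ≤ n) (H : IsBounded M N (omega n d)) : IsResidueBundle p ϖ R (SubQuot N M) d :=
  ((isBounded_omega_iff_bundle hϖ hM hN hd).mp H).2.2

namespace IsPairPoint

theorem bounded_plus' (h : IsPairPoint i Ep Em) :
    IsBounded (trivialLattice p ϖ n R) Ep (omega n (i - 1)) :=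
  isBounded_nuPlus_iff.mp h.bounded_plus

theorem bounded_minus' (h : IsPairPoint i Ep Em) :
    IsBounded Em (trivialLattice p ϖ n R) (omega n i) :=
  isBounded_nuMinus_iff.mp h.bounded_minus

theorem pullback (hϖ : Irreducible ϖ) (h : IsPairPoint i Ep Em) (f : R →ₐ[ResidueField O] R') :
    IsPairPoint i (pullback f Ep) (pullback f Em) where
  lattice_plus := h.lattice_plus.pullback hϖ f
  lattice_minus := h.lattice_minus.pullback hϖ f
  bounded_plus := by rw [← pullback_trivialLattice f]; exact h.bounded_plus.pullback f
  bounded_minus := by rw [← pullback_trivialLattice f]; exact h.bounded_minus.pullback f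
  bounded_xi := h.bounded_xi.pullback f

variable (hϖ : Irreducible ϖ) (hn : 2 * i + 1 ≤ n) (h : IsPairPoint i Ep Em)
include hϖ hn h

theorem trivial_le_plus : trivialLattice p ϖ n R ≤ Ep :=
  h.bounded_plus'.le hϖ (isLattice_trivialLattice hϖ) h.lattice_plus (by omega)

theorem scale_plus_le_trivial : scale Ep ≤ trivialLattice p ϖ n R :=
  h.bounded_plus'.scale_le hϖ (isLattice_trivialLattice hϖ) h.lattice_plus (by omega)

theorem minus_le_trivial : Em ≤ trivialLattice p ϖ n R :=
  h.bounded_minus'.le hϖ h.lattice_minus (isLattice_trivialLattice hϖ) (by omega)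

theorem scale_trivial_le_minus : scale (trivialLattice p ϖ n R) ≤ Em :=
  h.bounded_minus'.scale_le hϖ h.lattice_minus (isLattice_trivialLattice hϖ) (by omega)

theorem scale_trivial_le_scale_plus : scale (trivialLattice p ϖ n R) ≤ scale Ep :=
  scale_mono (h.trivial_le_plus hϖ hn)

theorem minus_le_plus : Em ≤ Ep := (h.minus_le_trivial hϖ hn).trans (h.trivial_le_plus hϖ hn)

theorem scale_plus_le_minus : scale Ep ≤ Em :=
  h.bounded_xi.scale_le hϖ h.lattice_minus h.lattice_plus (by omega)

theorem twist_dual_plus_le : twist (dual Ep) ≤ trivialLattice p ϖ n R := by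
  have := twist_dual_anti (h.trivial_le_plus hϖ hn)
  rwa [twist_dual_trivialLattice] at this

theorem scale_trivial_le_twist_dual_plus :
    scale (trivialLattice p ϖ n R) ≤ twist (dual Ep) := by
  have := scale_mono (twist_dual_anti (h.scale_plus_le_trivial hϖ hn))
  rwa [twist_dual_trivialLattice, scale_twist_dual_scale hϖ h.lattice_plus] at this

theorem trivial_le_twist_dual_minus : trivialLattice p ϖ n R ≤ twist (dual Em) := by
  have := twist_dual_anti (h.minus_le_trivial hϖ hn)
  rwa [twist_dual_trivialLattice] at this

theorem scale_twist_dual_minus_le : scale (twist (dual Em)) ≤ trivialLattice p ϖ n R := by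
  have := scale_mono (twist_dual_anti (h.scale_trivial_le_minus hϖ hn))
  rwa [scale_twist_dual_scale hϖ (isLattice_trivialLattice hϖ), twist_dual_trivialLattice] at this

theorem frobSub_perp_minus : frobSub (ResidueField O) (perp (reduction Em)) =
    reduction (scale (twist (dual Em))) :=
  frobSub_perp_reduction hϖ h.lattice_minus (h.minus_le_trivial hϖ hn)
    (h.scale_trivial_le_minus hϖ hn)

theorem frobSub_perp_plus : frobSub (ResidueField O) (perp (reduction (scale Ep))) =
    reduction (twist (dual Ep)) := by
  rw [frobSub_perp_reduction hϖ (h.lattice_plus.scale hϖ) (h.scale_plus_le_trivial hϖ hn)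
    (h.scale_trivial_le_scale_plus hϖ hn), scale_twist_dual_scale hϖ h.lattice_plus]

section Index

variable {K : Type u} [Field K] [IsAlgClosed K] [Algebra (ResidueField O) K]
  (f : R →ₐ[ResidueField O] K)

theorem hasIndex_plus : HasIndex (trivialLattice p ϖ n K) (Unitary.pullback f Ep) (i - 1 : ℕ) := by
  have := h.bounded_plus'.hasIndex f
  rwa [sum_omega (by omega), pullback_trivialLattice] at this

theorem hasIndex_minus : HasIndex (Unitary.pullback f Em) (trivialLattice p ϖ n K) i := by
  have := h.bounded_minus'.hasIndex f
  rwa [sum_omega (by omega), pullback_trivialLattice] at this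

theorem hasIndex_twist_dual_plus :
    HasIndex (Unitary.pullback f (twist (dual Ep))) (trivialLattice p ϖ n K) (i - 1 : ℕ) := by
  have := (h.bounded_plus'.twist_dual (isLattice_trivialLattice hϖ) h.lattice_plus).hasIndex f
  rwa [sum_omega (by omega), twist_dual_trivialLattice, pullback_trivialLattice] at this

theorem hasIndex_twist_dual_minus :
    HasIndex (trivialLattice p ϖ n K) (Unitary.pullback f (twist (dual Em))) i := by
  have := (h.bounded_minus'.twist_dual h.lattice_minus (isLattice_trivialLattice hϖ)).hasIndex f
  rwa [sum_omega (by omega), twist_dual_trivialLattice, pullback_trivialLattice] at this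

end Index

/-- The flag contains the reductions of `ϖ Ep`, `ϖ F(Em^∨)`, `Em` and `F(Ep^∨)`, whose dimensions
increase strictly in this order. So it nests them in this order, and geometric points suffice for
the inclusions over `R`. -/
theorem isYPoint (hi : 2 ≤ i) (H : ∀ (K : Type u) [Field K] [IsAlgClosed K]
    [Algebra (ResidueField O) K] (f : R →ₐ[ResidueField O] K),
    ∃ c : Flag (Submodule K (Fin n → K)),
      pullbackSub f (reduction (scale Ep)) ∈ c ∧ pullbackSub f (reduction Em) ∈ c ∧
      frobSub (ResidueField O) (perp (pullbackSub f (reduction Em))) ∈ c ∧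
      frobSub (ResidueField O) (perp (pullbackSub f (reduction (scale Ep)))) ∈ c) :
    IsYPoint i Ep Em := by
  have hFp := (h.lattice_plus.dual hϖ).twist hϖ
  have hFm := (h.lattice_minus.dual hϖ).twist hϖ
  have H' : ∀ (K : Type u) [Field K] [IsAlgClosed K] [Algebra (ResidueField O) K]
      (f : R →ₐ[ResidueField O] K), ∃ c : Flag (Submodule K (Fin n → K)),
      reduction (scale (Unitary.pullback f Ep)) ∈ c ∧ reduction (Unitary.pullback f Em) ∈ c ∧
      reduction (scale (twist (dual (Unitary.pullback f Em)))) ∈ c ∧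
      reduction (twist (dual (Unitary.pullback f Ep))) ∈ c := by
    intro K _ _ _ f
    have := charP_of_algebra (ResidueField O) p K
    have := perfectRing_of_isAlgClosed K p
    obtain ⟨c, h1, h2, h3, h4⟩ := H K f
    rw [← reduction_pullback hϖ f (h.scale_plus_le_trivial hϖ hn),
      pullback_scale f h.lattice_plus] at h1 h4
    rw [← reduction_pullback hϖ f (h.minus_le_trivial hϖ hn)] at h2 h3
    rw [(h.pullback hϖ f).frobSub_perp_minus hϖ hn] at h3
    rw [(h.pullback hϖ f).frobSub_perp_plus hϖ hn] at h4
    exact ⟨c, h1, h2, h3, h4⟩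
  refine ⟨h, le_of_forall_geometric hϖ h.lattice_plus hFm fun K _ _ _ f => ?_,
    le_of_forall_geometric hϖ h.lattice_minus hFp fun K _ _ _ f => ?_,
    le_of_forall_geometric hϖ (hFm.scale hϖ) h.lattice_minus fun K _ _ _ f => ?_⟩
  all_goals
    have := charP_of_algebra (ResidueField O) p K
    have := perfectRing_of_isAlgClosed K p
    have hK := h.pullback hϖ f
    obtain ⟨c, h1, h2, h3, h4⟩ := H' K f
    have i1 := h.hasIndex_plus hϖ hn f
    have i2 := h.hasIndex_minus hϖ hn f
    have i3 := h.hasIndex_twist_dual_plus hϖ hn f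
    have i4 := h.hasIndex_twist_dual_minus hϖ hn f
    rw [pullback_twist_dual f h.lattice_plus] at i3
    rw [pullback_twist_dual f h.lattice_minus] at i4
  -- The indices behind the three inclusions are `1`, `1` and `n - 2 i`. The last is positive
  -- because `2 i + 1 ≤ n`.
  · rw [pullback_twist_dual f h.lattice_minus, ← scale_le_scale_iff]
    exact le_of_mem_flag hϖ h1 h3 (hK.scale_plus_le_trivial hϖ hn)
      (hK.scale_trivial_le_scale_plus hϖ hn) (hK.scale_twist_dual_minus_le hϖ hn)
      (scale_mono (hK.trivial_le_twist_dual_minus hϖ hn))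
      (by omega) ((i1.symm.trans hϖ i4).scale_scale hϖ)
  · rw [pullback_twist_dual f h.lattice_plus]
    exact le_of_mem_flag hϖ h2 h4 (hK.minus_le_trivial hϖ hn) (hK.scale_trivial_le_minus hϖ hn)
      (hK.twist_dual_plus_le hϖ hn) (hK.scale_trivial_le_twist_dual_plus hϖ hn)
      (by omega) (i2.trans hϖ i3.symm)
  · rw [pullback_scale f hFm, pullback_twist_dual f h.lattice_minus]
    exact le_of_mem_flag hϖ h3 h2 (hK.scale_twist_dual_minus_le hϖ hn)
      (scale_mono (hK.trivial_le_twist_dual_minus hϖ hn))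
      (hK.minus_le_trivial hϖ hn) (hK.scale_trivial_le_minus hϖ hn)
      (by omega) ((i4.symm.scale hϖ).trans hϖ i2.symm)

end IsPairPoint

namespace IsYPoint

theorem pullback (hϖ : Irreducible ϖ) (h : IsYPoint i Ep Em) (f : R →ₐ[ResidueField O] R') :
    IsYPoint i (pullback f Ep) (pullback f Em) where
  pair := h.pair.pullback hϖ f
  plus_le := by
    rw [← pullback_twist_dual f h.pair.lattice_minus]
    exact pullback_mono f h.plus_le
  minus_le := by
    rw [← pullback_twist_dual f h.pair.lattice_plus]
    exact pullback_mono f h.minus_le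
  scale_le := by
    rw [← pullback_twist_dual f h.pair.lattice_minus,
      ← pullback_scale f ((h.pair.lattice_minus.dual hϖ).twist hϖ)]
    exact pullback_mono f h.scale_le

variable (hϖ : Irreducible ϖ) (hn : 2 * i + 1 ≤ n) (h : IsYPoint i Ep Em)
include hϖ hn h

/-- The inclusions defining `Y_i` give the chain `ϖ Ep ≤ ϖ F(Em^∨) ≤ Em ≤ F(Ep^∨)`, and every chain
extends to a flag. -/
theorem exists_flag : ∃ c : Flag (Submodule R (Fin n → R)),
      reduction (scale Ep) ∈ c ∧ reduction Em ∈ c ∧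
      frobSub (ResidueField O) (perp (reduction Em)) ∈ c ∧
      frobSub (ResidueField O) (perp (reduction (scale Ep))) ∈ c := by
  rw [h.pair.frobSub_perp_minus hϖ hn, h.pair.frobSub_perp_plus hϖ hn]
  obtain ⟨c, h1, h2, h3, h4⟩ := exists_flag_of_chain (reduction_mono (scale_mono h.plus_le))
    (reduction_mono h.scale_le) (reduction_mono h.minus_le)
  exact ⟨c, h1, h3, h2, h4⟩

theorem isDLPoint : IsDLPoint (ResidueField O) i (reduction (scale Ep)) (reduction Em) where
  le := reduction_mono (h.pair.scale_plus_le_minus hϖ hn)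
  bundle₁ := by
    rw [← isResidueBundle_sub_iff hϖ (h.pair.scale_plus_le_trivial hϖ hn),
      ← isResidueBundle_congr (subQuotScaleEquiv Ep _)]
    exact h.pair.bounded_plus'.isResidueBundle hϖ (isLattice_trivialLattice hϖ)
      h.pair.lattice_plus (by omega)
  quot₁ := by
    rw [← isResidueBundle_quot_iff hϖ (h.pair.scale_trivial_le_scale_plus hϖ hn)]
    -- The corank is read off from the index `n - (i - 1)` of `ϖ Ep` in `𝓔⁰`.
    refine (isBounded_omega_of_hasIndex hϖ (h.pair.lattice_plus.scale hϖ)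
      (isLattice_trivialLattice hϖ) (h.pair.scale_plus_le_trivial hϖ hn)
      (h.pair.scale_trivial_le_scale_plus hϖ hn) fun K _ _ _ f => ?_).isResidueBundle hϖ
      (h.pair.lattice_plus.scale hϖ) (isLattice_trivialLattice hϖ) (by omega)
    have := charP_of_algebra (ResidueField O) p K
    have := perfectRing_of_isAlgClosed K p
    rw [pullback_scale f h.pair.lattice_plus, pullback_trivialLattice]
    convert (h.pair.hasIndex_plus hϖ hn f).symm.scale hϖ using 1
    omega
  bundle₂ := by
    rw [← isResidueBundle_sub_iff hϖ (h.pair.minus_le_trivial hϖ hn)]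
    have hE := (isLattice_trivialLattice (p := p) (n := n) (R := R) hϖ).scale hϖ
    refine (isBounded_omega_of_hasIndex hϖ hE h.pair.lattice_minus
      (h.pair.scale_trivial_le_minus hϖ hn) (scale_mono (h.pair.minus_le_trivial hϖ hn))
      fun K _ _ _ f => ?_).isResidueBundle hϖ hE h.pair.lattice_minus (by omega)
    have := charP_of_algebra (ResidueField O) p K
    have := perfectRing_of_isAlgClosed K p
    rw [pullback_scale f (isLattice_trivialLattice hϖ), pullback_trivialLattice]
    convert (h.pair.hasIndex_minus hϖ hn f).symm.scale hϖ using 1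
    omega
  quot₂ := by
    rw [← isResidueBundle_quot_iff hϖ (h.pair.scale_trivial_le_minus hϖ hn)]
    exact h.pair.bounded_minus'.isResidueBundle hϖ h.pair.lattice_minus
      (isLattice_trivialLattice hϖ) (by omega)
  relPos K _ _ _ f := by
    have := charP_of_algebra (ResidueField O) p K
    have := perfectRing_of_isAlgClosed K p
    rw [← reduction_pullback hϖ f (h.pair.scale_plus_le_trivial hϖ hn),
      ← reduction_pullback hϖ f (h.pair.minus_le_trivial hϖ hn),
      pullback_scale f h.pair.lattice_plus]
    exact (h.pullback hϖ f).exists_flag hϖ hn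

end IsYPoint

/-- The preimages of `V₁` and `V₂` in `𝓔⁰` have to be `ϖ Ep` and `Em`; they are lattices because
`V₁` and `V₂` are subbundles. -/
theorem IsDLPoint.isYPoint (hϖ : Irreducible ϖ) (hi : 2 ≤ i) (hn : 2 * i + 1 ≤ n)
    {V₁ V₂ : Submodule R (Fin n → R)} (h : IsDLPoint (ResidueField O) i V₁ V₂) :
    IsYPoint i (unscale (ofReduction p ϖ V₁)) (ofReduction p ϖ V₂) := by
  have hE := isLattice_trivialLattice (p := p) (n := n) (R := R) hϖ
  have hm : IsLattice (ofReduction p ϖ V₂) := isLattice_ofReduction hϖ h.quot₂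
  have hp : IsLattice (unscale (ofReduction p ϖ V₁)) :=
    (isLattice_ofReduction hϖ h.quot₁).unscale hϖ
  have hr₁ : reduction (ofReduction p ϖ V₁) = V₁ := reduction_ofReduction hϖ V₁
  have hr₂ : reduction (ofReduction p ϖ V₂) = V₂ := reduction_ofReduction hϖ V₂
  have l₁ : trivialLattice p ϖ n R ≤ unscale (ofReduction p ϖ V₁) := by
    rw [← scale_le_scale_iff, scale_unscale]
    exact le_ofReduction hϖ V₁
  have bp : IsBounded (trivialLattice p ϖ n R) (unscale (ofReduction p ϖ V₁))
      (omega n (i - 1)) := by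
    rw [isBounded_omega_iff_bundle hϖ hE hp (by omega), scale_unscale,
      isResidueBundle_congr (subQuotScaleEquiv (unscale (ofReduction p ϖ V₁)) _), scale_unscale,
      isResidueBundle_sub_iff hϖ (ofReduction_le V₁), hr₁]
    exact ⟨l₁, ofReduction_le V₁, h.bundle₁⟩
  have bm : IsBounded (ofReduction p ϖ V₂) (trivialLattice p ϖ n R) (omega n i) := by
    rw [isBounded_omega_iff_bundle hϖ hm hE (by omega),
      isResidueBundle_quot_iff hϖ (le_ofReduction hϖ V₂), hr₂]
    exact ⟨ofReduction_le V₂, le_ofReduction hϖ V₂, h.quot₂⟩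
  have hpair : IsPairPoint i (unscale (ofReduction p ϖ V₁)) (ofReduction p ϖ V₂) := by
    refine ⟨hp, hm, isBounded_nuPlus_iff.mpr bp, isBounded_nuMinus_iff.mpr bm,
      isBounded_omega_of_hasIndex hϖ hm hp ((ofReduction_le V₂).trans l₁) ?_
        fun K _ _ _ f => ?_⟩
    · rw [scale_unscale, ← reduction_le_iff hϖ (ofReduction_le V₁) (le_ofReduction hϖ V₂), hr₁, hr₂]
      exact h.le
    · have := charP_of_algebra (ResidueField O) p K
      have := perfectRing_of_isAlgClosed K p
      -- `Em` has index `i` in `𝓔⁰`, which has index `i - 1` in `Ep`.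
      convert (bm.hasIndex f).trans hϖ (bp.hasIndex f) using 1
      rw [sum_omega (by omega), sum_omega (by omega)]
      omega
  refine hpair.isYPoint hϖ hn hi ?_
  rw [scale_unscale, hr₁, hr₂]
  exact h.relPos

/-- The points of `Y_i` are the points of the Deligne-Lusztig variety. -/
theorem bijOn_reduction (hϖ : Irreducible ϖ) (hi : 2 ≤ i) (hn : 2 * i + 1 ≤ n) :
    Set.BijOn
      (fun L : Submodule (WO p O R) (Amb p ϖ n R) × Submodule (WO p O R) (Amb p ϖ n R) =>
        (reduction (scale L.1), reduction L.2))
      {L | IsYPoint i L.1 L.2} {V | IsDLPoint (ResidueField O) i V.1 V.2} := by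
  refine ⟨fun L hL => IsYPoint.isDLPoint hϖ hn hL, ?_, ?_⟩
  · rintro ⟨Ep, Em⟩ h ⟨Ep', Em'⟩ h' heq
    obtain ⟨h1, h2⟩ := Prod.ext_iff.mp heq
    change IsYPoint i Ep Em at h
    change IsYPoint i Ep' Em' at h'
    change reduction (scale Ep) = reduction (scale Ep') at h1
    change reduction Em = reduction Em' at h2
    refine Prod.ext (le_antisymm ?_ ?_) (le_antisymm ?_ ?_)
    · exact scale_le_scale_iff.mp ((reduction_le_iff hϖ (h.pair.scale_plus_le_trivial hϖ hn)
        (h'.pair.scale_trivial_le_scale_plus hϖ hn)).mp h1.le)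
    · exact scale_le_scale_iff.mp ((reduction_le_iff hϖ (h'.pair.scale_plus_le_trivial hϖ hn)
        (h.pair.scale_trivial_le_scale_plus hϖ hn)).mp h1.ge)
    · exact (reduction_le_iff hϖ (h.pair.minus_le_trivial hϖ hn)
        (h'.pair.scale_trivial_le_minus hϖ hn)).mp h2.le
    · exact (reduction_le_iff hϖ (h'.pair.minus_le_trivial hϖ hn)
        (h.pair.scale_trivial_le_minus hϖ hn)).mp h2.ge
  · rintro ⟨V₁, V₂⟩ h
    refine ⟨⟨unscale (ofReduction p ϖ V₁), ofReduction p ϖ V₂⟩, h.isYPoint hϖ hi hn, ?_⟩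
    simp only [scale_unscale, reduction_ofReduction hϖ]

end PairPoints

/-! ### Closed conditions -/

section TriplePoints

variable {p : ℕ} [Fact p.Prime] {O : Type v} [CommRing O] [IsDomain O]
  [IsDiscreteValuationRing O] [IsAdicComplete (maximalIdeal O) O] [Finite (ResidueField O)]
  [CharP (ResidueField O) p] {ϖ : O} {n i : ℕ}
  {R R' : Type u} [CommRing R] [Algebra (ResidueField O) R] [CharP R p] [PerfectRing R p]
  [CommRing R'] [Algebra (ResidueField O) R'] [CharP R' p] [PerfectRing R' p]
  {M N M' N' E E' Ep Em : Submodule (WO p O R) (Amb p ϖ n R)}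

/-- For lattices with `ϖ M ≤ N` the locus where `M ≤ N` is closed. -/
theorem exists_ideal_pullback_le_iff (hϖ : Irreducible ϖ) (hM : IsLattice M) (hN : IsLattice N)
    (hsc : scale M ≤ N) : ∃ I : Ideal R, ∀ (R' : Type u) [CommRing R'] [Algebra (ResidueField O) R']
      [CharP R' p] [PerfectRing R' p] (f : R →ₐ[ResidueField O] R'),
      pullback f M ≤ pullback f N ↔ I ≤ RingHom.ker f := by
  obtain ⟨m, B, C, h⟩ := exists_frame hM
  obtain ⟨m', B', C', h'⟩ := exists_frame hN
  -- `D` is `ϖ` times `C' * B`, integral because `ϖ M ≤ N`. Over `R'` the inclusion says that `ϖ`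
  -- divides the image of `D`, so the ideal is generated by the residues of the entries of `D`.
  obtain ⟨D, hD⟩ := exists_map_eq ((h.scale.le_iff h').mp hsc)
  refine ⟨Ideal.span (Set.range fun a : Fin m' × Fin m => WO.res p O R (D a.1 a.2)),
    fun R' _ _ _ _ f => ?_⟩
  rw [(h.pullback f).le_iff (h'.pullback f), Ideal.span_le, Set.range_subset_iff, Prod.forall]
  refine forall_congr' fun a => forall_congr' fun b => ?_
  have h1 : algebraMap (WO p O R') (LO p ϖ R') (WO.map p O f (D a b)) =
      algebraMap (WO p O R') (LO p ϖ R') (algebraMap O (WO p O R') ϖ) *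
        (C'.map (LO.map p ϖ f) * B.map (LO.map p ϖ f)) a b := by
    rw [← LO.map_algebraMap, ← Matrix.map_mul, Matrix.map_apply]
    have h2 := congrFun (congrFun hD a) b
    rw [Matrix.map_apply, Matrix.mul_smul, Matrix.smul_apply, Units.smul_def, smul_eq_mul] at h2
    rw [h2, map_mul]
    congr 1
    have h3 := LO.map_algebraMap (p := p) ϖ f (algebraMap O (WO p O R) ϖ)
    rwa [WO.map_algebraMap] at h3
  have hu : IsUnit (algebraMap (WO p O R') (LO p ϖ R') (algebraMap O (WO p O R') ϖ)) :=
    IsLocalization.Away.algebraMap_isUnit _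
  change _ ↔ f (WO.res p O R (D a b)) = 0
  rw [← WO.res_map, WO.res_eq_zero_iff hϖ]
  refine exists_congr fun c => ?_
  rw [← (LO.algebraMap_injective (p := p) (R := R') hϖ).eq_iff, h1, map_mul, hu.mul_right_inj,
    eq_comm]

/-! ### Submodules of subquotients -/

theorem map_natMap_toSub_le (hN : N ≤ N') (hM : M ≤ M') (h : E ≤ E') :
    (toSub N M E).map (natMap hN hM) ≤ toSub N' M' E' := by
  rintro _ ⟨_, ⟨x, hx, rfl⟩, rfl⟩
  exact ⟨⟨x.1, hN x.2⟩, h hx, rfl⟩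

theorem map_natMap_toSub_le_iff (hN : N ≤ N') (hM : M ≤ M') (hE : E ≤ N) (hE' : M' ≤ E') :
    (toSub N M E).map (natMap hN hM) ≤ toSub N' M' E' ↔ E ≤ E' := by
  refine ⟨fun h x hx => ?_, map_natMap_toSub_le hN hM⟩
  exact (mk_mem_toSub hE' ⟨x, hN (hE hx)⟩).mp (h ⟨_, ⟨⟨x, hE hx⟩, hx, rfl⟩, rfl⟩)

theorem annihilator_toSub (h : M ≤ E) (h' : E ≤ N) :
    annihilator (toSub N M E) = toSub (dual M) (dual N) (dual E) := by
  rw [annihilator, ofSub_toSub h h']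

theorem twistSub_toSub (h : M ≤ E) (h' : E ≤ N) :
    twistSub (toSub N M E) = toSub (twist N) (twist M) (twist E) := by
  rw [twistSub, pullbackQuot, ofSub_toSub h h']
  rfl

/-! ### Partial sums of minuscule cocharacters -/

theorem sum_omega_lt (n d m : ℕ) :
    ∑ j : Fin n with j.val < m, omega n d j = (min n (min m d) : ℕ) := by
  simp only [omega]
  rw [Finset.sum_boole, Finset.filter_filter]
  have : (Finset.univ.filter fun j : Fin n => j.val < m ∧ j.val < d) =
      Finset.univ.filter fun j : Fin n => j.val < min m d :=
    Finset.filter_congr fun j _ => lt_min_iff.symm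
  rw [this, Fin.card_filter_val_lt]

theorem dualCochar_nu (n i : ℕ) :
    dualCochar (nu n i) = omega n i + dualCochar (omega n (i - 1)) := by
  rw [← dualCochar_nuMinus]
  ext j
  simp only [dualCochar, nu, nuPlus, Pi.add_apply]
  ring

/-- Such an `l` has `a` entries `1`, `b` entries `-1` and zeros, with `a - b = 1` and `b ≤ i - 1`.
The bound is the extreme case `a = i`, `b = i - 1`. -/
theorem dominated_dualCochar_nu (hi : 1 ≤ i) (hn : 2 * i + 1 ≤ n) {l : Fin n → ℤ} (hl : Antitone l)
    (h1 : ∀ j, l j ≤ 1) (h2 : ∀ j, -1 ≤ l j) (h3 : ∑ j, l j = 1)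
    (h4 : 0 ≤ (∑ j, min (l j) 0) + (i - 1 : ℕ)) : Dominated l (dualCochar (nu n i)) := by
  -- The positive part of `l` is `ω_a` and its negative part is the dual of `ω_b`.
  obtain ⟨a, ha, ha'⟩ := eq_omega_of_antitone (l := fun j => max (l j) 0)
    (fun x y hxy => max_le_max (hl hxy) le_rfl) (fun j => le_max_right _ _)
    fun j => max_le (h1 j) zero_le_one
  obtain ⟨b, hb, hb'⟩ := eq_omega_of_antitone (l := dualCochar fun j => min (l j) 0)
    (Antitone.dualCochar fun x y hxy => min_le_min (hl hxy) le_rfl)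
    (fun j => neg_nonneg.mpr (min_le_right _ _))
    fun j => neg_le.mp (le_min (h2 _) (by norm_num))
  have hmin : (fun j => min (l j) 0) = dualCochar (omega n b) := by
    rw [← hb', dualCochar_dualCochar]
  have hl' : l = omega n a + dualCochar (omega n b) := by
    rw [← ha', ← hmin]
    ext j
    exact (max_add_min (l j) 0).trans (add_zero _) |>.symm
  have h5 : ∑ j, min (l j) 0 = -(b : ℤ) := by
    rw [hmin, sum_dualCochar, sum_omega hb]
  rw [h5] at h4
  have h6 : (a : ℤ) - b = 1 := by
    rw [← h3, hl']
    simp only [Pi.add_apply, Finset.sum_add_distrib]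
    rw [sum_dualCochar, sum_omega ha, sum_omega hb]
    ring
  rw [dualCochar_nu, hl']
  constructor
  · intro m
    simp only [Pi.add_apply, Finset.sum_add_distrib]
    rw [sum_dualCochar_lt, sum_dualCochar_lt, sum_omega_lt, sum_omega_lt, sum_omega_lt,
      sum_omega_lt, sum_omega hb, sum_omega (by omega)]
    omega
  · simp only [Pi.add_apply, Finset.sum_add_distrib]
    rw [sum_dualCochar, sum_dualCochar, sum_omega ha, sum_omega hb, sum_omega (by omega),
      sum_omega (by omega)]
    omega

/-- In a common basis `M + N` has position `min (l, 0)` relative to `N`. It is contained in `N'`, so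
its index there is not negative. This bounds the negative part of `l`. -/
theorem HasRelPos.nonneg_of_le [Nontrivial R] (hϖ : Irreducible ϖ) {l : Fin n → ℤ} {d : ℤ}
    (H : HasRelPos M N l) (hM : M ≤ N') (hN : N ≤ N') (hd : HasIndex N N' d) :
    0 ≤ (∑ j, min (l j) 0) + d := by
  obtain ⟨g, rfl, rfl⟩ := H
  have h1 : HasRelPos (Submodule.span (WO p O R) (Set.range fun j =>
      ((unitϖ p ϖ R ^ (min (l j) 0) : (LO p ϖ R)ˣ) : LO p ϖ R) • g j))
      (Submodule.span (WO p O R) (Set.range g)) fun j => min (l j) 0 := ⟨g, rfl, rfl⟩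
  refine (h1.hasIndex.trans hϖ hd).nonneg hϖ (Submodule.span_le.mpr ?_)
  rintro _ ⟨j, rfl⟩
  rcases le_total (l j) 0 with h | h
  · simp only [min_eq_left h]
    exact hM (Submodule.subset_span ⟨j, rfl⟩)
  · simp only [min_eq_right h, zpow_zero, Units.val_one, one_smul]
    exact hN (Submodule.subset_span ⟨j, rfl⟩)

/-! ### Points over a pair of lattices -/

namespace IsTriplePoint

theorem bounded_minus' (h : IsTriplePoint i E Ep Em) : IsBounded Em E (omega n (i - 1)) :=
  isBounded_nuPlus_iff.mp h.bounded_minus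

theorem bounded_plus' (h : IsTriplePoint i E Ep Em) : IsBounded E Ep (omega n i) :=
  isBounded_nuMinus_iff.mp h.bounded_plus

theorem pullback (hϖ : Irreducible ϖ) (h : IsTriplePoint i E Ep Em) (f : R →ₐ[ResidueField O] R') :
    IsTriplePoint i (pullback f E) (pullback f Ep) (pullback f Em) where
  pair := h.pair.pullback hϖ f
  lattice := h.lattice.pullback hϖ f
  bounded_plus := h.bounded_plus.pullback f
  bounded_minus := h.bounded_minus.pullback f

variable (hϖ : Irreducible ϖ) (hn : 2 * i + 1 ≤ n) (h : IsTriplePoint i E Ep Em)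
include hϖ hn h

theorem minus_le : Em ≤ E :=
  h.bounded_minus'.le hϖ h.pair.lattice_minus h.lattice (by omega)

theorem le_plus : E ≤ Ep :=
  h.bounded_plus'.le hϖ h.lattice h.pair.lattice_plus (by omega)

section Index

variable {K : Type u} [Field K] [IsAlgClosed K] [Algebra (ResidueField O) K]
  (f : R →ₐ[ResidueField O] K) (hi : 1 ≤ i)
include hi

theorem hasIndex : HasIndex (Unitary.pullback f E) (trivialLattice p ϖ n K) 1 := by
  have := charP_of_algebra (ResidueField O) p K
  have := perfectRing_of_isAlgClosed K p
  have h1 := h.bounded_plus'.hasIndex f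
  rw [sum_omega (by omega)] at h1
  convert h1.trans hϖ (h.pair.hasIndex_plus hϖ hn f).symm using 1
  omega

theorem hasIndex_twist_dual :
    HasIndex (trivialLattice p ϖ n K) (Unitary.pullback f (twist (dual E))) 1 := by
  have := charP_of_algebra (ResidueField O) p K
  have := perfectRing_of_isAlgClosed K p
  have h1 := (h.bounded_plus'.twist_dual h.lattice h.pair.lattice_plus).hasIndex f
  rw [sum_omega (by omega)] at h1
  convert (h.pair.hasIndex_twist_dual_plus hϖ hn f).symm.trans hϖ h1 using 1
  omega

end Index

/-- The entries of the relative position are at most `1` since `ϖ 𝓔⁰ ≤ Em ≤ E`, at least `-1` since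
`ϖ E ≤ ϖ Ep ≤ 𝓔⁰`, and have sum `1`. As `E` and `𝓔⁰` lie in `Ep`, where `𝓔⁰` has index `i - 1`, at
most `i - 1` of them are negative. -/
theorem isBounded_trivial (hi : 1 ≤ i) :
    IsBounded E (trivialLattice p ϖ n R) (dualCochar (nu n i)) := fun K _ _ _ f => by
  have := charP_of_algebra (ResidueField O) p K
  have := perfectRing_of_isAlgClosed K p
  have hK := h.pullback hϖ f
  rw [pullback_trivialLattice]
  obtain ⟨l, hl, H⟩ := exists_hasRelPos hϖ hK.lattice (isLattice_trivialLattice hϖ)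
  refine ⟨l, hl, dominated_dualCochar_nu hi hn hl
    (H.le_one hϖ ((hK.pair.scale_trivial_le_minus hϖ hn).trans (hK.minus_le hϖ hn)))
    (fun j => ?_) (H.hasIndex.unique hϖ (h.hasIndex hϖ hn f hi))
    (H.nonneg_of_le hϖ (hK.le_plus hϖ hn) (hK.pair.trivial_le_plus hϖ hn)
      (h.pair.hasIndex_plus hϖ hn f)), H⟩
  have := H.scale.nonneg hϖ ((scale_mono (hK.le_plus hϖ hn)).trans
    (hK.pair.scale_plus_le_trivial hϖ hn)) j
  rw [Pi.add_apply, Pi.one_apply] at this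
  omega

end IsTriplePoint

namespace IsPreYPoint

theorem pullback (hϖ : Irreducible ϖ) (h : IsPreYPoint i E Ep Em) (f : R →ₐ[ResidueField O] R') :
    IsPreYPoint i (pullback f E) (pullback f Ep) (pullback f Em) where
  triple := h.triple.pullback hϖ f
  base := h.base.pullback hϖ f

variable (hϖ : Irreducible ϖ) (hn : 2 * i + 1 ≤ n) (h : IsPreYPoint i E Ep Em)
include hϖ hn h

theorem isResidueSubbundle : IsResidueSubbundle p ϖ R (toSub Ep Em E) (i - 1) i :=
  (isResidueSubbundle_toSub_iff (h.triple.minus_le hϖ hn) (h.triple.le_plus hϖ hn)).mpr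
    ⟨h.triple.bounded_minus'.isResidueBundle hϖ h.triple.pair.lattice_minus h.triple.lattice
      (by omega), h.triple.bounded_plus'.isResidueBundle hϖ h.triple.lattice
      h.triple.pair.lattice_plus (by omega)⟩

theorem toSub_pullback (f : R →ₐ[ResidueField O] R') :
    toSub (Unitary.pullback f Ep) (Unitary.pullback f Em) (Unitary.pullback f E) =
      pullbackQuot f (toSub Ep Em E) := by
  rw [pullbackQuot, ofSub_toSub (h.triple.minus_le hϖ hn) (h.triple.le_plus hϖ hn)]

/-- The middle inclusion `ϖ F(Em^∨) ≤ Em` is the last condition in `Y_i`. The result is both the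
lower bound for the modification `E ⇢ F(E^∨)` and the condition on `φ₂`. -/
theorem scale_twist_dual_le : scale (twist (dual E)) ≤ E :=
  ((scale_mono (twist_dual_anti (h.triple.minus_le hϖ hn))).trans h.base.scale_le).trans
    (h.triple.minus_le hϖ hn)

/-- The chain is `ϖ E ≤ ϖ Ep ≤ Em ≤ F(Ep^∨) ≤ F(E^∨)`. It is what makes the locus `E ≤ F(E^∨)`
closed. -/
theorem scale_le_twist_dual : scale E ≤ twist (dual E) :=
  ((scale_mono (h.triple.le_plus hϖ hn)).trans
    (h.triple.pair.scale_plus_le_minus hϖ hn)).trans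
    (h.base.minus_le.trans (twist_dual_anti (h.triple.le_plus hϖ hn)))

/-- `E` has index `1 + 1 = 2` in `F(E^∨)`, through `𝓔⁰`, and `ϖ F(E^∨) ≤ E` holds. Of the bound by
`ω_2` only the inclusion is left, and the bound relative to `𝓔⁰` is automatic. -/
theorem isXPoint_iff_le (hi : 1 ≤ i) : IsXPoint i E Ep Em ↔ E ≤ twist (dual E) := by
  have hF := (h.triple.lattice.dual hϖ).twist hϖ
  constructor
  · intro hX
    exact (isBounded_dualCochar_iff.mp hX.adlv.bounded_frob).le hϖ h.triple.lattice hF (by omega)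
  · intro hle
    refine ⟨h, h.triple.lattice, h.triple.isBounded_trivial hϖ hn hi,
      isBounded_dualCochar_iff.mpr (isBounded_omega_of_hasIndex hϖ h.triple.lattice hF hle
        (h.scale_twist_dual_le hϖ hn) fun K _ _ _ f => ?_)⟩
    have := charP_of_algebra (ResidueField O) p K
    have := perfectRing_of_isAlgClosed K p
    exact (h.triple.hasIndex hϖ hn f hi).trans hϖ (h.triple.hasIndex_twist_dual hϖ hn f hi)

theorem map_natMap_le_iff (h₁ : Ep ≤ twist (dual Em)) (h₂ : Em ≤ twist (dual Ep)) :
    (toSub Ep Em E).map (natMap h₁ h₂) ≤ twistSub (annihilator (toSub Ep Em E)) ↔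
      E ≤ twist (dual E) := by
  rw [annihilator_toSub (h.triple.minus_le hϖ hn) (h.triple.le_plus hϖ hn),
    twistSub_toSub (dual_anti (h.triple.le_plus hϖ hn)) (dual_anti (h.triple.minus_le hϖ hn))]
  exact map_natMap_toSub_le_iff h₁ h₂ (h.triple.le_plus hϖ hn)
    (twist_dual_anti (h.triple.le_plus hϖ hn))

theorem map_natMap_twistScaleSub_le (h₁ : trivialLattice p ϖ n R ≤ Ep)
    (h₂ : scale (trivialLattice p ϖ n R) ≤ Em) :
    (twistScaleSub (annihilator (toSub Ep Em E))).map (natMap h₁ h₂) ≤ toSub Ep Em E := by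
  rw [annihilator_toSub (h.triple.minus_le hϖ hn) (h.triple.le_plus hϖ hn), twistScaleSub,
    ofSub_toSub (dual_anti (h.triple.le_plus hϖ hn)) (dual_anti (h.triple.minus_le hϖ hn))]
  refine map_natMap_toSub_le h₁ h₂ ?_
  rw [twist_scale (h.triple.lattice.dual hϖ)]
  exact h.scale_twist_dual_le hϖ hn

theorem exists_ideal_isXPoint_pullback_iff (hi : 1 ≤ i) :
    ∃ I : Ideal R, ∀ (R' : Type u) [CommRing R'] [Algebra (ResidueField O) R'] [CharP R' p]
      [PerfectRing R' p] (f : R →ₐ[ResidueField O] R'),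
      IsXPoint i (Unitary.pullback f E) (Unitary.pullback f Ep) (Unitary.pullback f Em) ↔
        I ≤ RingHom.ker f := by
  obtain ⟨I, hI⟩ := exists_ideal_pullback_le_iff hϖ h.triple.lattice
    ((h.triple.lattice.dual hϖ).twist hϖ) (h.scale_le_twist_dual hϖ hn)
  refine ⟨I, fun R' _ _ _ _ f => ?_⟩
  rw [← hI R' f, (h.pullback hϖ f).isXPoint_iff_le hϖ hn hi, pullback_twist_dual f h.triple.lattice]

end IsPreYPoint

/-- Since `ϖ Ep ≤ Em`, any lattice between `Em` and `Ep` is in minuscule position to both, so the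
bounds amount to the two ranks. -/
theorem IsYPoint.isPreYPoint_ofSub (hϖ : Irreducible ϖ) (hn : 2 * i + 1 ≤ n)
    (h : IsYPoint i Ep Em) {W : Submodule (WO p O R) (SubQuot Ep Em)}
    (hW : IsResidueSubbundle p ϖ R W (i - 1) i) : IsPreYPoint i (ofSub W) Ep Em := by
  have hle := h.pair.minus_le_plus hϖ hn
  have hsc := h.pair.scale_plus_le_minus hϖ hn
  have h1 := le_ofSub hle W
  have h2 := ofSub_le W
  rw [← toSub_ofSub hle W, isResidueSubbundle_toSub_iff h1 h2] at hW
  have hL : IsLattice (ofSub W) :=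
    isLattice_of_projective hϖ h.pair.lattice_plus h2 (hsc.trans h1) hW.2.bundle.projective
  refine ⟨⟨h.pair, hL, isBounded_nuMinus_iff.mpr ?_, isBounded_nuPlus_iff.mpr ?_⟩, h⟩
  · exact (isBounded_omega_iff_bundle hϖ hL h.pair.lattice_plus (by omega)).mpr
      ⟨h2, hsc.trans h1, hW.2⟩
  · exact (isBounded_omega_iff_bundle hϖ h.pair.lattice_minus hL (by omega)).mpr
      ⟨h1, (scale_mono h2).trans hsc, hW.1⟩

/-- The points over a point of `Y_i` are the points of a Grassmannian. -/
theorem IsYPoint.bijOn_toSub (hϖ : Irreducible ϖ) (hn : 2 * i + 1 ≤ n) (h : IsYPoint i Ep Em) :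
    Set.BijOn (toSub Ep Em) {E | IsPreYPoint i E Ep Em}
      {W | IsResidueSubbundle p ϖ R W (i - 1) i} := by
  refine ⟨fun E hE => IsPreYPoint.isResidueSubbundle hϖ hn hE, fun E hE E' hE' heq => ?_,
    fun W hW => ⟨_, h.isPreYPoint_ofSub hϖ hn hW, toSub_ofSub (h.pair.minus_le_plus hϖ hn) W⟩⟩
  change IsPreYPoint i E Ep Em at hE
  change IsPreYPoint i E' Ep Em at hE'
  rw [← ofSub_toSub (hE.triple.minus_le hϖ hn) (hE.triple.le_plus hϖ hn), heq,
    ofSub_toSub (hE'.triple.minus_le hϖ hn) (hE'.triple.le_plus hϖ hn)]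

end TriplePoints

end Unitary

/-! ### The main theorem -/

open IsLocalRing Unitary in
theorem theorem7 {p : ℕ} [Fact p.Prime] {O : Type v} [CommRing O] [IsDomain O]
    [IsDiscreteValuationRing O] [IsAdicComplete (maximalIdeal O) O] [Finite (ResidueField O)]
    [CharP (ResidueField O) p] {ϖ : O} (hϖ : Irreducible ϖ)
    {n i : ℕ} (hi : 2 ≤ i) (hin : i ≤ (n - 1) / 2)
    {R : Type u} [CommRing R] [Algebra (ResidueField O) R] [CharP R p] [PerfectRing R p] :
    -- `Y_i` is the perfection of the Deligne-Lusztig variety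
    Set.BijOn
      (fun L : Submodule (WO p O R) (Amb p ϖ n R) × Submodule (WO p O R) (Amb p ϖ n R) =>
        (reduction (scale L.1), reduction L.2))
      {L | IsYPoint i L.1 L.2} {V | IsDLPoint (ResidueField O) i V.1 V.2} ∧
    (∀ Ep Em : Submodule (WO p O R) (Amb p ϖ n R), IsYPoint i Ep Em →
      ∀ (R' : Type u) [CommRing R'] [Algebra (ResidueField O) R'] [CharP R' p] [PerfectRing R' p]
        (f : R →ₐ[ResidueField O] R'),
        IsYPoint i (pullback f Ep) (pullback f Em) ∧
        reduction (scale (pullback f Ep)) = pullbackSub f (reduction (scale Ep)) ∧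
        reduction (pullback f Em) = pullbackSub f (reduction Em)) ∧
    ∀ (Ep Em : Submodule (WO p O R) (Amb p ϖ n R)) (hY : IsYPoint i Ep Em),
      -- `𝓥_i = Ep / Em` is a vector bundle of rank `2 i - 1`
      IsResidueBundle p ϖ R (SubQuot Ep Em) (2 * i - 1) ∧
      -- the points of `π₁⁻¹(Y_i)` over `(Ep, Em)` are the subbundles of `𝓥_i` of rank `i - 1`
      Set.BijOn (toSub Ep Em) {E | IsPreYPoint i E Ep Em}
        {W | IsResidueSubbundle p ϖ R W (i - 1) i} ∧
      ∀ E : Submodule (WO p O R) (Amb p ϖ n R), IsPreYPoint i E Ep Em →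
        (∀ (R' : Type u) [CommRing R'] [Algebra (ResidueField O) R'] [CharP R' p]
          [PerfectRing R' p] (f : R →ₐ[ResidueField O] R'),
          IsPreYPoint i (pullback f E) (pullback f Ep) (pullback f Em) ∧
          toSub (pullback f Ep) (pullback f Em) (pullback f E) =
            pullbackQuot f (toSub Ep Em E)) ∧
        -- `X_i` is defined in `π₁⁻¹(Y_i)` by `φ₁(W) ⊆ F(W^⊥)`
        (IsXPoint i E Ep Em ↔
          (toSub Ep Em E).map (natMap hY.plus_le hY.minus_le) ≤
            twistSub (annihilator (toSub Ep Em E))) ∧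
        -- `φ₂(F(ϖ W^⊥)) ⊆ W` holds automatically
        (∃ (h₁ : trivialLattice p ϖ n R ≤ Ep) (h₂ : scale (trivialLattice p ϖ n R) ≤ Em),
          twist (scale (dual Em)) ≤ trivialLattice p ϖ n R ∧
          twist (scale (dual Ep)) ≤ scale (trivialLattice p ϖ n R) ∧
          (twistScaleSub (annihilator (toSub Ep Em E))).map (natMap h₁ h₂) ≤ toSub Ep Em E) ∧
        -- `X_i` is closed in `π₁⁻¹(Y_i)`
        ∃ I : Ideal R, ∀ (R' : Type u) [CommRing R'] [Algebra (ResidueField O) R'] [CharP R' p]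
          [PerfectRing R' p] (f : R →ₐ[ResidueField O] R'),
          IsXPoint i (pullback f E) (pullback f Ep) (pullback f Em) ↔ I ≤ RingHom.ker f := by
  -- The truncated subtraction in `(n - 1) / 2` does no harm, as `2 ≤ i` excludes `n = 0`.
  have hn : 2 * i + 1 ≤ n := by omega
  refine ⟨bijOn_reduction hϖ hi hn, fun Ep Em hY R' _ _ _ _ f => ?_, fun Ep Em hY => ?_⟩
  · refine ⟨hY.pullback hϖ f, ?_,
      reduction_pullback hϖ f (hY.pair.minus_le_trivial hϖ hn)⟩
    rw [← pullback_scale f hY.pair.lattice_plus]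
    exact reduction_pullback hϖ f (hY.pair.scale_plus_le_trivial hϖ hn)
  · refine ⟨hY.pair.bounded_xi.isResidueBundle hϖ hY.pair.lattice_minus hY.pair.lattice_plus
      (by omega), hY.bijOn_toSub hϖ hn, fun E hE => ⟨fun R' _ _ _ _ f =>
        ⟨hE.pullback hϖ f, hE.toSub_pullback hϖ hn f⟩, ?_, ?_,
        hE.exists_ideal_isXPoint_pullback_iff hϖ hn (by omega)⟩⟩
    · rw [hE.map_natMap_le_iff hϖ hn, hE.isXPoint_iff_le hϖ hn (by omega)]
    · refine ⟨hY.pair.trivial_le_plus hϖ hn, hY.pair.scale_trivial_le_minus hϖ hn, ?_, ?_,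
        hE.map_natMap_twistScaleSub_le hϖ hn _ _⟩
      · rw [twist_scale (hY.pair.lattice_minus.dual hϖ)]
        exact hY.pair.scale_twist_dual_minus_le hϖ hn
      · rw [twist_scale (hY.pair.lattice_plus.dual hϖ)]
        exact scale_mono (hY.pair.twist_dual_plus_le hϖ hn)
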